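/- **Theorem (convergence of the $\theta$-scheme).** Let $N\ge 1$, $\sigma\in(0,2)$, $T>0$, $Q_T=\mathbb R^N\times(0,T]$ and $\theta\in[0,1]$. Consider the problem $$u_t-F\big(-(-\Delta)^{\sigma/2}u\big)=f(x,t)\ \text{ in } Q_T,\qquad u(x,0)=u_0(x)\ \text{ in }\mathbb R^N, \tag{1}$$ where $$-(-\Delta)^{\sigma/2}\phi(x)=\lim_{r\to0}\int_{|z|>r}\big(\phi(x+z)-\phi(x)\big)\frac{c\,dz}{|z|^{N+\sigma}},\qquad c=\frac{2^\sigma\Gamma(\frac{N+\sigma}2)}{\pi^{N/2}|\Gamma(-\frac\sigma2)|}.$$ Assume * (A1) $F:\mathbb R\to\mathbb R$ and $L_F\in\mathbb R$ satisfy $F(l_1)-F(l_2)\le L_F(l_1-l_2)^+$ for all $l_1,l_2\in\mathbb R$; * (A2) $f:\mathbb R^N\times[0,T]\to\mathbb R$ is bounded and its restriction to $Q_T$ is continuous, and $u_0:\mathbb R^N\to\mathbb R$ is bounded and continuous. A bounded viscosity subsolution of (1) is a bounded upper semicontinuous $u:\mathbb R^N\times[0,T]\to\mathbb R$ with $u(\cdot,0)\le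 u_0$ such that $\phi_t-F(-(-\Delta)^{\sigma/2}\phi)\le f$ at $(x_0,t_0)$ whenever $\phi$ is $C^2$ and bounded on $\mathbb R^N\times[0,T]$, and $u-\phi$ has a maximum over $\mathbb R^N\times[0,T]$ at $(x_0,t_0)\in Q_T$. Supersolutions are defined symmetrically, and a bounded viscosity solution is both. For $h>0$ let $\Delta_h\phi(x)=\sum_{k=1}^N h^{-2}\big(\phi(x+he_k)-2\phi(x)+\phi(x-he_k)\big)$ and, for bounded $\phi$, $$-(-\Delta_h)^{\sigma/2}\phi(x)=\frac1{|\Gamma(-\frac\sigma2)|}\int_0^\infty\big(e^{t\Delta_h}\phi(x)-\phi(x)\big)\frac{dt}{t^{1+\sigma/2}},\qquad e^{t\Delta_h}=\sum_{m\ge0}\frac{t^m}{m!}\Delta_h^m .$$ Let $$C_\sigma=\sum_{\mathbf j\in\mathbb Z^N\setminus\{0\}}\frac1{|\Gamma(-\frac\sigma2)|}\int_0^\infty e^{-2Nt}\prod_{i=1}^N I_{|\mathbf j_i|}(2t)\,\frac{dt}{t^{1+\sigma/2}},$$ where $I_m$ is the modified Bessel function of the first kind. With $\tau=T/M$, $M\in\{1,2,\dots\}$,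 $x_{\mathbf i}=h\mathbf i$, $t_n=n\tau$, the $\theta$-scheme is $U^0_{\mathbf i}=u_0(x_{\mathbf i})$ and, for $0\le n<M$ and $\mathbf i\in\mathbb Z^N$, $$U^{n+1}_{\mathbf i}=U^n_{\mathbf i}+\tau\Big[F\Big(-(1-\theta)(-\Delta_h)^{\sigma/2}U^n_{\mathbf i}-\theta(-\Delta_h)^{\sigma/2}U^{n+1}_{\mathbf i}\Big)+f(x_{\mathbf i},t_n)\Big]. \tag{2}$$ The scheme on the whole space asks, for a function $U_h$ on $\mathbb R^N\times[0,T]$, that $U_h(x,t)=u_0(x)$ for $t\in[0,\tau)$ and that, for all $x\in\mathbb R^N$ and $t\in[\tau,T]$, $$U_h(x,t)=U_h(x,t-\tau)+\tau\Big[F\Big(-(1-\theta)(-\Delta_h)^{\sigma/2}U_h(\cdot,t-\tau)(x)-\theta(-\Delta_h)^{\sigma/2}U_h(\cdot,t)(x)\Big)+f(x,t-\tau)\Big]. \tag{3}$$ Then: 1. For all $h>0$ and $M\ge1$, (2) has exactly one bounded solution, and so has (3). 2. Problem (1) has a bounded viscosity solution. 3. If $u$ is a bounded viscosity solution of (1),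 then the bounded solutions of (2) and of (3) converge to $u$ locally uniformly as $h\to0$ and $\tau\to0$ under the CFL condition $(1-\theta)\,\tau\,L_F\,C_\sigma\le h^{\sigma}$. That is, for all $R,\varepsilon>0$ there is $\delta>0$ such that, whenever $0<h<\delta$, $\tau=T/M<\delta$ and the CFL condition holds, $|U^n_{\mathbf i}-u(x_{\mathbf i},t_n)|\le\varepsilon$ for all $0\le n\le M$ and $|x_{\mathbf i}|\le R$, and $|U_h(x,t)-u(x,t)|\le\varepsilon$ for all $|x|\le R$ and $t\in[0,T]$. -/

import Mathlib

open Set Filter Topology MeasureTheory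

noncomputable section

namespace ThetaScheme

/-! ### The discrete Laplacian and its fractional powers

The operators act on functions on an additive group `G` along `N` increments `e k`. With
`G = ℝ^N`, `e k = h e_k` they act on functions on the whole space; with `G = ℤ^N` and `e k` the
`k`-th unit vector they act on functions on the grid `h ℤ^N`, written in terms of indices. -/

/-- The discrete Laplacian
`Δ_h φ(x) = ∑ₖ (φ(x + e k) - 2 φ(x) + φ(x - e k)) / h²`. -/
def discLap {N : ℕ} {G : Type*} [AddCommGroup G] (e : Fin N → G) (h : ℝ) (φ : G → ℝ) : G → ℝ :=
  fun x => ∑ k, (φ (x + e k) - 2 * φ x + φ (x - e k)) / h ^ 2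

/-- The semigroup `e^{t Δ_h} φ = ∑ₘ t^m / m! (Δ_h)^m φ`, i.e. the bounded solution of the
semi-discrete heat equation `∂ₜ U = Δ_h U`, `U(0) = φ` (`φ` bounded; `Δ_h` is then a bounded
operator for the supremum norm). -/
def discHeat {N : ℕ} {G : Type*} [AddCommGroup G] (e : Fin N → G) (h t : ℝ) (φ : G → ℝ) : G → ℝ :=
  fun x => ∑' m : ℕ, t ^ m / (m.factorial : ℝ) * ((discLap e h)^[m] φ) x

/-- The operator `-(-Δ_h)^{σ/2}`, namely
`-(-Δ_h)^{σ/2} φ(x) = 1/|Γ(-σ/2)| ∫₀^∞ (e^{t Δ_h} φ(x) - φ(x)) dt / t^{1+σ/2}`. -/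
def discFracLap {N : ℕ} {G : Type*} [AddCommGroup G] (e : Fin N → G) (h σ : ℝ) (φ : G → ℝ) :
    G → ℝ :=
  fun x => 1 / |Real.Gamma (-(σ / 2))| *
    ∫ t in Ioi (0 : ℝ), (discHeat e h t φ x - φ x) / t ^ (1 + σ / 2)

/-- The increments `h e_k` of the whole space `ℝ^N`. -/
def spaceStep (N : ℕ) (h : ℝ) (k : Fin N) : EuclideanSpace ℝ (Fin N) :=
  h • EuclideanSpace.single k (1 : ℝ)

/-- The increments `e_k` of the index set `ℤ^N`. -/
def indexStep (N : ℕ) (k : Fin N) : Fin N → ℤ := Pi.single k 1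

/-- The grid point `x_i = h i`, `i ∈ ℤ^N`. -/
def gridPoint {N : ℕ} (h : ℝ) (i : Fin N → ℤ) : EuclideanSpace ℝ (Fin N) :=
  WithLp.toLp 2 (fun k => h * (i k : ℝ))

/-! ### The weights and the constant in the CFL condition -/

/-- The modified Bessel function of the first kind `I_m`, `m ∈ ℕ`. -/
def besselI (m : ℕ) (x : ℝ) : ℝ :=
  ∑' k : ℕ, (x / 2) ^ (2 * k + m) / ((k.factorial : ℝ) * ((k + m).factorial : ℝ))

/-- `G(j, t) = e^{-2Nt} ∏ᵢ I_{|jᵢ|}(2t)`. -/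
def heatWeight {N : ℕ} (j : Fin N → ℤ) (t : ℝ) : ℝ :=
  Real.exp (-(2 * (N : ℝ) * t)) * ∏ i, besselI (j i).natAbs (2 * t)

/-- The weight `κ_{σ,h,j}` of `-(-Δ_h)^{σ/2}`. -/
def weight {N : ℕ} (σ h : ℝ) (j : Fin N → ℤ) : ℝ :=
  1 / h ^ σ * (1 / |Real.Gamma (-(σ / 2))|) *
    ∫ t in Ioi (0 : ℝ), heatWeight j t / t ^ (1 + σ / 2)

/-- The constant `C_σ = ∑_{j ≠ 0} κ_{σ,1,j}`, so that `∑_{j ≠ 0} κ_{σ,h,j} = C_σ / h^σ`. -/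
def cflConst (N : ℕ) (σ : ℝ) : ℝ :=
  ∑' j : {j : Fin N → ℤ // j ≠ 0}, weight σ 1 j.1

/-! ### The equation and its viscosity solutions -/

/-- The operator `-(-Δ)^{σ/2}` on `ℝ^N`:
`-(-Δ)^{σ/2} φ(x) = lim_{r → 0} ∫_{|z| > r} (φ(x+z) - φ(x)) c / |z|^{N+σ} dz`
with `c = 2^σ Γ((N+σ)/2) / (π^{N/2} |Γ(-σ/2)|)`. The limit exists for bounded `C²` functions. -/
def fracLap {N : ℕ} (σ : ℝ) (φ : EuclideanSpace ℝ (Fin N) → ℝ) (x : EuclideanSpace ℝ (Fin N)) :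
    ℝ :=
  limUnder (𝓝[>] (0 : ℝ)) fun r : ℝ =>
    ∫ z in {z : EuclideanSpace ℝ (Fin N) | r < ‖z‖},
      (φ (x + z) - φ x) *
        (2 ^ σ * Real.Gamma (((N : ℝ) + σ) / 2) /
            (Real.pi ^ ((N : ℝ) / 2) * |Real.Gamma (-(σ / 2))|) / ‖z‖ ^ ((N : ℝ) + σ))

/-- Boundedness of a function of `(x, t)` on `ℝ^N × [0, T]`. -/
def BoundedOnSlab {N : ℕ} (T : ℝ) (w : EuclideanSpace ℝ (Fin N) → ℝ → ℝ) : Prop :=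
  ∃ C : ℝ, ∀ x, ∀ t ∈ Icc (0 : ℝ) T, |w x t| ≤ C

/-- Test functions: `C²`, and bounded on `ℝ^N × [0, T]`. -/
def IsTestFunction {N : ℕ} (T : ℝ) (φ : EuclideanSpace ℝ (Fin N) → ℝ → ℝ) : Prop :=
  ContDiff ℝ 2 (Function.uncurry φ) ∧ BoundedOnSlab T φ

/-- Bounded upper semicontinuous viscosity subsolutions of
`u_t - F(-(-Δ)^{σ/2} u) = f` in `ℝ^N × (0, T]`, `u(·, 0) = u₀`. -/
structure IsViscositySubsolution {N : ℕ} (σ T : ℝ) (F : ℝ → ℝ)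
    (f : EuclideanSpace ℝ (Fin N) → ℝ → ℝ) (u₀ : EuclideanSpace ℝ (Fin N) → ℝ)
    (u : EuclideanSpace ℝ (Fin N) → ℝ → ℝ) : Prop where
  usc : UpperSemicontinuousOn (Function.uncurry u) (univ ×ˢ Icc (0 : ℝ) T)
  bounded : BoundedOnSlab T u
  initial : ∀ x, u x 0 ≤ u₀ x
  test : ∀ φ : EuclideanSpace ℝ (Fin N) → ℝ → ℝ, IsTestFunction T φ →
    ∀ x, ∀ t ∈ Ioc (0 : ℝ) T,
      (∀ y, ∀ s ∈ Icc (0 : ℝ) T, u y s - φ y s ≤ u x t - φ x t) →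
        deriv (φ x) t - F (fracLap σ (fun y => φ y t) x) ≤ f x t

/-- Bounded lower semicontinuous viscosity supersolutions of
`u_t - F(-(-Δ)^{σ/2} u) = f` in `ℝ^N × (0, T]`, `u(·, 0) = u₀`. -/
structure IsViscositySupersolution {N : ℕ} (σ T : ℝ) (F : ℝ → ℝ)
    (f : EuclideanSpace ℝ (Fin N) → ℝ → ℝ) (u₀ : EuclideanSpace ℝ (Fin N) → ℝ)
    (u : EuclideanSpace ℝ (Fin N) → ℝ → ℝ) : Prop where
  lsc : LowerSemicontinuousOn (Function.uncurry u) (univ ×ˢ Icc (0 : ℝ) T)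
  bounded : BoundedOnSlab T u
  initial : ∀ x, u₀ x ≤ u x 0
  test : ∀ φ : EuclideanSpace ℝ (Fin N) → ℝ → ℝ, IsTestFunction T φ →
    ∀ x, ∀ t ∈ Ioc (0 : ℝ) T,
      (∀ y, ∀ s ∈ Icc (0 : ℝ) T, u x t - φ x t ≤ u y s - φ y s) →
        f x t ≤ deriv (φ x) t - F (fracLap σ (fun y => φ y t) x)

/-- Bounded viscosity solutions; they are continuous on `ℝ^N × [0, T]` and equal `u₀` at `t = 0`. -/
def IsViscositySolution {N : ℕ} (σ T : ℝ) (F : ℝ → ℝ)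
    (f : EuclideanSpace ℝ (Fin N) → ℝ → ℝ) (u₀ : EuclideanSpace ℝ (Fin N) → ℝ)
    (u : EuclideanSpace ℝ (Fin N) → ℝ → ℝ) : Prop :=
  IsViscositySubsolution σ T F f u₀ u ∧ IsViscositySupersolution σ T F f u₀ u

/-! ### The θ-scheme -/

/-- Bounded solutions `U n i = U_i^n`, `0 ≤ n ≤ M`, `i ∈ ℤ^N`, of the θ-scheme on the grid
`h ℤ^N × {0, τ, …, M τ}`. -/
structure IsGridSolution {N : ℕ} (σ θ : ℝ) (F : ℝ → ℝ)
    (f : EuclideanSpace ℝ (Fin N) → ℝ → ℝ) (u₀ : EuclideanSpace ℝ (Fin N) → ℝ)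
    (h τ : ℝ) (M : ℕ) (U : ℕ → (Fin N → ℤ) → ℝ) : Prop where
  bounded : ∃ C : ℝ, ∀ n ≤ M, ∀ i, |U n i| ≤ C
  initial : ∀ i, U 0 i = u₀ (gridPoint h i)
  step : ∀ n < M, ∀ i,
    U (n + 1) i = U n i + τ *
      (F ((1 - θ) * discFracLap (indexStep N) h σ (U n) i
          + θ * discFracLap (indexStep N) h σ (U (n + 1)) i)
        + f (gridPoint h i) (n * τ))

/-- Bounded solutions of the θ-scheme extended to the whole space `ℝ^N × [0, T]`: the scheme is
imposed at every `(x, t)` with `t ∈ [τ, T]`, and `U = u₀` for `t ∈ [0, τ)`. -/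
structure IsSpaceSolution {N : ℕ} (σ θ T : ℝ) (F : ℝ → ℝ)
    (f : EuclideanSpace ℝ (Fin N) → ℝ → ℝ) (u₀ : EuclideanSpace ℝ (Fin N) → ℝ)
    (h τ : ℝ) (U : EuclideanSpace ℝ (Fin N) → ℝ → ℝ) : Prop where
  bounded : BoundedOnSlab T U
  initial : ∀ x, ∀ t ∈ Ico (0 : ℝ) τ, U x t = u₀ x
  step : ∀ x, ∀ t ∈ Icc τ T,
    U x t = U x (t - τ) + τ *
      (F ((1 - θ) * discFracLap (spaceStep N h) h σ (fun y => U y (t - τ)) x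
          + θ * discFracLap (spaceStep N h) h σ (fun y => U y t) x)
        + f x (t - τ))

end ThetaScheme

end

/-! The semigroup generated by the discrete Laplacian is convolution with the transition
probabilities of a continuous-time random walk, given by products of Bessel functions. Hence the
discrete operator is a jump operator with nonnegative weights and total rate K = C_σ / h^σ. Adding K
times the identity leaves a positive operator of norm at most K. Two facts about the scheme follow.
The implicit step is the fixed point of a relaxed map that contracts for every h and τ
(`abs_relaxMap_sub_le`), which gives existence and uniqueness without a CFL condition. Under the CFL
condition the explicit part is monotone as well, so the scheme can be tested at approximate maximum
points (`IsSpaceSolution.test_at_almost_max`), and this yields barriers independent of h and τ.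

Convergence follows the method of half-relaxed limits. Consistency (`tendsto_discFracLap`) is
probabilistic: by Lévy's continuity theorem the random walk converges to the Gaussian, subordination
turns the mixture of heat kernels into the kernel of the fractional Laplacian, and symmetric second
differences provide a dominating function C min(1, 2Nt) / t^(1+σ/2) that does not depend on h.
Stability and consistency make the upper half-relaxed limit a viscosity subsolution, and the
barriers give its initial values. The change of sign u ↦ -u, with F replaced by l ↦ -F(-l), turns
lower limits and supersolutions into upper limits and subsolutions, so every argument is carried out
from one side only.

Comparison (`IsViscositySubsolution.add_nonpos`) doubles the variables. The penalization |x -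
y|²/(2ε) is smooth but its nonlocal effect is of order 1/ε. Since the equation sees a test function
globally, that function may be replaced by the subsolution itself away from the contact point
(`IsViscositySubsolution.test_glue`). There the maximum property for the simultaneous shift (x+z,
y+z) leaves the penalization unchanged, and near the contact point the quadratic contributes an
amount that vanishes as the gluing region shrinks. What remains is a widely spread bump, negligible
for large R, and a difference of values of f at nearby points.

Comparison forces the upper and lower limits to coincide. This gives the existence of a solution and
the convergence of the whole-space scheme; the grid scheme follows because the whole-space solution
restricts to the grid solution. -/

namespace ThetaScheme
noncomputable section

/-! ### Bounded functions, translations and Bessel weights -/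

/-- Bounded real functions on a type. -/
def IsBddFun {G : Type*} (φ : G → ℝ) : Prop := ∃ C : ℝ, ∀ x, |φ x| ≤ C

/-- The Banach space of bounded real functions. -/
def BddFun (G : Type*) : Type _ := lp (fun _ : G => ℝ) ⊤

namespace BddFun
variable {G : Type*}

instance : NormedAddCommGroup (BddFun G) := inferInstanceAs (NormedAddCommGroup (lp (fun _ : G => ℝ) ⊤))
instance : NormedSpace ℝ (BddFun G) := inferInstanceAs (NormedSpace ℝ (lp (fun _ : G => ℝ) ⊤))
instance : CompleteSpace (BddFun G) := inferInstanceAs (CompleteSpace (lp (fun _ : G => ℝ) ⊤))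
instance : FunLike (BddFun G) G ℝ where
  coe φ := φ.1
  coe_injective _ _ h := Subtype.ext h

lemma abs_apply_le (φ : BddFun G) (x : G) : |φ x| ≤ ‖φ‖ :=
  lp.norm_apply_le_norm (E := fun _ : G => ℝ) (by simp) φ x

lemma norm_le {φ : BddFun G} {C : ℝ} (hC : 0 ≤ C) (h : ∀ x, |φ x| ≤ C) : ‖φ‖ ≤ C :=
  lp.norm_le_of_forall_le (E := fun _ : G => ℝ) hC h

lemma ext {φ ψ : BddFun G} (h : ∀ x, φ x = ψ x) : φ = ψ :=
  DFunLike.ext _ _ h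

@[simp] lemma add_apply (φ ψ : BddFun G) (x : G) : (φ + ψ) x = φ x + ψ x := rfl
@[simp] lemma sub_apply (φ ψ : BddFun G) (x : G) : (φ - ψ) x = φ x - ψ x := rfl
@[simp] lemma smul_apply (c : ℝ) (φ : BddFun G) (x : G) : (c • φ) x = c * φ x := rfl
@[simp] lemma zero_apply (x : G) : (0 : BddFun G) x = 0 := rfl

end BddFun

namespace IsBddFun
variable {G : Type*} {φ ψ : G → ℝ}

lemma memℓp (h : IsBddFun φ) : Memℓp φ ⊤ := by
  obtain ⟨C, hC⟩ := h
  refine memℓp_infty ⟨C, ?_⟩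
  rintro _ ⟨x, rfl⟩
  exact hC x

/-- A bounded function as a member of `BddFun`. -/
def toBddFun (h : IsBddFun φ) : BddFun G := ⟨φ, h.memℓp⟩

@[simp] lemma toBddFun_apply (h : IsBddFun φ) (x : G) : h.toBddFun x = φ x := rfl

lemma coe (φ : BddFun G) : IsBddFun (φ : G → ℝ) :=
  ⟨‖φ‖, φ.abs_apply_le⟩

lemma add (h : IsBddFun φ) (h' : IsBddFun ψ) : IsBddFun (fun x => φ x + ψ x) := by
  obtain ⟨C, hC⟩ := h
  obtain ⟨D, hD⟩ := h'
  exact ⟨C + D, fun x => (abs_add_le _ _).trans (add_le_add (hC x) (hD x))⟩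

lemma neg (h : IsBddFun φ) : IsBddFun (fun x => -φ x) := by
  obtain ⟨C, hC⟩ := h
  exact ⟨C, fun x => by simpa using hC x⟩

lemma sub (h : IsBddFun φ) (h' : IsBddFun ψ) : IsBddFun (fun x => φ x - ψ x) := by
  simpa [sub_eq_add_neg] using h.add h'.neg

lemma const_mul (c : ℝ) (h : IsBddFun φ) : IsBddFun (fun x => c * φ x) := by
  obtain ⟨C, hC⟩ := h
  exact ⟨|c| * C, fun x => by
    rw [abs_mul]; exact mul_le_mul_of_nonneg_left (hC x) (abs_nonneg c)⟩

lemma const (c : ℝ) : IsBddFun (fun _ : G => c) := ⟨|c|, fun _ => le_rfl⟩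

lemma comp {H : Type*} (h : IsBddFun φ) (g : H → G) : IsBddFun (fun x => φ (g x)) := by
  obtain ⟨C, hC⟩ := h
  exact ⟨C, fun x => hC _⟩

lemma exists_nonneg (h : IsBddFun φ) : ∃ C : ℝ, 0 ≤ C ∧ ∀ x, |φ x| ≤ C := by
  obtain ⟨C, hC⟩ := h
  exact ⟨max C 0, le_max_right _ _, fun x => (hC x).trans (le_max_left _ _)⟩

end IsBddFun

/-- Evaluation at a point. -/
def evalCLM {G : Type*} (x : G) : BddFun G →L[ℝ] ℝ :=
  LinearMap.mkContinuous
    { toFun := fun φ => φ x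
      map_add' := fun _ _ => rfl
      map_smul' := fun _ _ => rfl } 1 (fun φ => by
        rw [one_mul]; exact φ.abs_apply_le x)

@[simp] lemma evalCLM_apply {G : Type*} (x : G) (φ : BddFun G) : evalCLM x φ = φ x := rfl

variable {G : Type*} [AddCommGroup G]

/-- Translation of bounded functions. -/
def shiftCLM (v : G) : BddFun G →L[ℝ] BddFun G :=
  LinearMap.mkContinuous
    { toFun := fun φ => ((IsBddFun.coe φ).comp (fun x => x + v)).toBddFun
      map_add' := fun _ _ => rfl
      map_smul' := fun _ _ => rfl } 1 (fun φ => by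
        rw [one_mul]
        exact BddFun.norm_le (norm_nonneg _) fun x => φ.abs_apply_le (x + v))

@[simp] lemma shiftCLM_apply (v : G) (φ : BddFun G) (x : G) : shiftCLM v φ x = φ (x + v) := rfl

lemma commute_shiftCLM (v w : G) : Commute (shiftCLM v) (shiftCLM w) := by
  refine ContinuousLinearMap.ext fun φ => BddFun.ext fun x => ?_
  change φ (x + v + w) = φ (x + w + v)
  congr 1
  abel

lemma shiftCLM_pow_apply (v : G) (m : ℕ) (φ : BddFun G) (x : G) :
    (shiftCLM v ^ m) φ x = φ (x + m • v) := by
  induction m generalizing x with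
  | zero => simp
  | succ m ih =>
    rw [pow_succ']
    change (shiftCLM v ^ m) φ (x + v) = _
    rw [ih, succ_nsmul]
    congr 1
    abel

instance : NormedAlgebra ℚ (BddFun G →L[ℝ] BddFun G) :=
  NormedAlgebra.restrictScalars ℚ ℝ _

omit [AddCommGroup G] in
lemma hasSum_exp_smul_apply (t : ℝ) (A : BddFun G →L[ℝ] BddFun G) (φ : BddFun G) (x : G) :
    HasSum (fun m : ℕ => t ^ m / (m.factorial : ℝ) * (A ^ m) φ x) (NormedSpace.exp (t • A) φ x) := by
  have h := NormedSpace.exp_series_hasSum_exp' (𝕂 := ℝ) (t • A)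
  have h2 := ((evalCLM x).comp (ContinuousLinearMap.apply ℝ (BddFun G) φ)).hasSum h
  convert! h2 using 2 with m
  simp [smul_pow, div_eq_inv_mul, mul_assoc]

/-- Pairs of naturals, parametrized by their difference and their minimum. -/
def natPairEquiv : ℤ × ℕ ≃ ℕ × ℕ where
  toFun p := (p.2 + p.1.toNat, p.2 + (-p.1).toNat)
  invFun q := ((q.1 : ℤ) - q.2, min q.1 q.2)
  left_inv p := by ext <;> simp; omega
  right_inv q := by ext <;> (simp; omega)

/-- Exponents a and b with difference j and minimum k are k and k + |j| in some order, so their sum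
is 2k + |j|. The product of two exponential coefficients is therefore a term of the Bessel series,
and summing over k at fixed j produces I_|j|(2t). -/
lemma natPairEquiv_term (t : ℝ) (j : ℤ) (k : ℕ) :
    t ^ (natPairEquiv (j, k)).1 / ((natPairEquiv (j, k)).1.factorial : ℝ) *
      (t ^ (natPairEquiv (j, k)).2 / ((natPairEquiv (j, k)).2.factorial : ℝ)) =
    (2 * t / 2) ^ (2 * k + j.natAbs) / ((k.factorial : ℝ) * ((k + j.natAbs).factorial : ℝ)) := by
  simp only [natPairEquiv, Equiv.coe_fn_mk]
  rw [mul_div_cancel_left₀ t two_ne_zero, div_mul_div_comm, ← pow_add]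
  rcases le_total 0 j with hj | hj
  · have h1 : j.toNat = j.natAbs := by omega
    have h2 : (-j).toNat = 0 := by omega
    rw [h1, h2, add_zero, mul_comm (Nat.cast _)]
    congr 2; omega
  · have h1 : (-j).toNat = j.natAbs := by omega
    have h2 : j.toNat = 0 := by omega
    rw [h1, h2, add_zero]
    congr 2; omega

lemma summable_pow_div_factorial_prod {t : ℝ} (ht : 0 ≤ t) :
    Summable (fun q : ℕ × ℕ =>
      t ^ q.1 / (q.1.factorial : ℝ) * (t ^ q.2 / (q.2.factorial : ℝ))) :=
  (Real.summable_pow_div_factorial t).mul_of_nonneg (Real.summable_pow_div_factorial t)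
    (fun _ => by positivity) (fun _ => by positivity)

lemma summable_besselI_pairs {t : ℝ} (ht : 0 ≤ t) :
    Summable (fun p : ℤ × ℕ => (2 * t / 2) ^ (2 * p.2 + p.1.natAbs) /
      ((p.2.factorial : ℝ) * ((p.2 + p.1.natAbs).factorial : ℝ))) := by
  refine (natPairEquiv.summable_iff.mpr (summable_pow_div_factorial_prod ht)).congr ?_
  rintro ⟨j, k⟩
  exact (natPairEquiv_term t j k)

lemma hasSum_besselI {t : ℝ} (ht : 0 ≤ t) (j : ℤ) :
    HasSum (fun k : ℕ => (2 * t / 2) ^ (2 * k + j.natAbs) /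
      ((k.factorial : ℝ) * ((k + j.natAbs).factorial : ℝ))) (besselI j.natAbs (2 * t)) :=
  ((summable_besselI_pairs ht).prod_factor j).hasSum

lemma besselI_nonneg {t : ℝ} (ht : 0 ≤ t) (m : ℕ) : 0 ≤ besselI m (2 * t) :=
  tsum_nonneg fun k => by positivity

lemma one_le_besselI_zero {t : ℝ} (ht : 0 ≤ t) : 1 ≤ besselI 0 (2 * t) := by
  have h := hasSum_besselI ht 0
  have := h.summable.le_tsum 0 (fun k _ => by positivity)
  simpa [besselI] using this

lemma summable_besselI {t : ℝ} (ht : 0 ≤ t) :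
    Summable (fun j : ℤ => besselI j.natAbs (2 * t)) :=
  (summable_besselI_pairs ht).prod

/-- The generating function e^{t(S + S⁻¹)} = ∑ I_|j|(2t) S^j for the translation S by v: the two
exponentials commute, and their absolutely convergent double series is regrouped along the diagonals
a - b = j. -/
lemma hasSum_exp_shift_pair (v : G) {t : ℝ} (ht : 0 ≤ t) (φ : BddFun G) (x : G) :
    HasSum (fun j : ℤ => besselI j.natAbs (2 * t) * φ (x + j • v))
      (NormedSpace.exp (t • (shiftCLM v + shiftCLM (-v))) φ x) := by
  have hexp : NormedSpace.exp (t • (shiftCLM v + shiftCLM (-v))) =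
      NormedSpace.exp (t • shiftCLM v) * NormedSpace.exp (t • shiftCLM (-v)) := by
    rw [smul_add]
    exact NormedSpace.exp_add_of_commute
      (((commute_shiftCLM v (-v)).smul_left t).smul_right t)
  have hsum : Summable (fun q : ℕ × ℕ => t ^ q.1 / (q.1.factorial : ℝ) *
      (t ^ q.2 / (q.2.factorial : ℝ)) * φ (x + q.1 • v + q.2 • (-v))) := by
    refine Summable.of_norm_bounded ((summable_pow_div_factorial_prod ht).mul_right ‖φ‖) ?_
    intro q
    rw [norm_mul, Real.norm_of_nonneg (by positivity)]
    exact mul_le_mul_of_nonneg_left (BddFun.abs_apply_le φ _) (by positivity)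
  have h1 : HasSum (fun a : ℕ => t ^ a / (a.factorial : ℝ) *
      NormedSpace.exp (t • shiftCLM (-v)) φ (x + a • v))
      (NormedSpace.exp (t • (shiftCLM v + shiftCLM (-v))) φ x) := by
    rw [hexp]
    have := hasSum_exp_smul_apply t (shiftCLM v) (NormedSpace.exp (t • shiftCLM (-v)) φ) x
    simpa only [shiftCLM_pow_apply] using! this
  have h2 : HasSum (fun q : ℕ × ℕ => t ^ q.1 / (q.1.factorial : ℝ) *
      (t ^ q.2 / (q.2.factorial : ℝ)) * φ (x + q.1 • v + q.2 • (-v)))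
      (NormedSpace.exp (t • (shiftCLM v + shiftCLM (-v))) φ x) := by
    have h3 := hsum.hasSum.prod_fiberwise (g := fun a : ℕ => t ^ a / (a.factorial : ℝ) *
      NormedSpace.exp (t • shiftCLM (-v)) φ (x + a • v)) (fun a => by
        have := (hasSum_exp_smul_apply t (shiftCLM (-v)) φ (x + a • v)).mul_left
          (t ^ a / (a.factorial : ℝ))
        simpa only [shiftCLM_pow_apply, mul_assoc] using this)
    rw [← h3.unique h1]
    exact hsum.hasSum
  rw [← natPairEquiv.hasSum_iff] at h2
  refine h2.prod_fiberwise fun j => ?_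
  have := (hasSum_besselI ht j).mul_right (φ (x + j • v))
  convert! this using 2 with k
  simp only [Function.comp]
  rw [natPairEquiv_term]
  congr 2
  rw [add_assoc]
  congr 1
  simp only [natPairEquiv, Equiv.coe_fn_mk]
  rw [smul_neg, ← natCast_zsmul, ← natCast_zsmul, ← sub_eq_add_neg, ← sub_smul]
  congr 1
  omega

end
end ThetaScheme

/-! ### The discrete heat semigroup as a random walk -/

namespace ThetaScheme
noncomputable section
variable {G : Type*} [AddCommGroup G]

/-- The sum of the translations by `±e k`. -/
def neighborCLM {n : ℕ} (e : Fin n → G) : BddFun G →L[ℝ] BddFun G :=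
  ∑ k, (shiftCLM (e k) + shiftCLM (-e k))

/-- The lattice vector `∑ j k • e k`. -/
def latVec {n : ℕ} (e : Fin n → G) (j : Fin n → ℤ) : G := ∑ k, j k • e k

lemma commute_neighborCLM {n : ℕ} (e : Fin n → G) (v : G) :
    Commute (shiftCLM v + shiftCLM (-v)) (neighborCLM e) :=
  Commute.sum_right _ _ _ fun _ _ =>
    ((commute_shiftCLM _ _).add_right (commute_shiftCLM _ _)).add_left
      ((commute_shiftCLM _ _).add_right (commute_shiftCLM _ _))

lemma prod_besselI_nonneg {n : ℕ} {t : ℝ} (ht : 0 ≤ t) (j : Fin n → ℤ) :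
    0 ≤ ∏ i, besselI (j i).natAbs (2 * t) :=
  Finset.prod_nonneg fun _ _ => besselI_nonneg ht _

lemma summable_prod_besselI (n : ℕ) {t : ℝ} (ht : 0 ≤ t) :
    Summable (fun j : Fin n → ℤ => ∏ i, besselI (j i).natAbs (2 * t)) := by
  induction n with
  | zero => exact Summable.of_finite
  | succ n ih =>
    rw [← (Fin.consEquiv (fun _ : Fin (n + 1) => ℤ)).summable_iff]
    refine ((summable_besselI ht).mul_of_nonneg ih (fun j => besselI_nonneg ht _)
      (fun j => prod_besselI_nonneg ht j)).congr ?_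
    rintro ⟨j, j'⟩
    simp [Fin.consEquiv, Fin.prod_univ_succ]

lemma summable_prod_besselI_mul (n : ℕ) {t : ℝ} (ht : 0 ≤ t) {g : (Fin n → ℤ) → ℝ}
    (hg : IsBddFun g) : Summable (fun j : Fin n → ℤ => (∏ i, besselI (j i).natAbs (2 * t)) * g j) := by
  obtain ⟨C, hC⟩ := hg
  refine Summable.of_norm_bounded ((summable_prod_besselI n ht).mul_right C) fun j => ?_
  rw [norm_mul, Real.norm_of_nonneg (prod_besselI_nonneg ht j)]
  exact mul_le_mul_of_nonneg_left (hC j) (prod_besselI_nonneg ht j)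

/-- Translations in different directions commute, so the exponential factors over the coordinates;
induction on the number of directions multiplies the one-dimensional Bessel expansions. -/
lemma hasSum_exp_neighborCLM {n : ℕ} (e : Fin n → G) {t : ℝ} (ht : 0 ≤ t) (φ : BddFun G) (x : G) :
    HasSum (fun j : Fin n → ℤ => (∏ i, besselI (j i).natAbs (2 * t)) * φ (x + latVec e j))
      (NormedSpace.exp (t • neighborCLM e) φ x) := by
  induction n generalizing x with
  | zero =>
    have : neighborCLM e = 0 := by simp [neighborCLM]
    rw [this, smul_zero, NormedSpace.exp_zero]
    have h0 : ∀ j, latVec e j = 0 := fun j => by simp [latVec]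
    simp [h0]
  | succ n ih =>
    set e' : Fin n → G := fun k => e k.succ
    have hA : neighborCLM e = (shiftCLM (e 0) + shiftCLM (-e 0)) + neighborCLM e' := by
      simp [neighborCLM, Fin.sum_univ_succ, e']
    have hexp : NormedSpace.exp (t • neighborCLM e) =
        NormedSpace.exp (t • (shiftCLM (e 0) + shiftCLM (-e 0))) *
          NormedSpace.exp (t • neighborCLM e') := by
      rw [hA, smul_add]
      exact NormedSpace.exp_add_of_commute
        (((commute_neighborCLM e' (e 0)).smul_left t).smul_right t)
    have hs := (summable_prod_besselI_mul (n + 1) ht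
      ((IsBddFun.coe φ).comp (fun j => x + latVec e j)))
    have h1 := hasSum_exp_shift_pair (e 0) ht (NormedSpace.exp (t • neighborCLM e') φ) x
    have h2 := ((Fin.consEquiv (fun _ : Fin (n + 1) => ℤ)).hasSum_iff.mpr hs.hasSum).prod_fiberwise
      (g := fun j : ℤ => besselI j.natAbs (2 * t) *
        NormedSpace.exp (t • neighborCLM e') φ (x + j • e 0)) (fun j => by
        convert! (ih e' (x + j • e 0)).mul_left (besselI j.natAbs (2 * t)) using 2 with j'
        simp [Fin.consEquiv, Fin.prod_univ_succ, latVec, Fin.sum_univ_succ, e', mul_assoc,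
          add_assoc])
    have h3 := h2.unique h1
    rw [hexp]
    change HasSum _ (NormedSpace.exp (t • (shiftCLM (e 0) + shiftCLM (-e 0)))
      (NormedSpace.exp (t • neighborCLM e') φ) x)
    rw [← h3]
    exact hs.hasSum

/-- The discrete Laplacian as a bounded operator. -/
def lapCLM {n : ℕ} (e : Fin n → G) (h : ℝ) : BddFun G →L[ℝ] BddFun G :=
  (h ^ 2)⁻¹ • neighborCLM e + (-(2 * n / h ^ 2)) • 1

lemma lapCLM_apply {n : ℕ} (e : Fin n → G) (h : ℝ) (φ : BddFun G) (x : G) :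
    lapCLM e h φ x = discLap e h φ x := by
  have h1 : neighborCLM e φ x = ∑ k, (φ (x + e k) + φ (x - e k)) := by
    change evalCLM x ((∑ k, (shiftCLM (e k) + shiftCLM (-e k))) φ) = _
    rw [sum_apply, map_sum]
    simp [sub_eq_add_neg]
  change (h ^ 2)⁻¹ * neighborCLM e φ x + (-(2 * n / h ^ 2)) * φ x = _
  rw [h1, discLap, ← Finset.sum_div, Finset.sum_add_distrib, Finset.sum_add_distrib,
    Finset.sum_sub_distrib]
  simp
  ring

lemma lapCLM_pow_apply {n : ℕ} (e : Fin n → G) (h : ℝ) (m : ℕ) (φ : BddFun G) :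
    ⇑((lapCLM e h ^ m) φ) = (discLap e h)^[m] φ := by
  induction m with
  | zero => rfl
  | succ m ih =>
    rw [pow_succ', Function.iterate_succ_apply', ← ih]
    funext x
    exact lapCLM_apply e h _ x

lemma exp_lapCLM_apply {n : ℕ} (e : Fin n → G) (h t : ℝ) (φ : BddFun G) (x : G) :
    NormedSpace.exp (t • lapCLM e h) φ x = discHeat e h t φ x := by
  rw [discHeat, ← (hasSum_exp_smul_apply t (lapCLM e h) φ x).tsum_eq]
  simp_rw [lapCLM_pow_apply]

lemma heatWeight_nonneg {n : ℕ} (j : Fin n → ℤ) {t : ℝ} (ht : 0 ≤ t) : 0 ≤ heatWeight j t :=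
  mul_nonneg (Real.exp_nonneg _) (prod_besselI_nonneg ht j)

lemma heatWeight_neg {n : ℕ} (j : Fin n → ℤ) (t : ℝ) : heatWeight (-j) t = heatWeight j t := by
  simp [heatWeight]

/-- The discrete heat semigroup is the convolution with the heat weights. -/
lemma hasSum_discHeat {n : ℕ} (e : Fin n → G) {h t : ℝ} (ht : 0 ≤ t) {φ : G → ℝ}
    (hφ : IsBddFun φ) (x : G) :
    HasSum (fun j : Fin n → ℤ => heatWeight j (t / h ^ 2) * φ (x + latVec e j))
      (discHeat e h t φ x) := by
  have ht' : 0 ≤ t / h ^ 2 := by positivity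
  have h1 : NormedSpace.exp (t • lapCLM e h) =
      Real.exp (-(2 * n * (t / h ^ 2))) • NormedSpace.exp ((t / h ^ 2) • neighborCLM e) := by
    -- The diagonal part of the Laplacian is a scalar operator. It commutes with everything and
    -- contributes the factor e^{-2nt/h²} of the heat weight.
    have : t • lapCLM e h = (t / h ^ 2) • neighborCLM e +
        algebraMap ℝ (BddFun G →L[ℝ] BddFun G) (-(2 * n * (t / h ^ 2))) := by
      rw [lapCLM, smul_add, smul_smul, smul_smul, Algebra.algebraMap_eq_smul_one]
      congr 2
      ring
    rw [this, NormedSpace.exp_add_of_commute (Algebra.commutes _ _).symm,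
      ← NormedSpace.algebraMap_exp_comm, ← Algebra.commutes, ← Algebra.smul_def,
      Real.exp_eq_exp_ℝ]
  have h2 := (hasSum_exp_neighborCLM e ht' hφ.toBddFun x).mul_left
    (Real.exp (-(2 * n * (t / h ^ 2))))
  have h3 := exp_lapCLM_apply e h t hφ.toBddFun x
  rw [h1] at h3
  change Real.exp (-(2 * n * (t / h ^ 2))) *
    NormedSpace.exp ((t / h ^ 2) • neighborCLM e) hφ.toBddFun x = discHeat e h t φ x at h3
  rw [h3] at h2
  convert! h2 using 2 with j
  rw [heatWeight, mul_assoc]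
  rfl

lemma discHeat_const {n : ℕ} (e : Fin n → G) (h t c : ℝ) (x : G) :
    discHeat e h t (fun _ => c) x = c := by
  have h0 : discLap e h (fun _ : G => c) = fun _ => 0 := by
    funext y; simp [discLap]; right; left; ring
  have h1 : ∀ m : ℕ, (discLap e h)^[m + 1] (fun _ : G => c) = fun _ => 0 := by
    intro m
    induction m with
    | zero => exact h0
    | succ m ih => rw [Function.iterate_succ_apply', ih]; funext y; simp [discLap]
  rw [discHeat, tsum_eq_single 0]
  · simp
  · intro m hm
    obtain ⟨k, rfl⟩ := Nat.exists_eq_succ_of_ne_zero hm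
    rw [Nat.succ_eq_add_one, h1, mul_zero]

/-- The semigroup preserves constants. The weights depend neither on the group nor on the
increments, so the convolution formula may be read on ℤ with zero increments. -/
lemma hasSum_heatWeight (n : ℕ) {t : ℝ} (ht : 0 ≤ t) :
    HasSum (fun j : Fin n → ℤ => heatWeight j t) 1 := by
  have := hasSum_discHeat (fun _ : Fin n => (0 : ℤ)) (h := 1) ht (IsBddFun.const (1 : ℝ)) 0
  rw [discHeat_const] at this
  simpa using this

lemma heatWeight_zero_le_one (n : ℕ) {t : ℝ} (ht : 0 ≤ t) : heatWeight (0 : Fin n → ℤ) t ≤ 1 := by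
  have h := hasSum_heatWeight n ht
  rw [← h.tsum_eq]
  exact h.summable.le_tsum 0 fun j _ => heatWeight_nonneg j ht

/-- The probability that the random walk has left its starting point. -/
def leaveProb (n : ℕ) (t : ℝ) : ℝ := 1 - heatWeight (0 : Fin n → ℤ) t

lemma leaveProb_nonneg (n : ℕ) {t : ℝ} (ht : 0 ≤ t) : 0 ≤ leaveProb n t :=
  sub_nonneg.mpr (heatWeight_zero_le_one n ht)

lemma leaveProb_le_one (n : ℕ) {t : ℝ} (ht : 0 ≤ t) : leaveProb n t ≤ 1 := by
  have := heatWeight_nonneg (0 : Fin n → ℤ) ht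
  unfold leaveProb
  linarith

/-- Since I_0 ≥ 1, the walk stays put with probability at least e^{-2nt} ≥ 1 - 2nt. The linear bound
makes the singularity of t^{-1-σ/2} at 0 integrable. -/
lemma leaveProb_le (n : ℕ) {t : ℝ} (ht : 0 ≤ t) : leaveProb n t ≤ 2 * n * t := by
  have h1 : Real.exp (-(2 * n * t)) ≤ heatWeight (0 : Fin n → ℤ) t := by
    refine le_mul_of_one_le_right (Real.exp_nonneg _) ?_
    rw [← Finset.prod_const_one (s := (Finset.univ : Finset (Fin n)))]
    exact Finset.prod_le_prod (fun _ _ => zero_le_one) fun i _ => one_le_besselI_zero ht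
  have h2 := Real.add_one_le_exp (-(2 * n * t))
  unfold leaveProb
  linarith

variable {n : ℕ} (e : Fin n → G)

lemma discHeat_add (h : ℝ) {t : ℝ} (ht : 0 ≤ t) {φ ψ : G → ℝ} (hφ : IsBddFun φ) (hψ : IsBddFun ψ)
    (x : G) : discHeat e h t (fun y => φ y + ψ y) x = discHeat e h t φ x + discHeat e h t ψ x := by
  refine (hasSum_discHeat e ht (hφ.add hψ) x).unique ?_
  simpa only [mul_add] using (hasSum_discHeat e ht hφ x).add (hasSum_discHeat e ht hψ x)

lemma discHeat_const_mul (h : ℝ) {t : ℝ} (ht : 0 ≤ t) {φ : G → ℝ} (hφ : IsBddFun φ) (c : ℝ)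
    (x : G) : discHeat e h t (fun y => c * φ y) x = c * discHeat e h t φ x := by
  refine (hasSum_discHeat e ht (hφ.const_mul c) x).unique ?_
  simpa only [mul_left_comm] using (hasSum_discHeat e ht hφ x).mul_left c

lemma discHeat_mono (h : ℝ) {t : ℝ} (ht : 0 ≤ t) {φ ψ : G → ℝ} (hφ : IsBddFun φ) (hψ : IsBddFun ψ)
    (hle : ∀ y, φ y ≤ ψ y) (x : G) : discHeat e h t φ x ≤ discHeat e h t ψ x :=
  hasSum_le (fun j => mul_le_mul_of_nonneg_left (hle _) (heatWeight_nonneg j (by positivity)))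
    (hasSum_discHeat e ht hφ x) (hasSum_discHeat e ht hψ x)

/-- The discrete heat semigroup at a point where a nonnegative function is known. -/
lemma le_discHeat_of_nonneg (h : ℝ) {t : ℝ} (ht : 0 ≤ t) {φ : G → ℝ} (hφ : IsBddFun φ)
    (hpos : ∀ y, 0 ≤ φ y) (x : G) :
    φ x - leaveProb n (t / h ^ 2) * φ x ≤ discHeat e h t φ x := by
  have h1 := hasSum_discHeat e (h := h) ht hφ x
  have h2 := h1.summable.le_tsum 0 fun j _ =>
    mul_nonneg (heatWeight_nonneg j (by positivity)) (hpos _)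
  rw [h1.tsum_eq] at h2
  simp only [latVec, Pi.zero_apply, zero_smul, Finset.sum_const_zero, add_zero] at h2
  unfold leaveProb
  linarith

/-- Comparison of increments of the heat semigroup for ordered functions. -/
lemma discHeat_sub_le (h : ℝ) {t : ℝ} (ht : 0 ≤ t) {U φ : G → ℝ} (hU : IsBddFun U)
    (hφ : IsBddFun φ) {ξ : ℝ} (hle : ∀ y, U y ≤ φ y + ξ) (x : G) :
    discHeat e h t U x - U x ≤
      discHeat e h t φ x - φ x + leaveProb n (t / h ^ 2) * (φ x + ξ - U x) := by
  have hb : IsBddFun (fun y => φ y + ξ - U y) := (hφ.add (IsBddFun.const ξ)).sub hU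
  have h1 := le_discHeat_of_nonneg e h ht hb (fun y => by linarith [hle y]) x
  have h2 : discHeat e h t (fun y => φ y + ξ - U y) x =
      discHeat e h t φ x + ξ - discHeat e h t U x := by
    refine (hasSum_discHeat e ht hb x).unique ?_
    have := ((hasSum_discHeat e (h := h) ht hφ x).add
      (hasSum_discHeat e (h := h) ht (IsBddFun.const ξ) x)).sub (hasSum_discHeat e (h := h) ht hU x)
    rw [discHeat_const] at this
    simpa only [mul_add, mul_sub] using this
  linarith

lemma abs_discHeat_sub_le (h : ℝ) {t : ℝ} (ht : 0 ≤ t) {φ : G → ℝ} {C : ℝ} (hC : ∀ y, |φ y| ≤ C)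
    (x : G) : |discHeat e h t φ x - φ x| ≤ 2 * C * leaveProb n (t / h ^ 2) := by
  have hφ : IsBddFun φ := ⟨C, hC⟩
  have h0 := IsBddFun.const (G := G) (0 : ℝ)
  have hl := leaveProb_nonneg n (t := t / h ^ 2) (by positivity)
  -- The function is compared with zero from both sides, the gap being at most C.
  have h1 := discHeat_sub_le e h ht hφ h0 (ξ := C) (fun y => by linarith [(abs_le.mp (hC y)).2]) x
  have h2 := discHeat_sub_le e h ht h0 hφ (ξ := C) (fun y => by linarith [(abs_le.mp (hC y)).1]) x
  rw [discHeat_const] at h1 h2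
  have h3 := abs_le.mp (hC x)
  rw [abs_le]
  constructor <;> nlinarith

lemma hasDerivAt_discHeat (h t : ℝ) {φ : G → ℝ} (hφ : IsBddFun φ) (x : G) :
    HasDerivAt (fun s => discHeat e h s φ x) (discHeat e h t (discLap e h φ) x) t := by
  have h1 := hasDerivAt_exp_smul_const (lapCLM e h) t
  have h2 := ((evalCLM x).comp
    (ContinuousLinearMap.apply ℝ (BddFun G) hφ.toBddFun)).hasFDerivAt.comp_hasDerivAt t h1
  convert! h2 using 1
  · funext s
    exact (exp_lapCLM_apply e h s hφ.toBddFun x).symm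
  · have h3 := exp_lapCLM_apply e h t (lapCLM e h hφ.toBddFun) x
    rw [show ⇑(lapCLM e h hφ.toBddFun) = discLap e h φ from
      funext fun y => lapCLM_apply e h hφ.toBddFun y] at h3
    exact h3.symm

lemma IsBddFun.discLap {φ : G → ℝ} (hφ : IsBddFun φ) (h : ℝ) : IsBddFun (discLap e h φ) := by
  have := IsBddFun.coe (lapCLM e h hφ.toBddFun)
  rwa [show ⇑(lapCLM e h hφ.toBddFun) = ThetaScheme.discLap e h φ from
      funext fun y => lapCLM_apply e h hφ.toBddFun y] at this

lemma discHeat_zero (h : ℝ) (φ : G → ℝ) (x : G) : discHeat e h 0 φ x = φ x := by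
  rw [discHeat, tsum_eq_single 0]
  · simp
  · intro m hm
    simp [hm]

lemma continuous_discHeat (h : ℝ) {φ : G → ℝ} (hφ : IsBddFun φ) (x : G) :
    Continuous (fun t => discHeat e h t φ x) :=
  continuous_iff_continuousAt.mpr fun t => (hasDerivAt_discHeat e h t hφ x).continuousAt

/-- An upper bound of the discrete Laplacian bounds the growth of the heat semigroup. -/
lemma discHeat_sub_le_of_discLap_le (h : ℝ) {t : ℝ} (ht : 0 ≤ t) {φ : G → ℝ} (hφ : IsBddFun φ)
    {A : ℝ} (hA : ∀ y, ThetaScheme.discLap e h φ y ≤ A) (x : G) :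
    discHeat e h t φ x - φ x ≤ A * t := by
  have h1 := (convex_Icc (0 : ℝ) t).image_sub_le_mul_sub_of_deriv_le
    (f := fun s => discHeat e h s φ x) (C := A)
    (continuous_discHeat e h hφ x).continuousOn
    (fun s _ => (hasDerivAt_discHeat e h s hφ x).differentiableAt.differentiableWithinAt)
    (fun s hs => by
      rw [interior_Icc] at hs
      rw [(hasDerivAt_discHeat e h s hφ x).deriv, ← discHeat_const e h s A x]
      exact discHeat_mono e h hs.1.le (hφ.discLap e h) (IsBddFun.const A) hA x)
    0 ⟨le_rfl, ht⟩ t ⟨ht, le_rfl⟩ ht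
  simpa [discHeat_zero] using h1

end
end ThetaScheme

/-! ### The discrete fractional Laplacian and its jump rate -/

namespace ThetaScheme
noncomputable section

/-- The normalizing constant `1 / |Γ(-σ/2)|`. -/
def gammaConst (σ : ℝ) : ℝ := 1 / |Real.Gamma (-(σ / 2))|

lemma gammaConst_pos {σ : ℝ} (hσ : σ ∈ Ioo (0 : ℝ) 2) : 0 < gammaConst σ := by
  refine one_div_pos.mpr (abs_pos.mpr (Real.Gamma_ne_zero fun m hm => ?_))
  have h1 : σ / 2 = m := by linarith
  have h2 : (0 : ℝ) < m := by linarith [hσ.1]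
  have h3 : (m : ℝ) < 1 := by linarith [hσ.2]
  have h4 : 0 < m := by exact_mod_cast h2
  have h5 : m < 1 := by exact_mod_cast h3
  omega

/-- Near 0 the integrand is at most c t^{-σ/2}, integrable because σ < 2; at infinity it is at most
t^{-1-σ/2}, integrable because σ > 0. Every time integral below is dominated by a function of this
type. -/
lemma integrableOn_min_div_rpow {σ : ℝ} (hσ : σ ∈ Ioo (0 : ℝ) 2) {c : ℝ} (hc : 0 ≤ c) :
    IntegrableOn (fun t : ℝ => min 1 (c * t) / t ^ (1 + σ / 2)) (Ioi 0) := by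
  have hm : Measurable (fun t : ℝ => min 1 (c * t) / t ^ (1 + σ / 2)) := by fun_prop
  rw [← Ioc_union_Ioi_eq_Ioi zero_le_one, integrableOn_union]
  constructor
  · have h1 : IntegrableOn (fun t : ℝ => c * t ^ (-(σ / 2))) (Ioc 0 1) := by
      have := (intervalIntegral.intervalIntegrable_rpow' (a := 0) (b := 1) (r := -(σ / 2))
        (by linarith [hσ.2])).const_mul c
      rwa [intervalIntegrable_iff_integrableOn_Ioc_of_le zero_le_one] at this
    refine Integrable.mono' h1 hm.aestronglyMeasurable ?_
    filter_upwards [ae_restrict_mem measurableSet_Ioc] with t ht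
    have ht0 : 0 < t := ht.1
    have hct : 0 ≤ c * t := by positivity
    rw [Real.norm_of_nonneg (div_nonneg (le_min zero_le_one hct) (by positivity)),
      div_le_iff₀ (by positivity), mul_assoc, ← Real.rpow_add ht0,
      show -(σ / 2) + (1 + σ / 2) = 1 by ring, Real.rpow_one]
    exact min_le_right _ _
  · refine Integrable.mono' (integrableOn_Ioi_rpow_of_lt (a := -(1 + σ / 2)) (c := 1)
      (by linarith [hσ.1]) one_pos) hm.aestronglyMeasurable ?_
    filter_upwards [ae_restrict_mem measurableSet_Ioi] with t ht
    have ht0 : 0 < t := one_pos.trans ht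
    have hct : 0 ≤ c * t := by positivity
    rw [Real.norm_of_nonneg (div_nonneg (le_min zero_le_one hct) (by positivity)),
      Real.rpow_neg ht0.le, ← one_div]
    gcongr
    exact min_le_left _ _

/-- The weight is the semigroup applied to the indicator of a lattice point. Its measurability in
time then follows from the differentiability of the semigroup rather than from the Bessel series. -/
lemma heatWeight_eq_discHeat {n : ℕ} (j : Fin n → ℤ) {t : ℝ} (ht : 0 ≤ t) :
    heatWeight j t = discHeat (indexStep n) 1 t (fun i => if i = j then 1 else 0) 0 := by
  have hb : IsBddFun (fun i : Fin n → ℤ => if i = j then (1 : ℝ) else 0) :=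
    ⟨1, fun i => by by_cases h : i = j <;> simp [h]⟩
  have h1 := hasSum_discHeat (indexStep n) (h := 1) ht hb 0
  have h2 : ∀ i : Fin n → ℤ, latVec (indexStep n) i = i := by
    intro i
    funext k
    simp [latVec, indexStep, Finset.sum_apply, Pi.single_apply]
  refine HasSum.unique ?_ h1
  simp only [h2, zero_add, one_pow, div_one]
  convert! hasSum_ite_eq j (heatWeight j t) using 2 with i
  by_cases hi : i = j <;> simp [hi]

lemma aestronglyMeasurable_heatWeight {n : ℕ} (j : Fin n → ℤ) :
    AEStronglyMeasurable (fun t => heatWeight j t) (volume.restrict (Ioi (0 : ℝ))) := by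
  have hb : IsBddFun (fun i : Fin n → ℤ => if i = j then (1 : ℝ) else 0) :=
    ⟨1, fun i => by by_cases h : i = j <;> simp [h]⟩
  refine (continuous_discHeat (indexStep n) 1 hb 0).aestronglyMeasurable.congr ?_
  filter_upwards [ae_restrict_mem measurableSet_Ioi] with t ht
  exact (heatWeight_eq_discHeat j (le_of_lt ht)).symm

variable {σ : ℝ} (n : ℕ)

lemma integrableOn_leaveProb (hσ : σ ∈ Ioo (0 : ℝ) 2) (h : ℝ) :
    IntegrableOn (fun t : ℝ => leaveProb n (t / h ^ 2) / t ^ (1 + σ / 2)) (Ioi 0) := by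
  -- For h = 0 the quotient t / h² takes the default value 0, where the leaving probability
  -- vanishes.
  rcases eq_or_ne h 0 with rfl | hh
  · have h0 : leaveProb n 0 = 0 := le_antisymm (by simpa using leaveProb_le n le_rfl)
      (leaveProb_nonneg n le_rfl)
    simp [h0]
  have h2 : 0 < h ^ 2 := by positivity
  refine Integrable.mono' (integrableOn_min_div_rpow hσ (c := 2 * n / h ^ 2) (by positivity)) ?_ ?_
  · have hm : AEStronglyMeasurable (fun t => leaveProb n (t / h ^ 2))
        (volume.restrict (Ioi (0 : ℝ))) := by
      have hb : IsBddFun (fun i : Fin n → ℤ => if i = 0 then (1 : ℝ) else 0) :=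
        ⟨1, fun i => by by_cases h : i = 0 <;> simp [h]⟩
      refine AEStronglyMeasurable.congr (f := fun t => 1 - discHeat (indexStep n) 1 (t / h ^ 2)
        (fun i => if i = 0 then 1 else 0) 0) ?_ ?_
      · exact (continuous_const.sub ((continuous_discHeat (indexStep n) 1 hb 0).comp
          (continuous_id.div_const _))).aestronglyMeasurable
      · filter_upwards [ae_restrict_mem measurableSet_Ioi] with t ht
        rw [leaveProb, heatWeight_eq_discHeat 0 (div_nonneg (le_of_lt ht) h2.le)]
    exact (hm.aemeasurable.div
      (by fun_prop : Measurable fun t : ℝ => t ^ (1 + σ / 2)).aemeasurable).aestronglyMeasurable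
  · filter_upwards [ae_restrict_mem measurableSet_Ioi] with t ht
    have ht0 : 0 < t := ht
    have hq : 0 ≤ t / h ^ 2 := by positivity
    rw [Real.norm_of_nonneg (div_nonneg (leaveProb_nonneg n hq) (by positivity))]
    gcongr
    refine le_min (leaveProb_le_one n hq) ?_
    calc leaveProb n (t / h ^ 2) ≤ 2 * n * (t / h ^ 2) := leaveProb_le n hq
      _ = 2 * n / h ^ 2 * t := by ring

/-- The total jump rate `∑_{j ≠ 0} κ_{σ,h,j}`. -/
def jumpRate (σ h : ℝ) : ℝ :=
  gammaConst σ * ∫ t in Ioi (0 : ℝ), leaveProb n (t / h ^ 2) / t ^ (1 + σ / 2)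

lemma jumpRate_nonneg (hσ : σ ∈ Ioo (0 : ℝ) 2) (h : ℝ) : 0 ≤ jumpRate n σ h :=
  mul_nonneg (gammaConst_pos hσ).le (setIntegral_nonneg measurableSet_Ioi fun t ht => by
    have ht0 : 0 < t := ht
    exact div_nonneg (leaveProb_nonneg n (by positivity)) (by positivity))

/-- The weights with j ≠ 0 sum to the leaving probability for each t. Positivity and the integrable
majorant `leaveProb` allow the sum over j and the integral over t to be exchanged. -/
lemma jumpRate_one (hσ : σ ∈ Ioo (0 : ℝ) 2) : jumpRate n σ 1 = cflConst n σ := by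
  have hint := integrableOn_leaveProb n hσ 1
  simp only [one_pow, div_one] at hint
  have hsub : ∀ t : ℝ, 0 ≤ t →
      HasSum (fun j : {j : Fin n → ℤ // j ≠ 0} => heatWeight j.1 t) (leaveProb n t) := by
    intro t ht
    have h1 := hasSum_heatWeight n ht
    have h2 := hasSum_ite_eq (0 : Fin n → ℤ) (heatWeight (0 : Fin n → ℤ) t)
    have h3 := h1.sub h2
    have h4 : Function.support (fun j : Fin n → ℤ => heatWeight j t -
        if j = 0 then heatWeight (0 : Fin n → ℤ) t else 0) ⊆ {j | j ≠ 0} := by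
      intro j hj h0
      subst h0
      simp at hj
    have h5 := (hasSum_subtype_iff_of_support_subset h4).mpr h3
    have h6 : (fun j : Fin n → ℤ => heatWeight j t -
        if j = 0 then heatWeight (0 : Fin n → ℤ) t else 0) ∘ Subtype.val =
        fun j : {j : Fin n → ℤ // j ≠ 0} => heatWeight j.1 t := by
      funext j
      simp [j.2]
    rw [← h6]
    exact h5
  have hterm : ∀ j : {j : Fin n → ℤ // j ≠ 0},
      IntegrableOn (fun t => heatWeight j.1 t / t ^ (1 + σ / 2)) (Ioi 0) := by
    intro j
    refine Integrable.mono' hint ((aestronglyMeasurable_heatWeight j.1).aemeasurable.div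
      (by fun_prop : Measurable fun t : ℝ => t ^ (1 + σ / 2)).aemeasurable).aestronglyMeasurable ?_
    filter_upwards [ae_restrict_mem measurableSet_Ioi] with t ht
    have ht0 : 0 < t := ht
    rw [Real.norm_of_nonneg (div_nonneg (heatWeight_nonneg _ ht0.le) (by positivity))]
    gcongr
    have h1 := hsub t ht0.le
    rw [← h1.tsum_eq]
    exact h1.summable.le_tsum j fun j _ => heatWeight_nonneg _ ht0.le
  have hnorm : ∀ j : {j : Fin n → ℤ // j ≠ 0},
      (∫ t in Ioi (0 : ℝ), ‖heatWeight j.1 t / t ^ (1 + σ / 2)‖) =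
        ∫ t in Ioi (0 : ℝ), heatWeight j.1 t / t ^ (1 + σ / 2) := by
    intro j
    refine setIntegral_congr_fun measurableSet_Ioi fun t ht => ?_
    have ht0 : 0 < t := ht
    exact Real.norm_of_nonneg (div_nonneg (heatWeight_nonneg _ ht0.le) (by positivity))
  have hsum := hasSum_integral_of_summable_integral_norm hterm (by
    simp_rw [hnorm]
    refine summable_of_sum_le (c := ∫ t in Ioi (0 : ℝ), leaveProb n t / t ^ (1 + σ / 2))
      (fun j => setIntegral_nonneg measurableSet_Ioi fun t ht => ?_) fun s => ?_
    · have ht0 : 0 < t := ht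
      exact div_nonneg (heatWeight_nonneg _ ht0.le) (by positivity)
    · rw [← integral_finsetSum _ fun j _ => hterm j]
      refine setIntegral_mono_on (integrable_finsetSum _ fun j _ => hterm j) hint
        measurableSet_Ioi fun t ht => ?_
      have ht0 : 0 < t := ht
      rw [← Finset.sum_div]
      gcongr
      exact sum_le_hasSum s (fun j _ => heatWeight_nonneg _ ht0.le) (hsub t ht0.le))
  rw [cflConst, jumpRate, gammaConst]
  simp only [one_pow, div_one, weight, Real.one_rpow, one_mul]
  rw [tsum_mul_left, hsum.tsum_eq]
  congr 1
  refine setIntegral_congr_fun measurableSet_Ioi fun t ht => ?_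
  rw [tsum_div_const, (hsub t (le_of_lt ht)).tsum_eq]

/-- The substitution t = h² s turns dt / t^{1+σ/2} into h^{-σ} ds / s^{1+σ/2}; this is the origin of
the power h^σ in the CFL condition. -/
lemma integral_comp_div_rpow {h : ℝ} (hh : 0 < h) (g : ℝ → ℝ) :
    ∫ t in Ioi (0 : ℝ), g (t / h ^ 2) / t ^ (1 + σ / 2) =
      (∫ t in Ioi (0 : ℝ), g t / t ^ (1 + σ / 2)) / h ^ σ := by
  have h2 : 0 < h ^ 2 := by positivity
  have h1 := integral_comp_mul_left_Ioi (fun t => g (t / h ^ 2) / t ^ (1 + σ / 2)) 0 h2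
  rw [mul_zero] at h1
  have h3 : (∫ t in Ioi (0 : ℝ), g (h ^ 2 * t / h ^ 2) / (h ^ 2 * t) ^ (1 + σ / 2)) =
      (∫ t in Ioi (0 : ℝ), g t / t ^ (1 + σ / 2)) / (h ^ 2) ^ (1 + σ / 2) := by
    rw [← integral_div]
    refine setIntegral_congr_fun measurableSet_Ioi fun t ht => ?_
    have ht0 : 0 < t := ht
    rw [mul_div_cancel_left₀ _ h2.ne', Real.mul_rpow h2.le ht0.le, div_div, mul_comm]
  rw [h3] at h1
  have h4 : (h ^ 2) ^ (1 + σ / 2) = h ^ 2 * h ^ σ := by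
    rw [Real.rpow_add h2, Real.rpow_one, ← Real.rpow_natCast h 2, ← Real.rpow_mul hh.le]
    congr 2
    push_cast; ring
  rw [h4] at h1
  have h5 : 0 < h ^ σ := Real.rpow_pos_of_pos hh σ
  rw [smul_eq_mul] at h1
  field_simp at h1 ⊢
  linarith

lemma jumpRate_eq (hσ : σ ∈ Ioo (0 : ℝ) 2) {h : ℝ} (hh : 0 < h) :
    jumpRate n σ h = cflConst n σ / h ^ σ := by
  rw [← jumpRate_one n hσ, jumpRate, jumpRate, integral_comp_div_rpow hh]
  simp only [one_pow, div_one, mul_div_assoc]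

variable {G : Type*} [AddCommGroup G] {n} (e : Fin n → G) (h : ℝ)

lemma integrableOn_discHeat_sub (hσ : σ ∈ Ioo (0 : ℝ) 2) {φ : G → ℝ} (hφ : IsBddFun φ) (x : G) :
    IntegrableOn (fun t : ℝ => (discHeat e h t φ x - φ x) / t ^ (1 + σ / 2)) (Ioi 0) := by
  obtain ⟨C, hC⟩ := hφ
  refine Integrable.mono' ((integrableOn_leaveProb n hσ h).const_mul (2 * C))
    ((((continuous_discHeat e h ⟨C, hC⟩ x).sub continuous_const).measurable.div
      (by fun_prop : Measurable fun t : ℝ => t ^ (1 + σ / 2))).aestronglyMeasurable) ?_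
  filter_upwards [ae_restrict_mem measurableSet_Ioi] with t ht
  have ht0 : 0 < t := ht
  rw [norm_div, Real.norm_eq_abs, Real.norm_of_nonneg (by positivity : 0 ≤ t ^ (1 + σ / 2)),
    ← mul_div_assoc]
  gcongr
  exact abs_discHeat_sub_le e h ht0.le hC x

/-- Comparison principle for the discrete fractional Laplacian. -/
lemma discFracLap_le (hσ : σ ∈ Ioo (0 : ℝ) 2) {U φ : G → ℝ} (hU : IsBddFun U)
    (hφ : IsBddFun φ) {ξ : ℝ} (hle : ∀ y, U y ≤ φ y + ξ) (x : G) :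
    discFracLap e h σ U x ≤ discFracLap e h σ φ x + jumpRate n σ h * (φ x + ξ - U x) := by
  have h1 := integrableOn_discHeat_sub e h hσ hU x
  have h2 := integrableOn_discHeat_sub e h hσ hφ x
  have h3 := (integrableOn_leaveProb n hσ h).mul_const (φ x + ξ - U x)
  have h4 : (∫ t in Ioi (0 : ℝ), (discHeat e h t U x - U x) / t ^ (1 + σ / 2)) ≤
      (∫ t in Ioi (0 : ℝ), (discHeat e h t φ x - φ x) / t ^ (1 + σ / 2)) +
      (∫ t in Ioi (0 : ℝ), leaveProb n (t / h ^ 2) / t ^ (1 + σ / 2)) * (φ x + ξ - U x) := by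
    rw [← integral_mul_const, ← integral_add h2 h3]
    refine setIntegral_mono_on h1 (h2.add h3) measurableSet_Ioi fun t ht => ?_
    have ht0 : 0 < t := ht
    have h6 := div_le_div_of_nonneg_right (discHeat_sub_le e h ht0.le hU hφ hle x)
      (by positivity : 0 ≤ t ^ (1 + σ / 2))
    rwa [add_div, ← div_mul_eq_mul_div] at h6
  have h5 := mul_le_mul_of_nonneg_left h4 (gammaConst_pos hσ).le
  rw [mul_add, ← mul_assoc] at h5
  exact h5

lemma discFracLap_add (hσ : σ ∈ Ioo (0 : ℝ) 2) {φ ψ : G → ℝ} (hφ : IsBddFun φ) (hψ : IsBddFun ψ)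
    (x : G) : discFracLap e h σ (fun y => φ y + ψ y) x =
      discFracLap e h σ φ x + discFracLap e h σ ψ x := by
  simp only [discFracLap]
  rw [← mul_add, ← integral_add (integrableOn_discHeat_sub e h hσ hφ x)
    (integrableOn_discHeat_sub e h hσ hψ x)]
  congr 1
  refine setIntegral_congr_fun measurableSet_Ioi fun t ht => ?_
  rw [discHeat_add e h (le_of_lt ht) hφ hψ]
  ring

lemma discFracLap_const_mul {φ : G → ℝ} (hφ : IsBddFun φ) (c : ℝ)
    (x : G) : discFracLap e h σ (fun y => c * φ y) x = c * discFracLap e h σ φ x := by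
  simp only [discFracLap]
  rw [mul_left_comm c, ← integral_const_mul c]
  congr 1
  refine setIntegral_congr_fun measurableSet_Ioi fun t ht => ?_
  have ht0 : 0 < t := ht
  rw [discHeat_const_mul e h ht0.le hφ]
  ring

lemma discFracLap_neg {φ : G → ℝ} (hφ : IsBddFun φ)
    (x : G) : discFracLap e h σ (fun y => -φ y) x = -discFracLap e h σ φ x := by
  simpa using discFracLap_const_mul e h hφ (-1) x

lemma discFracLap_sub (hσ : σ ∈ Ioo (0 : ℝ) 2) {φ ψ : G → ℝ} (hφ : IsBddFun φ) (hψ : IsBddFun ψ)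
    (x : G) : discFracLap e h σ (fun y => φ y - ψ y) x =
      discFracLap e h σ φ x - discFracLap e h σ ψ x := by
  simpa [sub_eq_add_neg, discFracLap_neg e h hψ] using discFracLap_add e h hσ hφ hψ.neg x

lemma discFracLap_const (c : ℝ) (x : G) : discFracLap e h σ (fun _ => c) x = 0 := by
  simp [discFracLap, discHeat_const]

/-- Adding the jump rate times φ cancels the diagonal of the operator and leaves a sum with
nonnegative weights of total mass K. The bound is the comparison principle against zero, used from
both sides. -/
lemma abs_discFracLap_add_le (hσ : σ ∈ Ioo (0 : ℝ) 2) {φ : G → ℝ} {C : ℝ} (hC : ∀ y, |φ y| ≤ C)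
    (x : G) : |discFracLap e h σ φ x + jumpRate n σ h * φ x| ≤ jumpRate n σ h * C := by
  have hφ : IsBddFun φ := ⟨C, hC⟩
  have h0 := IsBddFun.const (G := G) (0 : ℝ)
  have h1 := discFracLap_le e h hσ hφ h0 (ξ := C) (fun y => by linarith [(abs_le.mp (hC y)).2]) x
  have h2 := discFracLap_le e h hσ h0 hφ (ξ := C) (fun y => by linarith [(abs_le.mp (hC y)).1]) x
  rw [discFracLap_const] at h1 h2
  rw [abs_le]
  constructor <;> linarith

lemma IsBddFun.discFracLap (hσ : σ ∈ Ioo (0 : ℝ) 2) {φ : G → ℝ} (hφ : IsBddFun φ) :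
    IsBddFun (discFracLap e h σ φ) := by
  obtain ⟨C, hC⟩ := hφ
  have h1 : IsBddFun (fun x => ThetaScheme.discFracLap e h σ φ x + jumpRate n σ h * φ x) :=
    ⟨_, abs_discFracLap_add_le e h hσ hC⟩
  have h2 := h1.sub (IsBddFun.const_mul (jumpRate n σ h) ⟨C, hC⟩)
  simpa using h2

end
end ThetaScheme

/-! ### The nonlinearity and the solvability of the implicit step -/

namespace ThetaScheme
noncomputable section

/-- Assumption (A1): `F` is nondecreasing and Lipschitz with constant `LF`. -/
def OneSidedLipschitz (F : ℝ → ℝ) (LF : ℝ) : Prop :=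
  ∀ l₁ l₂ : ℝ, F l₁ - F l₂ ≤ LF * max 0 (l₁ - l₂)

namespace OneSidedLipschitz
variable {F : ℝ → ℝ} {LF : ℝ}

lemma mono (hF : OneSidedLipschitz F LF) : Monotone F := fun a b hab => by
  have := hF a b
  rw [max_eq_left (by linarith)] at this
  linarith

lemma nonneg (hF : OneSidedLipschitz F LF) : 0 ≤ LF := by
  have h1 := hF 1 0
  have h2 := hF.mono (zero_le_one (α := ℝ))
  rw [max_eq_right (by norm_num)] at h1
  linarith

/-- The difference quotient of F lies in [0, LF]; with it a difference of two nonlinear equations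
becomes a linear one with a nonnegative coefficient. -/
lemma exists_slope (hF : OneSidedLipschitz F LF) (p q : ℝ) :
    ∃ μ, 0 ≤ μ ∧ μ ≤ LF ∧ F p - F q = μ * (p - q) := by
  rcases lt_trichotomy p q with h | h | h
  · have h1 := hF q p
    have h2 := hF.mono h.le
    have hpos : 0 < q - p := by linarith
    rw [max_eq_right hpos.le] at h1
    refine ⟨(F q - F p) / (q - p), div_nonneg (by linarith) hpos.le, (div_le_iff₀ hpos).mpr h1, ?_⟩
    field_simp
    ring
  · exact ⟨0, le_rfl, hF.nonneg, by simp [h]⟩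
  · have h1 := hF p q
    have h2 := hF.mono h.le
    have hpos : 0 < p - q := by linarith
    rw [max_eq_right hpos.le] at h1
    refine ⟨(F p - F q) / (p - q), div_nonneg (by linarith) hpos.le, (div_le_iff₀ hpos).mpr h1, ?_⟩
    field_simp

lemma abs_sub_le (hF : OneSidedLipschitz F LF) (p q : ℝ) : |F p - F q| ≤ LF * |p - q| := by
  obtain ⟨μ, h0, h1, h2⟩ := hF.exists_slope p q
  rw [h2, abs_mul, abs_of_nonneg h0]
  gcongr

lemma continuous (hF : OneSidedLipschitz F LF) : Continuous F :=
  LipschitzWith.continuous (K := ⟨LF, hF.nonneg⟩)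
    (LipschitzWith.of_dist_le_mul fun p q => hF.abs_sub_le p q)

lemma abs_le (hF : OneSidedLipschitz F LF) (p : ℝ) : |F p| ≤ |F 0| + LF * |p| := by
  have h1 := hF.abs_sub_le p 0
  rw [sub_zero] at h1
  have h2 := abs_sub_abs_le_abs_sub (F p) (F 0)
  linarith

/-- The nonlinearity of the problem solved by `-u`. -/
lemma reflect (hF : OneSidedLipschitz F LF) : OneSidedLipschitz (fun l => -F (-l)) LF :=
  fun l₁ l₂ => by
    have := hF (-l₂) (-l₁)
    rw [show -l₂ - -l₁ = l₁ - l₂ by ring] at this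
    linarith

end OneSidedLipschitz

section ImplicitStep
variable {G : Type*} [AddCommGroup G] {n : ℕ} (e : Fin n → G) {σ θ τ h LF : ℝ} {F : ℝ → ℝ}

/-- The relaxation parameter for which the implicit step is a contraction. -/
def relaxParam (n : ℕ) (σ θ τ h LF : ℝ) : ℝ := 1 / (1 + τ * LF * θ * jumpRate n σ h)

/-- The relaxed fixed-point map of the implicit step `V = g + τ F(a + θ L_h V)`. -/
def relaxMap (σ θ τ h LF : ℝ) (F : ℝ → ℝ) (g a V : G → ℝ) (x : G) : ℝ :=
  (1 - relaxParam n σ θ τ h LF) * V x +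
    relaxParam n σ θ τ h LF * (g x + τ * F (a x + θ * discFracLap e h σ V x))

lemma relaxParam_pos (hσ : σ ∈ Ioo (0 : ℝ) 2) (hθ : 0 ≤ θ) (hτ : 0 ≤ τ)
    (hF : OneSidedLipschitz F LF) : 0 < relaxParam n σ θ τ h LF := by
  have := jumpRate_nonneg n hσ h
  have := hF.nonneg
  unfold relaxParam
  positivity

lemma relaxParam_mul (hσ : σ ∈ Ioo (0 : ℝ) 2) (hθ : 0 ≤ θ) (hτ : 0 ≤ τ)
    (hF : OneSidedLipschitz F LF) :
    relaxParam n σ θ τ h LF * (τ * LF * θ * jumpRate n σ h) = 1 - relaxParam n σ θ τ h LF := by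
  have := jumpRate_nonneg n hσ h
  have := hF.nonneg
  have hp : 0 < 1 + τ * LF * θ * jumpRate n σ h := by positivity
  unfold relaxParam
  field_simp
  ring

/-- With the slope μ of F and c = λτμθ, the difference of the images is (1 - λ - cK) D + c (l + K
D), where l is the discrete operator applied to D. The relaxation parameter λ is chosen so that cK ≤
1 - λ whatever μ is; both coefficients are then nonnegative, and |l + K D| ≤ K m makes the K-terms
cancel. -/
lemma abs_relaxMap_sub_le (hσ : σ ∈ Ioo (0 : ℝ) 2) (hθ : 0 ≤ θ) (hτ : 0 ≤ τ)
    (hF : OneSidedLipschitz F LF) (g a : G → ℝ) {V W : G → ℝ} (hV : IsBddFun V) (hW : IsBddFun W)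
    {m : ℝ} (hm : ∀ y, |V y - W y| ≤ m) (x : G) :
    |relaxMap e σ θ τ h LF F g a V x - relaxMap e σ θ τ h LF F g a W x| ≤
      (1 - relaxParam n σ θ τ h LF) * m := by
  set lam := relaxParam n σ θ τ h LF with hlam
  set K := jumpRate n σ h
  have hK : 0 ≤ K := jumpRate_nonneg n hσ h
  have hl : 0 < lam := relaxParam_pos hσ hθ hτ hF
  have hl2 : lam * (τ * LF * θ * K) = 1 - lam := relaxParam_mul hσ hθ hτ hF
  have h1 := abs_discFracLap_add_le e h hσ hm x
  rw [discFracLap_sub e h hσ hV hW] at h1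
  obtain ⟨μ, hμ0, hμ1, hμ⟩ := hF.exists_slope (a x + θ * discFracLap e h σ V x)
    (a x + θ * discFracLap e h σ W x)
  set l := discFracLap e h σ V x - discFracLap e h σ W x with hldef
  set D := V x - W x with hD
  set c := lam * τ * μ * θ with hc
  have hc0 : 0 ≤ c := by positivity
  have hcK : c * K ≤ 1 - lam := by
    rw [← hl2]
    calc c * K = lam * (τ * μ * θ * K) := by rw [hc]; ring
      _ ≤ lam * (τ * LF * θ * K) := by gcongr
  have key : relaxMap e σ θ τ h LF F g a V x - relaxMap e σ θ τ h LF F g a W x =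
      (1 - lam - c * K) * D + c * (l + K * D) := by
    have : F (a x + θ * discFracLap e h σ V x) =
      F (a x + θ * discFracLap e h σ W x) + μ * (θ * l) := by rw [hldef]; linarith
    simp only [relaxMap, ← hlam]
    rw [this, hc, hD]
    ring
  rw [key]
  calc |(1 - lam - c * K) * D + c * (l + K * D)|
      ≤ (1 - lam - c * K) * |D| + c * |l + K * D| := by
        refine (abs_add_le _ _).trans_eq ?_
        rw [abs_mul, abs_mul, abs_of_nonneg hc0, abs_of_nonneg (by linarith : 0 ≤ 1 - lam - c * K)]
    _ ≤ (1 - lam - c * K) * m + c * (K * m) := by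
        have := hm x
        have h2 : 0 ≤ 1 - lam - c * K := by linarith
        gcongr
    _ = (1 - lam) * m := by ring

lemma relaxMap_eq_self (hσ : σ ∈ Ioo (0 : ℝ) 2) (hθ : 0 ≤ θ) (hτ : 0 ≤ τ)
    (hF : OneSidedLipschitz F LF) {g a V : G → ℝ} {x : G} :
    relaxMap e σ θ τ h LF F g a V x = V x ↔
      V x = g x + τ * F (a x + θ * discFracLap e h σ V x) := by
  have hl : 0 < relaxParam n σ θ τ h LF := relaxParam_pos hσ hθ hτ hF
  constructor
  · intro hx
    rw [relaxMap] at hx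
    have : relaxParam n σ θ τ h LF * (g x + τ * F (a x + θ * discFracLap e h σ V x)) =
      relaxParam n σ θ τ h LF * V x := by linarith
    exact (mul_left_cancel₀ hl.ne' this).symm
  · intro hx
    rw [relaxMap, ← hx]
    ring

lemma implicitStep_unique (hσ : σ ∈ Ioo (0 : ℝ) 2) (hθ : 0 ≤ θ) (hτ : 0 ≤ τ)
    (hF : OneSidedLipschitz F LF) {g a V W : G → ℝ} (hV : IsBddFun V) (hW : IsBddFun W)
    (hVs : ∀ x, V x = g x + τ * F (a x + θ * discFracLap e h σ V x))
    (hWs : ∀ x, W x = g x + τ * F (a x + θ * discFracLap e h σ W x)) : V = W := by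
  have hl : 0 < relaxParam n σ θ τ h LF := relaxParam_pos hσ hθ hτ hF
  set D := (hV.sub hW).toBddFun
  have h1 : ‖D‖ ≤ max 0 ((1 - relaxParam n σ θ τ h LF) * ‖D‖) := by
    refine BddFun.norm_le (le_max_left _ _) fun x => le_max_of_le_right ?_
    have := abs_relaxMap_sub_le (h := h) e hσ hθ hτ hF g a hV hW (fun y => D.abs_apply_le y) x
    rw [(relaxMap_eq_self e hσ hθ hτ hF).mpr (hVs x),
      (relaxMap_eq_self e hσ hθ hτ hF).mpr (hWs x)] at this
    exact this
  have h2 : ‖D‖ ≤ 0 := by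
    rcases le_max_iff.mp h1 with h | h
    · exact h
    · nlinarith
  funext x
  have h3 : |V x - W x| ≤ 0 := (D.abs_apply_le x).trans h2
  exact sub_eq_zero.mp (abs_nonpos_iff.mp h3)

lemma IsBddFun.comp_oneSidedLipschitz {X : Type*} (hF : OneSidedLipschitz F LF) {φ : X → ℝ}
    (hφ : IsBddFun φ) : IsBddFun (fun x => F (φ x)) := by
  obtain ⟨C, hC⟩ := hφ
  refine ⟨|F 0| + LF * C, fun x => (hF.abs_le _).trans ?_⟩
  have := mul_le_mul_of_nonneg_left (hC x) hF.nonneg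
  linarith

/-- Banach's fixed point theorem in the space of bounded functions. The bound on the solution does
not involve the contraction constant and lets the steps be iterated. -/
lemma exists_implicitStep (hσ : σ ∈ Ioo (0 : ℝ) 2) (hθ : 0 ≤ θ) (hτ : 0 ≤ τ)
    (hF : OneSidedLipschitz F LF) {g a : G → ℝ} {A B : ℝ} (hg : ∀ x, |g x| ≤ A)
    (ha : ∀ x, |a x| ≤ B) :
    ∃ V : G → ℝ, (∀ x, V x = g x + τ * F (a x + θ * discFracLap e h σ V x)) ∧
      ∀ x, |V x| ≤ A + τ * (|F 0| + LF * B) := by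
  have hl : 0 < relaxParam n σ θ τ h LF := relaxParam_pos hσ hθ hτ hF
  have hl1 : 0 ≤ 1 - relaxParam n σ θ τ h LF := by
    rw [← relaxParam_mul hσ hθ hτ hF]
    have := jumpRate_nonneg n hσ h
    have := hF.nonneg
    positivity
  have hb : ∀ V : BddFun G, IsBddFun (relaxMap e σ θ τ h LF F g a V) := fun V =>
    ((IsBddFun.coe V).const_mul _).add (((show IsBddFun g from ⟨A, hg⟩).add
      (((show IsBddFun a from ⟨B, ha⟩).add (((IsBddFun.coe V).discFracLap e h hσ).const_mul θ)
        |>.comp_oneSidedLipschitz hF).const_mul τ)).const_mul _)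
  let Φ : BddFun G → BddFun G := fun V => (hb V).toBddFun
  have hΦ : ContractingWith ⟨1 - relaxParam n σ θ τ h LF, hl1⟩ Φ := by
    refine ⟨?_, LipschitzWith.of_dist_le_mul fun V W => ?_⟩
    · exact show 1 - relaxParam n σ θ τ h LF < 1 by linarith
    · rw [dist_eq_norm, dist_eq_norm]
      refine BddFun.norm_le (mul_nonneg hl1 (norm_nonneg _)) fun x => ?_
      exact abs_relaxMap_sub_le e hσ hθ hτ hF g a (IsBddFun.coe V) (IsBddFun.coe W)
        (fun y => (V - W).abs_apply_le y) x
  set V := ContractingWith.fixedPoint Φ hΦ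
  have hV : ∀ x, relaxMap e σ θ τ h LF F g a V x = V x := fun x =>
    congrArg (fun W : BddFun G => W x) hΦ.fixedPoint_isFixedPt
  refine ⟨V, fun x => (relaxMap_eq_self e hσ hθ hτ hF).mp (hV x), fun x => ?_⟩
  have hA : ∀ y : G, |g y + τ * F (a y)| ≤ A + τ * (|F 0| + LF * B) := fun y => by
    refine (abs_add_le _ _).trans (add_le_add (hg y) ?_)
    rw [abs_mul, abs_of_nonneg hτ]
    refine mul_le_mul_of_nonneg_left ((hF.abs_le _).trans ?_) hτ
    have := mul_le_mul_of_nonneg_left (ha y) hF.nonneg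
    linarith
  set C := A + τ * (|F 0| + LF * B)
  have hC : 0 ≤ C := (abs_nonneg _).trans (hA x)
  -- The fixed point is compared with the image of the zero function; the factor λ then cancels from
  -- both sides.
  have h1 : ‖V‖ ≤ (1 - relaxParam n σ θ τ h LF) * ‖V‖ + relaxParam n σ θ τ h LF * C := by
    refine BddFun.norm_le (by positivity) fun y => ?_
    have h2 := abs_relaxMap_sub_le (h := h) e hσ hθ hτ hF g a (IsBddFun.coe V)
      (IsBddFun.const 0) (m := ‖V‖) (fun z => by simpa using V.abs_apply_le z) y
    rw [hV y] at h2
    have h3 : relaxMap e σ θ τ h LF F g a (fun _ => 0) y =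
        relaxParam n σ θ τ h LF * (g y + τ * F (a y)) := by
      simp [relaxMap, discFracLap_const]
    have h4 : |relaxMap e σ θ τ h LF F g a (fun _ => 0) y| ≤ relaxParam n σ θ τ h LF * C := by
      rw [h3, abs_mul, abs_of_pos hl]
      exact mul_le_mul_of_nonneg_left (hA y) hl.le
    have h5 := abs_sub_abs_le_abs_sub (V y) (relaxMap e σ θ τ h LF F g a (fun _ => 0) y)
    linarith
  refine (V.abs_apply_le x).trans ?_
  have h2 : relaxParam n σ θ τ h LF * ‖V‖ ≤ relaxParam n σ θ τ h LF * C := by linarith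
  exact le_of_mul_le_mul_left h2 hl

/-- A priori bounds of the iterates of the scheme. -/
def iterBound (n : ℕ) (σ θ τ h LF F0 C B : ℝ) : ℕ → ℝ
  | 0 => C
  | m + 1 => iterBound n σ θ τ h LF F0 C B m + τ * B +
      τ * (F0 + LF * ((1 - θ) * (2 * jumpRate n σ h * iterBound n σ θ τ h LF F0 C B m)))

lemma exists_scheme_seq (hσ : σ ∈ Ioo (0 : ℝ) 2) (hθ : θ ∈ Icc (0 : ℝ) 1) (hτ : 0 ≤ τ)
    (hF : OneSidedLipschitz F LF) {u : G → ℝ} {b : ℕ → G → ℝ} {C B : ℝ} (hu : ∀ x, |u x| ≤ C)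
    (hb : ∀ m x, |b m x| ≤ B) :
    ∃ V : ℕ → G → ℝ, V 0 = u ∧ (∀ m x, |V m x| ≤ iterBound n σ θ τ h LF |F 0| C B m) ∧
      ∀ m x, V (m + 1) x = V m x + τ * (F ((1 - θ) * discFracLap e h σ (V m) x +
        θ * discFracLap e h σ (V (m + 1)) x) + b m x) := by
  have hK := jumpRate_nonneg n hσ h
  have hθ1 : 0 ≤ 1 - θ := by linarith [hθ.2]
  -- The a priori bound is carried inside the subtype: each step needs a bounded previous iterate,
  -- so the recursion must pass the bound along.
  have hstep : ∀ (m : ℕ) (V : {V : G → ℝ // ∀ x, |V x| ≤ iterBound n σ θ τ h LF |F 0| C B m}),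
      ∃ W : {V : G → ℝ // ∀ x, |V x| ≤ iterBound n σ θ τ h LF |F 0| C B (m + 1)},
        ∀ x, W.1 x = V.1 x + τ * (F ((1 - θ) * discFracLap e h σ V.1 x +
          θ * discFracLap e h σ W.1 x) + b m x) := by
    rintro m ⟨V, hV⟩
    set D := iterBound n σ θ τ h LF |F 0| C B m
    obtain ⟨W, hW, hWb⟩ := exists_implicitStep (h := h) (n := n) e hσ hθ.1 hτ hF
      (g := fun x => V x + τ * b m x) (a := fun x => (1 - θ) * discFracLap e h σ V x)
      (A := D + τ * B) (B := (1 - θ) * (2 * jumpRate n σ h * D))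
      (fun x => (abs_add_le _ _).trans (add_le_add (hV x) (by
        rw [abs_mul, abs_of_nonneg hτ]
        exact mul_le_mul_of_nonneg_left (hb m x) hτ)))
      (fun x => by
        rw [abs_mul, abs_of_nonneg hθ1]
        refine mul_le_mul_of_nonneg_left ?_ hθ1
        have h1 := abs_discFracLap_add_le e h hσ hV x
        have h2 := mul_le_mul_of_nonneg_left (hV x) hK
        have h3 := abs_sub_abs_le_abs_sub (discFracLap e h σ V x) (-(jumpRate n σ h * V x))
        rw [sub_neg_eq_add, abs_neg, abs_mul, abs_of_nonneg hK] at h3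
        linarith)
    exact ⟨⟨W, hWb⟩, fun x => (hW x).trans (by ring)⟩
  choose next hnext using hstep
  let seq : ∀ m : ℕ, {V : G → ℝ // ∀ x, |V x| ≤ iterBound n σ θ τ h LF |F 0| C B m} :=
    fun m => Nat.rec ⟨u, hu⟩ (fun k V => next k V) m
  exact ⟨fun m => (seq m).1, rfl, fun m => (seq m).2, fun m x => hnext m (seq m) x⟩

end ImplicitStep

/-! ### Existence and uniqueness on the grid and on the whole space -/

section Existence
variable {N : ℕ} {σ T θ LF h : ℝ} {F : ℝ → ℝ}
  {f : EuclideanSpace ℝ (Fin N) → ℝ → ℝ} {u₀ : EuclideanSpace ℝ (Fin N) → ℝ}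

lemma exists_le_bound_of_le (c : ℕ → ℝ) (M : ℕ) : ∃ C, ∀ m ≤ M, c m ≤ C := by
  refine ⟨∑ m ∈ Finset.range (M + 1), |c m|, fun m hm => (le_abs_self _).trans ?_⟩
  exact Finset.single_le_sum (f := fun m => |c m|) (fun _ _ => abs_nonneg _)
    (Finset.mem_range.mpr (by omega))

lemma exists_gridSolution (hσ : σ ∈ Ioo (0 : ℝ) 2) (hT : 0 < T) (hθ : θ ∈ Icc (0 : ℝ) 1)
    (hF : OneSidedLipschitz F LF) (hf : BoundedOnSlab T f) (hu₀ : IsBddFun u₀) (h : ℝ) {M : ℕ}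
    (hM : 0 < M) : ∃ U, IsGridSolution σ θ F f u₀ h (T / M) M U := by
  obtain ⟨C, hC⟩ := hu₀
  obtain ⟨B, hB⟩ := hf
  have hM' : (0 : ℝ) < M := by exact_mod_cast hM
  have hτ : 0 < T / M := by positivity
  obtain ⟨V, hV0, hVb, hVs⟩ := exists_scheme_seq (h := h) (indexStep N) hσ hθ hτ.le hF
    (u := fun i => u₀ (gridPoint h i)) (fun i => hC _)
    -- The source is set to zero at times outside [0, T], where f is not assumed bounded. The
    -- infinite recursion is only read up to n = M.
    (b := fun m i => if (m : ℝ) * (T / M) ∈ Icc 0 T then f (gridPoint h i) (m * (T / M)) else 0)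
    (B := max B 0) (fun m i => by
      split_ifs with hm
      · exact (hB _ _ hm).trans (le_max_left _ _)
      · simp)
  obtain ⟨D, hD⟩ := exists_le_bound_of_le (iterBound N σ θ (T / M) h LF |F 0| C (max B 0)) M
  refine ⟨V, ⟨D, fun m hm i => (hVb m i).trans (hD m hm)⟩, fun i => by rw [hV0], fun m hm i => ?_⟩
  have h1 : (m : ℝ) * (T / M) ∈ Icc 0 T := by
    refine ⟨by positivity, ?_⟩
    have : (m : ℝ) ≤ M := by exact_mod_cast hm.le
    calc (m : ℝ) * (T / M) ≤ M * (T / M) := by gcongr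
      _ = T := by field_simp
  rw [hVs m i, if_pos h1]

lemma gridSolution_unique (hσ : σ ∈ Ioo (0 : ℝ) 2) (hθ : θ ∈ Icc (0 : ℝ) 1)
    (hF : OneSidedLipschitz F LF) {τ : ℝ} (hτ : 0 ≤ τ) {M : ℕ} {U V : ℕ → (Fin N → ℤ) → ℝ}
    (hU : IsGridSolution σ θ F f u₀ h τ M U) (hV : IsGridSolution σ θ F f u₀ h τ M V) :
    ∀ n ≤ M, V n = U n := by
  intro m
  induction m with
  | zero => intro _; funext i; rw [hU.initial, hV.initial]
  | succ m ih =>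
    intro hm
    have h1 := ih (by omega)
    obtain ⟨C, hC⟩ := hU.bounded
    obtain ⟨D, hD⟩ := hV.bounded
    refine implicitStep_unique (h := h) (indexStep N) hσ hθ.1 hτ hF
      (g := fun i => U m i + τ * f (gridPoint h i) (m * τ))
      (a := fun i => (1 - θ) * discFracLap (indexStep N) h σ (U m) i)
      ⟨D, hD _ hm⟩ ⟨C, hC _ hm⟩ (fun i => ?_) (fun i => ?_)
    · rw [hV.step m (by omega) i, h1]; ring
    · rw [hU.step m (by omega) i]; ring

/-- The scheme only couples times that differ by multiples of τ. An independent sequence is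
therefore run for each remainder s = t - ⌊t/τ⌋τ; no regularity in t is needed or produced. -/
lemma exists_spaceSolution (hσ : σ ∈ Ioo (0 : ℝ) 2) (hT : 0 < T) (hθ : θ ∈ Icc (0 : ℝ) 1)
    (hF : OneSidedLipschitz F LF) (hf : BoundedOnSlab T f) (hu₀ : IsBddFun u₀) (h : ℝ) {M : ℕ}
    (hM : 0 < M) : ∃ U, IsSpaceSolution σ θ T F f u₀ h (T / M) U := by
  obtain ⟨C, hC⟩ := hu₀
  obtain ⟨B, hB⟩ := hf
  have hM' : (0 : ℝ) < M := by exact_mod_cast hM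
  have hτ : 0 < T / M := by positivity
  set τ := T / M with hτdef
  have hseq := fun s : ℝ => exists_scheme_seq (h := h) (spaceStep N h) hσ hθ hτ.le hF (u := u₀) hC
    (b := fun m x => if s + m * τ ∈ Icc 0 T then f x (s + m * τ) else 0)
    (B := max B 0) (fun m i => by
      split_ifs with hm
      · exact (hB _ _ hm).trans (le_max_left _ _)
      · simp)
  choose V hV0 hVb hVs using hseq
  obtain ⟨D, hD⟩ := exists_le_bound_of_le (iterBound N σ θ τ h LF |F 0| C (max B 0)) M
  refine ⟨fun x t => V (t - ⌊t / τ⌋₊ * τ) ⌊t / τ⌋₊ x, ⟨D, fun x t ht => ?_⟩, fun x t ht => ?_,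
    fun x t ht => ?_⟩
  · refine (hVb _ _ x).trans (hD _ ?_)
    refine Nat.floor_le_of_le ?_
    rw [div_le_iff₀ hτ, hτdef]
    field_simp
    exact ht.2
  · have : ⌊t / τ⌋₊ = 0 := Nat.floor_eq_zero.mpr ((div_lt_one hτ).mpr ht.2)
    simp only [this, hV0]
  · have h1 : ⌊t / τ⌋₊ = ⌊(t - τ) / τ⌋₊ + 1 := by
      rw [← Nat.floor_add_one (div_nonneg (by linarith [ht.1]) hτ.le)]
      congr 1
      field_simp
      ring
    set k := ⌊(t - τ) / τ⌋₊
    have h2 : t - (⌊t / τ⌋₊ : ℝ) * τ = t - τ - k * τ := by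
      rw [h1]; push_cast; ring
    have h3 : t - τ - k * τ + k * τ = t - τ := by ring
    have h4 : t - τ ∈ Icc 0 T := ⟨by linarith [ht.1], by linarith [ht.2]⟩
    simp only [h2]
    rw [h1, hVs, h3, if_pos h4]

lemma spaceSolution_unique (hσ : σ ∈ Ioo (0 : ℝ) 2) (hθ : θ ∈ Icc (0 : ℝ) 1)
    (hF : OneSidedLipschitz F LF) {τ : ℝ} (hτ : 0 < τ)
    {U V : EuclideanSpace ℝ (Fin N) → ℝ → ℝ}
    (hU : IsSpaceSolution σ θ T F f u₀ h τ U) (hV : IsSpaceSolution σ θ T F f u₀ h τ V) :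
    ∀ x, ∀ t ∈ Icc (0 : ℝ) T, V x t = U x t := by
  have key : ∀ m : ℕ, ∀ t ∈ Icc (0 : ℝ) T, t < (m + 1) * τ → (fun x => V x t) = fun x => U x t := by
    intro m
    induction m with
    | zero =>
      intro t ht htm
      funext x
      rw [hU.initial x t ⟨ht.1, by simpa using htm⟩, hV.initial x t ⟨ht.1, by simpa using htm⟩]
    | succ m ih =>
      intro t ht htm
      rcases lt_or_ge t τ with h1 | h1
      · funext x
        rw [hU.initial x t ⟨ht.1, h1⟩, hV.initial x t ⟨ht.1, h1⟩]
      · have h2 := ih (t - τ) ⟨by linarith, by linarith [ht.2]⟩ (by push_cast at htm; linarith)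
        obtain ⟨C, hC⟩ := hU.bounded
        obtain ⟨D, hD⟩ := hV.bounded
        refine implicitStep_unique (h := h) (spaceStep N h) hσ hθ.1 hτ.le hF
          (g := fun x => U x (t - τ) + τ * f x (t - τ))
          (a := fun x => (1 - θ) * discFracLap (spaceStep N h) h σ (fun y => U y (t - τ)) x)
          ⟨D, fun x => hD x t ht⟩ ⟨C, fun x => hC x t ht⟩ (fun x => ?_) (fun x => ?_)
        · have h3 : V x (t - τ) = U x (t - τ) := congrFun h2 x
          rw [hV.step x t ⟨h1, ht.2⟩, h2, h3]; ring
        · rw [hU.step x t ⟨h1, ht.2⟩]; ring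
  intro x t ht
  obtain ⟨m, hm⟩ := exists_nat_gt (t / τ)
  refine congrFun (key m t ht ?_) x
  rw [div_lt_iff₀ hτ] at hm
  linarith

/-- All iterates of the discrete Laplacian commute with composition by a map that carries increments
to increments, hence so do the semigroup and the fractional power. It is used for the inclusion of
the grid in the whole space. -/
lemma discFracLap_comp {G H : Type*} [AddCommGroup G] [AddCommGroup H] {n : ℕ} {e : Fin n → G}
    {e' : Fin n → H} (g : G → H) (hadd : ∀ x k, g (x + e k) = g x + e' k)
    (hsub : ∀ x k, g (x - e k) = g x - e' k) (h σ : ℝ) (φ : H → ℝ) (x : G) :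
    discFracLap e h σ (fun y => φ (g y)) x = discFracLap e' h σ φ (g x) := by
  have h1 : ∀ ψ : H → ℝ, discLap e h (fun y => ψ (g y)) = fun y => discLap e' h ψ (g y) := by
    intro ψ; funext y; simp [discLap, hadd, hsub]
  have h2 : ∀ m : ℕ, (discLap e h)^[m] (fun y => φ (g y)) =
      fun y => (discLap e' h)^[m] φ (g y) := by
    intro m
    induction m with
    | zero => rfl
    | succ m ih => rw [Function.iterate_succ_apply', ih, h1]; simp [Function.iterate_succ_apply']
  simp [discFracLap, discHeat, h2]

lemma discFracLap_gridPoint (h σ : ℝ) (φ : EuclideanSpace ℝ (Fin N) → ℝ) (i : Fin N → ℤ) :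
    discFracLap (indexStep N) h σ (fun j => φ (gridPoint h j)) i =
      discFracLap (spaceStep N h) h σ φ (gridPoint h i) := by
  refine discFracLap_comp (gridPoint h) (fun x k => ?_) (fun x k => ?_) h σ φ i
  · ext l
    by_cases hl : l = k <;> simp [gridPoint, spaceStep, indexStep, hl, mul_add]
  · ext l
    by_cases hl : l = k <;> simp [gridPoint, spaceStep, indexStep, hl, mul_sub]

/-- This restriction reduces the grid part of the convergence statement to the whole-space part. -/
lemma IsSpaceSolution.gridSolution (hT : 0 < T) {M : ℕ} (hM : 0 < M)
    {U : EuclideanSpace ℝ (Fin N) → ℝ → ℝ}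
    (hU : IsSpaceSolution σ θ T F f u₀ h (T / M) U) :
    IsGridSolution σ θ F f u₀ h (T / M) M (fun n i => U (gridPoint h i) (n * (T / M))) := by
  have hM' : (0 : ℝ) < M := by exact_mod_cast hM
  have hτ : 0 < T / M := by positivity
  have hle : ∀ n ≤ M, (n : ℝ) * (T / M) ≤ T := by
    intro n hn
    have : (n : ℝ) ≤ M := by exact_mod_cast hn
    calc (n : ℝ) * (T / M) ≤ M * (T / M) := by gcongr
      _ = T := by field_simp
  refine ⟨?_, fun i => ?_, fun n hn i => ?_⟩
  · obtain ⟨C, hC⟩ := hU.bounded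
    exact ⟨C, fun n hn i => hC _ _ ⟨by positivity, hle n hn⟩⟩
  · simpa using hU.initial (gridPoint h i) 0 ⟨le_rfl, hτ⟩
  · have h1 : ((n + 1 : ℕ) : ℝ) * (T / M) - T / M = n * (T / M) := by push_cast; ring
    have h2 := hU.step (gridPoint h i) (((n + 1 : ℕ) : ℝ) * (T / M))
      ⟨by push_cast; nlinarith [Nat.cast_nonneg (α := ℝ) n], hle (n + 1) hn⟩
    rw [h1] at h2
    rw [discFracLap_gridPoint h σ (fun y => U y (n * (T / M))),
      discFracLap_gridPoint h σ (fun y => U y (((n + 1 : ℕ) : ℝ) * (T / M)))]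
    exact h2

end Existence

end
end ThetaScheme

/-! ### A smooth bounded bump, monotonicity of the scheme and barriers -/

namespace ThetaScheme
noncomputable section

/-- The space `ℝ^N`. -/
abbrev Space (N : ℕ) := EuclideanSpace ℝ (Fin N)

section QuadBump
variable {V : Type*} [NormedAddCommGroup V]

/-- The bounded smooth function `‖z‖² / (1 + ‖z‖²)`. -/
def quadBump (z : V) : ℝ := ‖z‖ ^ 2 / (1 + ‖z‖ ^ 2)

lemma quadBump_nonneg (z : V) : 0 ≤ quadBump z := by unfold quadBump; positivity

lemma quadBump_le_one (z : V) : quadBump z ≤ 1 := by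
  unfold quadBump
  rw [div_le_one (by positivity)]
  linarith

lemma quadBump_zero : quadBump (0 : V) = 0 := by simp [quadBump]

lemma quadBump_neg (z : V) : quadBump (-z) = quadBump z := by simp [quadBump]

lemma contDiff_quadBump [InnerProductSpace ℝ V] : ContDiff ℝ 2 (quadBump : V → ℝ) := by
  unfold quadBump
  exact (contDiff_norm_sq ℝ).div (contDiff_const.add (contDiff_norm_sq ℝ))
    fun z => by positivity

lemma quadBump_eq (z : V) : quadBump z = 1 - 1 / (1 + ‖z‖ ^ 2) := by
  unfold quadBump
  field_simp
  ring

/-- For `‖z‖ ≥ ρ` the function `quadBump` is bounded from below. -/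
lemma quadBump_lower {ρ : ℝ} (hρ : 0 ≤ ρ) {z : V} (hz : ρ ≤ ‖z‖) :
    ρ ^ 2 / (1 + ρ ^ 2) ≤ quadBump z := by
  unfold quadBump
  rw [div_le_div_iff₀ (by positivity) (by positivity)]
  nlinarith [pow_le_pow_left₀ hρ hz 2]

lemma quadBump_pos {z : V} (hz : z ≠ 0) : 0 < quadBump z := by
  have : 0 < ‖z‖ := norm_pos_iff.mpr hz
  unfold quadBump
  positivity

/-- Since the bump is 1 - 1/(1 + |x|²), reciprocals must be bounded from below. Convexity of 1/r
removes the inner product b: 1/(a+m+2b) + 1/(a+m-2b) ≥ 2/(a+m). -/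
lemma quadBump_second_diff_le_sq [InnerProductSpace ℝ V] (x z : V) :
    quadBump (x + z) + quadBump (x - z) - 2 * quadBump x ≤ 2 * ‖z‖ ^ 2 := by
  rw [quadBump_eq, quadBump_eq, quadBump_eq]
  have h1 := norm_add_sq_real x z
  have h2 := norm_sub_sq_real x z
  set b := inner ℝ x z
  set a := 1 + ‖x‖ ^ 2 with ha
  set m := ‖z‖ ^ 2 with hm
  have ha1 : 1 ≤ a := by rw [ha]; linarith [sq_nonneg ‖x‖]
  have hm0 : 0 ≤ m := sq_nonneg _
  have hp : 0 < a + m + 2 * b := by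
    rw [show a + m + 2 * b = 1 + ‖x + z‖ ^ 2 by rw [h1]; ring]; positivity
  have hq : 0 < a + m - 2 * b := by
    rw [show a + m - 2 * b = 1 + ‖x - z‖ ^ 2 by rw [h2]; ring]; positivity
  rw [show 1 + ‖x + z‖ ^ 2 = a + m + 2 * b by rw [h1]; ring,
    show 1 + ‖x - z‖ ^ 2 = a + m - 2 * b by rw [h2]; ring]
  have h3 : 2 / (a + m) ≤ 1 / (a + m + 2 * b) + 1 / (a + m - 2 * b) := by
    rw [div_add_div _ _ hp.ne' hq.ne', div_le_div_iff₀ (by linarith) (by positivity)]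
    nlinarith [sq_nonneg b]
  have h4 : 2 / a - 2 / (a + m) ≤ 2 * m := by
    rw [div_sub_div _ _ (by linarith) (by linarith), div_le_iff₀ (by nlinarith)]
    have : 1 ≤ a * (a + m) := by nlinarith
    nlinarith
  have h5 : 2 / a = 2 * (1 / a) := by ring
  linarith

/-- Combines the quadratic bound with the trivial bound 2: with m = |z|², min(2m, 2) ≤ 4m/(1+m). The
right-hand side is bounded in z and hence integrable against the Lévy kernel. -/
lemma quadBump_second_diff_le [InnerProductSpace ℝ V] (x z : V) :
    quadBump (x + z) + quadBump (x - z) - 2 * quadBump x ≤ 4 * quadBump z := by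
  have h1 := quadBump_second_diff_le_sq x z
  have h2 : quadBump (x + z) + quadBump (x - z) - 2 * quadBump x ≤ 2 := by
    linarith [quadBump_le_one (x + z), quadBump_le_one (x - z), quadBump_nonneg x]
  rw [show 4 * quadBump z = 4 * ‖z‖ ^ 2 / (1 + ‖z‖ ^ 2) by rw [quadBump]; ring,
    le_div_iff₀ (by positivity)]
  nlinarith [sq_nonneg ‖z‖]

end QuadBump

section Scheme
variable {N : ℕ} {σ θ T LF h τ : ℝ} {F : ℝ → ℝ}
  {f : EuclideanSpace ℝ (Fin N) → ℝ → ℝ} {u₀ : EuclideanSpace ℝ (Fin N) → ℝ}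

lemma discLap_le_of_second_diff_le {φ : (Space N) → ℝ} {A : ℝ}
    (hφ : ∀ x z, φ (x + z) + φ (x - z) - 2 * φ x ≤ A * ‖z‖ ^ 2) (hh : h ≠ 0) (x : Space N) :
    discLap (spaceStep N h) h φ x ≤ N * A := by
  have h1 : ∀ k ∈ (Finset.univ : Finset (Fin N)),
      (φ (x + spaceStep N h k) - 2 * φ x + φ (x - spaceStep N h k)) / h ^ 2 ≤ A := by
    intro k _
    have h2 := hφ x (spaceStep N h k)
    have h3 : ‖spaceStep N h k‖ ^ 2 = h ^ 2 := by
      simp [spaceStep, norm_smul]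
    rw [div_le_iff₀ (by positivity)]
    rw [h3] at h2
    linarith
  calc discLap (spaceStep N h) h φ x ≤ ∑ _k : Fin N, A := Finset.sum_le_sum h1
    _ = N * A := by simp

/-- The integral `∫₀^∞ min(1, A t) t^{-1-σ/2} dt`. -/
def tailInt (σ A : ℝ) : ℝ := ∫ t in Ioi (0 : ℝ), min 1 (A * t) / t ^ (1 + σ / 2)

/-- The semigroup increment is at most 1 because 0 ≤ φ ≤ 1, and at most A t because of the bound on
the Laplacian. The resulting estimate does not depend on h, and so the barriers do not either. -/
lemma discFracLap_le_tailInt (hσ : σ ∈ Ioo (0 : ℝ) 2) {φ : (Space N) → ℝ} {A : ℝ} (hA : 0 ≤ A)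
    (h0 : ∀ x, 0 ≤ φ x) (h1 : ∀ x, φ x ≤ 1)
    (hlap : ∀ x, discLap (spaceStep N h) h φ x ≤ A) (x : Space N) :
    discFracLap (spaceStep N h) h σ φ x ≤ gammaConst σ * tailInt σ A := by
  have hφ : IsBddFun φ := ⟨1, fun y => abs_le.mpr ⟨by linarith [h0 y], h1 y⟩⟩
  refine mul_le_mul_of_nonneg_left ?_ (gammaConst_pos hσ).le
  refine setIntegral_mono_on (integrableOn_discHeat_sub _ h hσ hφ x)
    (integrableOn_min_div_rpow hσ hA) measurableSet_Ioi fun t ht => ?_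
  have ht0 : 0 < t := ht
  refine div_le_div_of_nonneg_right (le_min ?_ ?_) (by positivity)
  · have := discHeat_mono (spaceStep N h) h ht0.le hφ (IsBddFun.const 1) h1 x
    rw [discHeat_const] at this
    linarith [h0 x]
  · exact discHeat_sub_le_of_discLap_le _ h ht0.le hφ hlap x

lemma BoundedOnSlab.isBddFun {w : (Space N) → ℝ → ℝ} (hw : BoundedOnSlab T w) {t : ℝ}
    (ht : t ∈ Icc (0 : ℝ) T) : IsBddFun (fun x => w x t) := by
  obtain ⟨C, hC⟩ := hw
  exact ⟨C, fun x => hC x t ht⟩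

lemma BoundedOnSlab.sub {w v : (Space N) → ℝ → ℝ} (hw : BoundedOnSlab T w) (hv : BoundedOnSlab T v) :
    BoundedOnSlab T (fun x t => w x t - v x t) := by
  obtain ⟨C, hC⟩ := hw
  obtain ⟨D, hD⟩ := hv
  exact ⟨C + D, fun x t ht => (abs_sub _ _).trans (add_le_add (hC x t ht) (hD x t ht))⟩

lemma BoundedOnSlab.neg {w : (Space N) → ℝ → ℝ} (hw : BoundedOnSlab T w) :
    BoundedOnSlab T (fun x t => -w x t) := by
  obtain ⟨C, hC⟩ := hw
  exact ⟨C, fun x t ht => by simpa using hC x t ht⟩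

/-- The slab is unbounded and solutions of the scheme need not be continuous, so suprema need not be
attained; approximate maxima replace maxima throughout the analysis of the scheme. -/
lemma BoundedOnSlab.exists_almost_max (hT : 0 ≤ T) {w : (Space N) → ℝ → ℝ} (hw : BoundedOnSlab T w)
    {δ : ℝ} (hδ : 0 < δ) :
    ∃ y, ∃ s ∈ Icc (0 : ℝ) T, ∀ x, ∀ t ∈ Icc (0 : ℝ) T, w x t ≤ w y s + δ := by
  obtain ⟨C, hC⟩ := hw
  set A : Set ℝ := {r | ∃ y, ∃ s ∈ Icc (0 : ℝ) T, r = w y s}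
  have hA : BddAbove A := ⟨C, by
    rintro r ⟨y, s, hs, rfl⟩
    exact (le_abs_self _).trans (hC y s hs)⟩
  obtain ⟨r, ⟨y, s, hs, rfl⟩, hr⟩ := exists_lt_of_lt_csSup
    (⟨w 0 0, 0, 0, ⟨le_rfl, hT⟩, rfl⟩ : A.Nonempty) (sub_lt_self (sSup A) hδ)
  exact ⟨y, s, hs, fun x t ht => by linarith [le_csSup hA ⟨x, t, ht, rfl⟩]⟩

lemma cfl_jumpRate (hσ : σ ∈ Ioo (0 : ℝ) 2) (hh : 0 < h)
    (hcfl : (1 - θ) * τ * (LF * cflConst N σ) ≤ h ^ σ) :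
    τ * LF * (1 - θ) * jumpRate N σ h ≤ 1 := by
  rw [jumpRate_eq N hσ hh, ← mul_div_assoc, div_le_one (Real.rpow_pos_of_pos hh σ)]
  linarith

/-- Monotonicity of the scheme, tested at an approximate maximum point. -/
lemma IsSpaceSolution.test_at_almost_max (hσ : σ ∈ Ioo (0 : ℝ) 2) (hθ : θ ∈ Icc (0 : ℝ) 1)
    (hF : OneSidedLipschitz F LF) (hτ : 0 < τ)
    (hcfl : τ * LF * (1 - θ) * jumpRate N σ h ≤ 1)
    {U φ : (Space N) → ℝ → ℝ} (hU : IsSpaceSolution σ θ T F f u₀ h τ U) (hφ : BoundedOnSlab T φ)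
    {δ : ℝ} {y : Space N} {s : ℝ} (hs : s ∈ Icc τ T)
    (hmax : ∀ x, ∀ t ∈ Icc (0 : ℝ) T, U x t - φ x t ≤ U y s - φ y s + δ) :
    φ y s - φ y (s - τ) ≤
      τ * (F ((1 - θ) * discFracLap (spaceStep N h) h σ (fun x => φ x (s - τ)) y +
        θ * discFracLap (spaceStep N h) h σ (fun x => φ x s) y) + f y (s - τ)) +
      δ * (1 + τ * LF * θ * jumpRate N σ h) := by
  have hs0 : s ∈ Icc (0 : ℝ) T := ⟨hτ.le.trans hs.1, hs.2⟩
  have hs1 : s - τ ∈ Icc (0 : ℝ) T := ⟨by linarith [hs.1], by linarith [hs.2]⟩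
  have hK := jumpRate_nonneg N hσ h
  have hL := hF.nonneg
  have hθ1 : 0 ≤ 1 - θ := by linarith [hθ.2]
  set K := jumpRate N σ h
  set ξ := U y s - φ y s + δ with hξ
  have h1 := discFracLap_le (spaceStep N h) h hσ (hU.bounded.isBddFun hs0) (hφ.isBddFun hs0)
    (ξ := ξ) (fun x => by linarith [hmax x s hs0]) y
  have h2 := discFracLap_le (spaceStep N h) h hσ (hU.bounded.isBddFun hs1) (hφ.isBddFun hs1)
    (ξ := ξ) (fun x => by linarith [hmax x (s - τ) hs1]) y
  set a := discFracLap (spaceStep N h) h σ (fun x => U x s) y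
  set b := discFracLap (spaceStep N h) h σ (fun x => U x (s - τ)) y
  set a' := discFracLap (spaceStep N h) h σ (fun x => φ x s) y
  set b' := discFracLap (spaceStep N h) h σ (fun x => φ x (s - τ)) y
  have hδ : 0 ≤ δ := by linarith [hmax y s hs0]
  have hg : 0 ≤ φ y (s - τ) + ξ - U y (s - τ) := by linarith [hmax y (s - τ) hs1]
  set g := φ y (s - τ) + ξ - U y (s - τ) with hgdef
  have h1' : a ≤ a' + K * δ := by
    have : φ y s + ξ - U y s = δ := by rw [hξ]; ring
    rw [this] at h1; exact h1
  set X := (1 - θ) * b' + θ * a'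
  set D := (1 - θ) * (K * g) + θ * (K * δ) with hD
  have hD0 : 0 ≤ D := by have := hθ.1; positivity
  have h3 : (1 - θ) * b + θ * a ≤ X + D := by
    have e1 := mul_le_mul_of_nonneg_left h2 hθ1
    have e2 := mul_le_mul_of_nonneg_left h1' hθ.1
    calc (1 - θ) * b + θ * a ≤ (1 - θ) * (b' + K * g) + θ * (a' + K * δ) := add_le_add e1 e2
      _ = X + D := by ring
  have h4 : F ((1 - θ) * b + θ * a) ≤ F X + LF * D := by
    have e1 := hF.mono h3
    have e2 := hF (X + D) X
    rw [add_sub_cancel_left, max_eq_right hD0] at e2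
    linarith
  have h5 := hU.step y s hs
  -- The CFL condition enters here: g is the gap at the previous time level, and its coefficient τ
  -- LF (1-θ) K is at most 1, so the explicit part is absorbed by g itself.
  have h6 : τ * (LF * D) ≤ g + δ * (τ * LF * θ * K) := by
    have := mul_le_mul_of_nonneg_right hcfl hg
    calc τ * (LF * D) = τ * LF * (1 - θ) * K * g + δ * (τ * LF * θ * K) := by rw [hD]; ring
      _ ≤ g + δ * (τ * LF * θ * K) := by linarith
  have h7 := mul_le_mul_of_nonneg_left h4 hτ.le
  have h8 : U y s = U y (s - τ) + τ * (F ((1 - θ) * b + θ * a) + f y (s - τ)) := h5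
  have h9 : φ y s - φ y (s - τ) = U y s - U y (s - τ) + δ - g := by rw [hgdef, hξ]; ring
  rw [h9, h8]
  linarith

/-- Comparison of a solution of the scheme with a strict supersolution. -/
lemma IsSpaceSolution.le_of_strict_supersolution (hσ : σ ∈ Ioo (0 : ℝ) 2)
    (hθ : θ ∈ Icc (0 : ℝ) 1) (hF : OneSidedLipschitz F LF) (hT : 0 ≤ T) (hτ : 0 < τ)
    (hcfl : τ * LF * (1 - θ) * jumpRate N σ h ≤ 1)
    {U φ : (Space N) → ℝ → ℝ} (hU : IsSpaceSolution σ θ T F f u₀ h τ U) (hφ : BoundedOnSlab T φ)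
    {η : ℝ} (hη : 0 < η) (hinit : ∀ x, ∀ t ∈ Ico (0 : ℝ) τ, u₀ x ≤ φ x t)
    (hsuper : ∀ y, ∀ s ∈ Icc τ T,
      τ * (F ((1 - θ) * discFracLap (spaceStep N h) h σ (fun x => φ x (s - τ)) y +
        θ * discFracLap (spaceStep N h) h σ (fun x => φ x s) y) + f y (s - τ)) + η ≤
      φ y s - φ y (s - τ)) :
    ∀ x, ∀ t ∈ Icc (0 : ℝ) T, U x t ≤ φ x t := by
  intro x t ht
  refine le_of_forall_pos_lt_add fun ε hε => ?_
  set c := 1 + τ * LF * θ * jumpRate N σ h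
  have hc : 1 ≤ c := by
    have := jumpRate_nonneg N hσ h
    have := hF.nonneg
    have := hθ.1
    have : 0 ≤ τ * LF * θ * jumpRate N σ h := by positivity
    linarith
  -- The tolerance is so small that the error δ c of the approximate maximum costs only half of the
  -- strictness η.
  set δ := min (ε / 2) (η / (2 * c))
  have hδ : 0 < δ := lt_min (by positivity) (by positivity)
  obtain ⟨y, s, hs, hmax⟩ := (hU.bounded.sub hφ).exists_almost_max hT hδ
  rcases lt_or_ge s τ with h1 | h1
  · have h2 := hinit y s ⟨hs.1, h1⟩
    have h3 := hU.initial y s ⟨hs.1, h1⟩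
    have h4 := hmax x t ht
    have h5 : δ ≤ ε / 2 := min_le_left _ _
    linarith
  · have h2 := hU.test_at_almost_max hσ hθ hF hτ hcfl hφ ⟨h1, hs.2⟩ hmax
    have h3 := hsuper y s ⟨h1, hs.2⟩
    have h4 : δ * c ≤ η / 2 := by
      calc δ * c ≤ η / (2 * c) * c := mul_le_mul_of_nonneg_right (min_le_right _ _) (by linarith)
        _ = η / 2 := by field_simp
    linarith

/-- Barrier for the scheme, uniform in the discretization parameters. -/
lemma IsSpaceSolution.le_barrier (hσ : σ ∈ Ioo (0 : ℝ) 2)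
    (hθ : θ ∈ Icc (0 : ℝ) 1) (hF : OneSidedLipschitz F LF) (hT : 0 ≤ T) (hh : 0 < h) (hτ : 0 < τ)
    (hcfl : τ * LF * (1 - θ) * jumpRate N σ h ≤ 1)
    {U : (Space N) → ℝ → ℝ} (hU : IsSpaceSolution σ θ T F f u₀ h τ U)
    {B : ℝ} (hB : ∀ x, ∀ t ∈ Icc (0 : ℝ) T, |f x t| ≤ B) {a b : ℝ} (hb : 0 ≤ b) {x₀ : Space N}
    (hu₀ : ∀ x, u₀ x ≤ a + b * quadBump (x - x₀)) :
    ∀ x, ∀ t ∈ Icc (0 : ℝ) T, U x t ≤ a + b * quadBump (x - x₀) +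
      (|F (b * (gammaConst σ * tailInt σ (N * 2)))| + B + 1) * t := by
  set L := gammaConst σ * tailInt σ (N * 2)
  set C := |F (b * L)| + B + 1 with hC
  have hB0 : 0 ≤ B := (abs_nonneg _).trans (hB 0 0 ⟨le_rfl, hT⟩)
  have hC0 : 0 ≤ C := by positivity
  have hq : IsBddFun (fun x : Space N => quadBump (x - x₀)) :=
    ⟨1, fun y => abs_le.mpr ⟨by linarith [quadBump_nonneg (y - x₀)], quadBump_le_one _⟩⟩
  have hlap : ∀ s y, discFracLap (spaceStep N h) h σ
      (fun x => a + b * quadBump (x - x₀) + C * s) y ≤ b * L := by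
    intro s y
    have h1 : (fun x : Space N => a + b * quadBump (x - x₀) + C * s) =
        fun x => b * quadBump (x - x₀) + (a + C * s) := by funext x; ring
    rw [h1, discFracLap_add _ h hσ (hq.const_mul b) (IsBddFun.const _), discFracLap_const,
      discFracLap_const_mul _ h hq, add_zero]
    refine mul_le_mul_of_nonneg_left (discFracLap_le_tailInt hσ (by positivity)
      (fun x => quadBump_nonneg _) (fun x => quadBump_le_one _) (fun x =>
        discLap_le_of_second_diff_le (fun x z => ?_) hh.ne' x) y) hb
    have := quadBump_second_diff_le_sq (x - x₀) z
    rwa [show x - x₀ + z = x + z - x₀ by abel, show x - x₀ - z = x - z - x₀ by abel] at this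
  -- The summand 1 in C supplies the strictness: over one time step it contributes exactly τ, which
  -- is taken as η.
  refine hU.le_of_strict_supersolution hσ hθ hF hT hτ hcfl (φ := fun x t =>
    a + b * quadBump (x - x₀) + C * t) ⟨|a| + b + C * T, fun x t ht => ?_⟩ (η := τ) hτ
    (fun x t ht => ?_) (fun y s hs => ?_)
  · have h1 := quadBump_nonneg (x - x₀)
    have h2 := quadBump_le_one (x - x₀)
    have h3 : b * quadBump (x - x₀) ≤ b := mul_le_of_le_one_right hb h2
    have h4 : 0 ≤ b * quadBump (x - x₀) := by positivity
    have h5 : C * t ≤ C * T := mul_le_mul_of_nonneg_left ht.2 hC0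
    have h6 : 0 ≤ C * t := mul_nonneg hC0 ht.1
    rw [abs_le]
    constructor <;> linarith [neg_abs_le a, le_abs_self a]
  · linarith [hu₀ x, mul_nonneg hC0 ht.1]
  · have hs1 : s - τ ∈ Icc (0 : ℝ) T := ⟨by linarith [hs.1], by linarith [hs.2]⟩
    have h1 := hlap (s - τ) y
    have h2 := hlap s y
    have hθ1 : 0 ≤ 1 - θ := by linarith [hθ.2]
    have h3 : (1 - θ) * discFracLap (spaceStep N h) h σ
        (fun x => a + b * quadBump (x - x₀) + C * (s - τ)) y +
        θ * discFracLap (spaceStep N h) h σ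
        (fun x => a + b * quadBump (x - x₀) + C * s) y ≤ b * L := by
      have e1 := mul_le_mul_of_nonneg_left h1 hθ1
      have e2 := mul_le_mul_of_nonneg_left h2 hθ.1
      linarith
    have h4 := (hF.mono h3).trans (le_abs_self _)
    have h5 := (le_abs_self _).trans (hB y (s - τ) hs1)
    have h6 := mul_le_mul_of_nonneg_left (add_le_add h4 h5) hτ.le
    rw [hC]
    linarith

end Scheme

end
end ThetaScheme

/-! ### Heat kernels, subordination and the central limit theorem for the walk -/

namespace ThetaScheme
noncomputable section
variable {N : ℕ}

/-! ### The Gaussian density -/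

/-- The heat kernel `(4πt)^{-N/2} e^{-|z|²/(4t)}`. -/
def gaussDens (t : ℝ) (z : Space N) : ℝ :=
  (4 * Real.pi * t) ^ (-((N : ℝ) / 2)) * Real.exp (-(1 / (4 * t)) * ‖z‖ ^ 2)

lemma gaussDens_nonneg {t : ℝ} (ht : 0 < t) (z : Space N) : 0 ≤ gaussDens t z := by
  have := Real.pi_pos
  unfold gaussDens
  positivity

lemma gaussDens_neg (t : ℝ) (z : Space N) : gaussDens t (-z) = gaussDens t z := by
  simp [gaussDens]

lemma measurable_gaussDens : Measurable (fun p : ℝ × Space N => gaussDens p.1 p.2) := by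
  unfold gaussDens
  fun_prop

lemma integral_gaussDens {t : ℝ} (ht : 0 < t) : ∫ z : Space N, gaussDens t z = 1 := by
  have hp := Real.pi_pos
  have h1 := GaussianFourier.integral_rexp_neg_mul_sq_norm (V := Space N)
    (b := 1 / (4 * t)) (by positivity)
  simp only [gaussDens]
  rw [integral_const_mul, h1, finrank_euclideanSpace, Fintype.card_fin,
    show Real.pi / (1 / (4 * t)) = 4 * Real.pi * t by field_simp,
    ← Real.rpow_add (by positivity)]
  simp

lemma integrable_gaussDens {t : ℝ} (ht : 0 < t) : Integrable (fun z : Space N => gaussDens t z) :=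
  Integrable.of_integral_ne_zero (by rw [integral_gaussDens ht]; exact one_ne_zero)

/-- The Gaussian measure with density `gaussDens`. -/
def gaussMeasure (N : ℕ) (t : ℝ) : Measure (Space N) :=
  volume.withDensity (fun z => ENNReal.ofReal (gaussDens t z))

lemma measurable_gaussDens_right (t : ℝ) : Measurable (gaussDens t : Space N → ℝ) :=
  measurable_gaussDens.comp (measurable_const.prodMk measurable_id)

lemma integral_gaussMeasure {X : Type*} [NormedAddCommGroup X] [NormedSpace ℝ X] {t : ℝ}
    (ht : 0 < t) (g : Space N → X) :
    ∫ z, g z ∂gaussMeasure N t = ∫ z, gaussDens t z • g z := by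
  rw [gaussMeasure, integral_withDensity_eq_integral_toReal_smul
    (measurable_gaussDens_right t).ennreal_ofReal (by simp)]
  simp_rw [ENNReal.toReal_ofReal (gaussDens_nonneg ht _)]

lemma isProbabilityMeasure_gaussMeasure {t : ℝ} (ht : 0 < t) :
    IsProbabilityMeasure (gaussMeasure N t) := by
  constructor
  rw [gaussMeasure, withDensity_apply _ MeasurableSet.univ, Measure.restrict_univ,
    ← ofReal_integral_eq_lintegral_ofReal (integrable_gaussDens ht)
      (Eventually.of_forall fun z => gaussDens_nonneg ht z), integral_gaussDens ht]
  simp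

lemma charFun_gaussMeasure {t : ℝ} (ht : 0 < t) (ξ : Space N) :
    charFun (gaussMeasure N t) ξ = (Real.exp (-(t * ‖ξ‖ ^ 2)) : ℝ) := by
  have hp := Real.pi_pos
  have h1 := GaussianFourier.integral_cexp_neg_mul_sq_norm_add (V := Space N)
    (b := ((1 / (4 * t) : ℝ) : ℂ)) (by rw [Complex.ofReal_re]; positivity) Complex.I ξ
  have h2 : (Real.pi : ℂ) / ((1 / (4 * t) : ℝ) : ℂ) = ((4 * Real.pi * t : ℝ) : ℂ) := by
    push_cast
    field_simp
  rw [charFun_apply, integral_gaussMeasure ht]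
  have h3 : ∀ z : Space N, gaussDens t z • Complex.exp (↑(inner ℝ z ξ) * Complex.I) =
      (((4 * Real.pi * t) ^ (-((N : ℝ) / 2)) : ℝ) : ℂ) *
        Complex.exp (-((1 / (4 * t) : ℝ) : ℂ) * ↑‖z‖ ^ 2 + Complex.I * ↑(inner ℝ ξ z)) := by
    intro z
    rw [Complex.exp_add, gaussDens, Complex.real_smul, Complex.ofReal_mul, Complex.ofReal_exp,
      real_inner_comm, mul_comm Complex.I]
    push_cast
    ring
  simp_rw [h3]
  rw [integral_const_mul, h1, h2, finrank_euclideanSpace, Fintype.card_fin,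
    show ((N : ℂ) / 2) = (((N : ℝ) / 2 : ℝ) : ℂ) by push_cast; ring,
    ← Complex.ofReal_cpow (by positivity), ← mul_assoc, ← Complex.ofReal_mul,
    ← Real.rpow_add (by positivity)]
  simp only [neg_add_cancel, Real.rpow_zero, Complex.ofReal_one, one_mul, Complex.I_sq]
  rw [Complex.ofReal_exp]
  congr 1
  push_cast
  field_simp

/-! ### The kernel of the fractional Laplacian -/

/-- The kernel `c / |z|^{N+σ}` of the fractional Laplacian. -/
def fracKernel (σ : ℝ) (z : Space N) : ℝ :=
  2 ^ σ * Real.Gamma (((N : ℝ) + σ) / 2) /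
    (Real.pi ^ ((N : ℝ) / 2) * |Real.Gamma (-(σ / 2))|) / ‖z‖ ^ ((N : ℝ) + σ)

lemma fracKernel_nonneg {σ : ℝ} (hσ : 0 < σ) (z : Space N) : 0 ≤ fracKernel σ z := by
  have h1 : 0 < Real.Gamma (((N : ℝ) + σ) / 2) := Real.Gamma_pos_of_pos (by positivity)
  have := Real.pi_pos
  unfold fracKernel
  positivity

lemma fracKernel_neg (σ : ℝ) (z : Space N) : fracKernel σ (-z) = fracKernel σ z := by
  simp [fracKernel]

/-- Subordination: the kernel is a mixture of heat kernels. -/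
lemma integral_gaussDens_div_rpow {σ : ℝ} (hσ : σ ∈ Ioo (0 : ℝ) 2) {z : Space N} (hz : z ≠ 0) :
    gammaConst σ * ∫ t in Ioi (0 : ℝ), gaussDens t z / t ^ (1 + σ / 2) = fracKernel σ z := by
  have hp := Real.pi_pos
  have hr : 0 < ‖z‖ := norm_pos_iff.mpr hz
  have hσ0 := hσ.1
  set a : ℝ := ((N : ℝ) + σ) / 2 with ha
  have ha0 : 0 < a := by positivity
  have h1 := Real.integral_rpow_mul_exp_neg_mul_Ioi ha0 (r := ‖z‖ ^ 2 / 4) (by positivity)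
  -- The inversion t ↦ 1/t turns the Gamma integral of exponent a = (N+σ)/2 into the mixture of
  -- Gaussians.
  rw [← integral_comp_rpow_Ioi _ (p := -1) (by norm_num)] at h1
  have h2 : ∫ t in Ioi (0 : ℝ), gaussDens t z / t ^ (1 + σ / 2) =
      (4 * Real.pi) ^ (-((N : ℝ) / 2)) * ((1 / (‖z‖ ^ 2 / 4)) ^ a * Real.Gamma a) := by
    rw [← h1, ← integral_const_mul]
    refine setIntegral_congr_fun measurableSet_Ioi fun t ht => ?_
    have ht0 : 0 < t := ht
    have e1 : (4 * Real.pi * t) ^ (-((N : ℝ) / 2)) =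
        (4 * Real.pi) ^ (-((N : ℝ) / 2)) * t ^ (-((N : ℝ) / 2)) :=
      Real.mul_rpow (by positivity) ht0.le
    have e2 : t ^ (-1 : ℝ) = t⁻¹ := Real.rpow_neg_one t
    have e3 : (t ^ (-1 : ℝ)) ^ (a - 1) = t ^ (1 - a) := by
      rw [← Real.rpow_mul ht0.le]; congr 1; ring
    have e4 : t ^ (-((N : ℝ) / 2)) / t ^ (1 + σ / 2) = t ^ (-1 - 1 : ℝ) * t ^ (1 - a) := by
      rw [← Real.rpow_sub ht0, ← Real.rpow_add ht0]
      congr 1; rw [ha]; ring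
    have e5 : -(‖z‖ ^ 2 / 4 * t ^ (-1 : ℝ)) = -(1 / (4 * t)) * ‖z‖ ^ 2 := by
      rw [e2]; field_simp
    simp only [gaussDens, smul_eq_mul]
    rw [e1, e3, e5, abs_neg, abs_one, one_mul]
    calc _ = (4 * Real.pi) ^ (-((N : ℝ) / 2)) * (t ^ (-((N : ℝ) / 2)) / t ^ (1 + σ / 2)) *
          Real.exp (-(1 / (4 * t)) * ‖z‖ ^ 2) := by ring
      _ = _ := by rw [e4]; ring
  rw [h2, gammaConst, fracKernel]
  have e6 : (1 / (‖z‖ ^ 2 / 4)) ^ a = 2 ^ ((N : ℝ) + σ) / ‖z‖ ^ ((N : ℝ) + σ) := by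
    rw [show 1 / (‖z‖ ^ 2 / 4) = (2 / ‖z‖) ^ (2 : ℝ) by
        rw [Real.rpow_two]; field_simp; norm_num,
      ← Real.rpow_mul (by positivity), Real.div_rpow (by norm_num) hr.le,
      show 2 * a = (N : ℝ) + σ by rw [ha]; ring]
  have e7 : (4 * Real.pi) ^ (-((N : ℝ) / 2)) = (2 ^ (N : ℝ))⁻¹ * (Real.pi ^ ((N : ℝ) / 2))⁻¹ := by
    rw [Real.rpow_neg (by positivity), Real.mul_rpow (by norm_num) hp.le, mul_inv,
      show (4 : ℝ) = 2 ^ (2 : ℝ) by norm_num, ← Real.rpow_mul (by norm_num)]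
    congr 4; ring
  rw [e6, e7, ← ha, Real.rpow_add (by norm_num : (0 : ℝ) < 2)]
  have : (0 : ℝ) < 2 ^ (N : ℝ) := by positivity
  field_simp

/-! ### Convergence of the random walk to the Gaussian -/

/-- The law at time `t` of the random walk generated by the discrete Laplacian. -/
def walkMeasure (N : ℕ) (h t : ℝ) : Measure (Space N) :=
  Measure.sum fun j : Fin N → ℤ =>
    ENNReal.ofReal (heatWeight j (t / h ^ 2)) • Measure.dirac (latVec (spaceStep N h) j)

lemma isProbabilityMeasure_walkMeasure (h : ℝ) {t : ℝ} (ht : 0 ≤ t) :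
    IsProbabilityMeasure (walkMeasure N h t) := by
  have h1 := hasSum_heatWeight N (t := t / h ^ 2) (by positivity)
  constructor
  rw [walkMeasure, Measure.sum_apply _ MeasurableSet.univ]
  simp only [Measure.smul_apply, measure_univ, smul_eq_mul, mul_one]
  rw [← ENNReal.ofReal_tsum_of_nonneg (fun j => heatWeight_nonneg j (by positivity)) h1.summable,
    h1.tsum_eq, ENNReal.ofReal_one]

lemma integral_walkMeasure (h : ℝ) {t : ℝ} (ht : 0 ≤ t) {g : Space N → ℝ} (hg : IsBddFun g)
    (hgm : Measurable g) :
    ∫ z, g z ∂walkMeasure N h t = discHeat (spaceStep N h) h t g 0 := by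
  have := isProbabilityMeasure_walkMeasure (N := N) h ht
  have hint : Integrable g (walkMeasure N h t) := by
    obtain ⟨C, hC⟩ := hg
    exact Integrable.of_bound hgm.aestronglyMeasurable C (Eventually.of_forall hC)
  have h1 := hasSum_integral_measure hint
  refine HasSum.unique ?_ (hasSum_discHeat (spaceStep N h) ht hg 0)
  convert! h1 using 2 with j
  rw [integral_smul_measure, integral_dirac, zero_add,
    ENNReal.toReal_ofReal (heatWeight_nonneg j (by positivity)), smul_eq_mul]

/-- The symbol of the discrete Laplacian. -/
def lapSymbol (h : ℝ) (ξ : Space N) : ℝ := ∑ k, (2 * Real.cos (h * ξ k) - 2) / h ^ 2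

lemma discHeat_of_eigen {G : Type*} [AddCommGroup G] {n : ℕ} {e : Fin n → G} {h c : ℝ} {φ : G → ℝ}
    (hφ : discLap e h φ = fun x => c * φ x) (t : ℝ) (x : G) :
    discHeat e h t φ x = Real.exp (t * c) * φ x := by
  have h1 : ∀ m : ℕ, (discLap e h)^[m] φ = fun x => c ^ m * φ x := by
    intro m
    induction m with
    | zero => simp
    | succ m ih =>
      rw [Function.iterate_succ_apply', ih]
      funext y
      have h2 := congrFun hφ y
      simp only [discLap] at h2 ⊢
      rw [pow_succ c m, mul_assoc, ← h2, Finset.mul_sum]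
      refine Finset.sum_congr rfl fun k _ => ?_
      ring
  rw [discHeat, Real.exp_eq_exp_ℝ, NormedSpace.exp_eq_tsum_div, ← tsum_mul_right]
  congr 1
  funext m
  rw [h1, mul_pow]
  ring

lemma inner_spaceStep (h : ℝ) (k : Fin N) (ξ : Space N) :
    inner ℝ (spaceStep N h k) ξ = h * ξ k := by
  rw [spaceStep, real_inner_smul_left, EuclideanSpace.inner_single_left]
  simp

lemma discLap_cos (h : ℝ) (ξ : Space N) :
    discLap (spaceStep N h) h (fun z => Real.cos (inner ℝ z ξ)) =
      fun z => lapSymbol h ξ * Real.cos (inner ℝ z ξ) := by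
  funext z
  rw [discLap, lapSymbol, Finset.sum_mul]
  refine Finset.sum_congr rfl fun k _ => ?_
  rw [inner_add_left, inner_sub_left, inner_spaceStep, Real.cos_add, Real.cos_sub]
  ring

lemma discLap_sin (h : ℝ) (ξ : Space N) :
    discLap (spaceStep N h) h (fun z => Real.sin (inner ℝ z ξ)) =
      fun z => lapSymbol h ξ * Real.sin (inner ℝ z ξ) := by
  funext z
  rw [discLap, lapSymbol, Finset.sum_mul]
  refine Finset.sum_congr rfl fun k _ => ?_
  rw [inner_add_left, inner_sub_left, inner_spaceStep, Real.sin_add, Real.sin_sub]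
  ring

/-- The cosine and sine of ⟨z, ξ⟩ are eigenfunctions of the discrete Laplacian for the same
eigenvalue `lapSymbol h ξ`; evaluating the semigroup on them at the origin gives the real and
imaginary parts. -/
lemma charFun_walkMeasure (h : ℝ) {t : ℝ} (ht : 0 ≤ t) (ξ : Space N) :
    charFun (walkMeasure N h t) ξ = (Real.exp (t * lapSymbol h ξ) : ℝ) := by
  have := isProbabilityMeasure_walkMeasure (N := N) h ht
  have hc : IsBddFun (fun z : Space N => Real.cos (inner ℝ z ξ)) :=
    ⟨1, fun z => Real.abs_cos_le_one _⟩
  have hs : IsBddFun (fun z : Space N => Real.sin (inner ℝ z ξ)) :=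
    ⟨1, fun z => Real.abs_sin_le_one _⟩
  have h1 := integral_walkMeasure h ht hc (by fun_prop)
  have h2 := integral_walkMeasure h ht hs (by fun_prop)
  rw [discHeat_of_eigen (discLap_cos h ξ)] at h1
  rw [discHeat_of_eigen (discLap_sin h ξ)] at h2
  simp only [inner_zero_left, Real.cos_zero, Real.sin_zero, mul_one, mul_zero] at h1 h2
  rw [charFun_apply]
  have hint : Integrable (fun z : Space N => Complex.exp (↑(inner ℝ z ξ) * Complex.I))
      (walkMeasure N h t) :=
    Integrable.of_bound (by fun_prop) 1
      (Eventually.of_forall fun z => (Complex.norm_exp_ofReal_mul_I _).le)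
  apply Complex.ext
  · rw [Complex.ofReal_re, ← h1]
    have := integral_re hint
    simp only [RCLike.re_to_complex] at this
    rw [← this]
    congr 1
    funext z
    exact (Complex.exp_ofReal_mul_I_re _)
  · rw [Complex.ofReal_im, ← h2]
    have := integral_im hint
    simp only [RCLike.im_to_complex] at this
    rw [← this]
    congr 1
    funext z
    exact (Complex.exp_ofReal_mul_I_im _)

lemma tendsto_lapSymbol {h : ℕ → ℝ} (hh : Tendsto h atTop (𝓝 0)) (hpos : ∀ n, 0 < h n)
    (ξ : Space N) : Tendsto (fun n => lapSymbol (h n) ξ) atTop (𝓝 (-‖ξ‖ ^ 2)) := by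
  have h1 : ∀ c : ℝ, Tendsto (fun n => (2 * Real.cos (h n * c) - 2) / h n ^ 2) atTop
      (𝓝 (-c ^ 2)) := by
    intro c
    have h2 : Tendsto (fun n => h n * c) atTop (𝓝 0) := by simpa using hh.mul_const c
    have h3 : ∀ᶠ n in atTop, |h n * c| ≤ 1 := by
      have := h2.abs
      rw [abs_zero] at this
      exact (this.eventually_lt_const one_pos).mono fun n hn => hn.le
    rw [tendsto_iff_dist_tendsto_zero]
    -- The remainder 5/96 |h c|⁴ of `Real.cos_bound`, doubled and divided by h².
    have h4 : Tendsto (fun n => h n ^ 2 * (c ^ 4 * (5 / 48))) atTop (𝓝 0) := by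
      simpa using (hh.pow 2).mul_const (c ^ 4 * (5 / 48))
    refine squeeze_zero' (Eventually.of_forall fun n => dist_nonneg) ?_ h4
    filter_upwards [h3] with n hn
    have h5 := Real.cos_bound hn
    have h6 := hpos n
    rw [Real.dist_eq, show (2 * Real.cos (h n * c) - 2) / h n ^ 2 - -c ^ 2 =
      2 * (Real.cos (h n * c) - (1 - (h n * c) ^ 2 / 2)) / h n ^ 2 by field_simp; ring,
      abs_div, abs_mul, abs_of_pos (by positivity : 0 < h n ^ 2), div_le_iff₀ (by positivity),
      abs_two]
    have h7 : |h n * c| ^ 4 = h n ^ 4 * c ^ 4 := by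
      rw [show |h n * c| ^ 4 = (|h n * c| ^ 2) ^ 2 by ring, sq_abs]; ring
    rw [h7] at h5
    linarith
  have h2 : -‖ξ‖ ^ 2 = ∑ k, -(ξ k) ^ 2 := by
    rw [EuclideanSpace.norm_sq_eq]
    simp
  rw [h2]
  exact tendsto_finsetSum _ fun k _ => h1 (ξ k)

/-- Lévy's continuity theorem: the symbol tends to -|ξ|², so the characteristic functions of the
walk converge to that of the Gaussian. -/
lemma tendsto_integral_walkMeasure {h : ℕ → ℝ} (hh : Tendsto h atTop (𝓝 0)) (hpos : ∀ n, 0 < h n)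
    {t : ℝ} (ht : 0 < t) {g : Space N → ℝ} (hg : IsBddFun g) (hgc : Continuous g) :
    Tendsto (fun n => discHeat (spaceStep N (h n)) (h n) t g 0) atTop
      (𝓝 (∫ z, gaussDens t z * g z)) := by
  let μ : ℕ → ProbabilityMeasure (Space N) := fun n =>
    ⟨walkMeasure N (h n) t, isProbabilityMeasure_walkMeasure _ ht.le⟩
  let μ₀ : ProbabilityMeasure (Space N) := ⟨gaussMeasure N t, isProbabilityMeasure_gaussMeasure ht⟩
  have h1 : Tendsto μ atTop (𝓝 μ₀) := by
    rw [ProbabilityMeasure.tendsto_iff_tendsto_charFun]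
    intro ξ
    change Tendsto (fun n => charFun (walkMeasure N (h n) t) ξ) atTop
      (𝓝 (charFun (gaussMeasure N t) ξ))
    simp_rw [charFun_walkMeasure _ ht.le]
    rw [charFun_gaussMeasure ht]
    refine (Complex.continuous_ofReal.tendsto _).comp ((Real.continuous_exp.tendsto _).comp ?_)
    have := (tendsto_lapSymbol hh hpos ξ).const_mul t
    rwa [mul_neg] at this
  obtain ⟨C, hC⟩ := hg
  let g' : BoundedContinuousFunction (Space N) ℝ :=
    BoundedContinuousFunction.ofNormedAddCommGroup g hgc C hC
  have h2 := (ProbabilityMeasure.tendsto_iff_forall_integral_tendsto.mp h1) g'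
  have h3 : ∫ z, g' z ∂(μ₀ : Measure (Space N)) = ∫ z, gaussDens t z * g z :=
    integral_gaussMeasure ht g
  rw [h3] at h2
  refine h2.congr fun n => ?_
  exact integral_walkMeasure (h n) ht.le ⟨C, hC⟩ hgc.measurable

end
end ThetaScheme

/-! ### Consistency of the discrete fractional Laplacian -/

namespace ThetaScheme
noncomputable section
variable {N : ℕ} {σ : ℝ}

/-- The symmetric second difference `φ(x+z) + φ(x-z) - 2 φ(x)`. -/
def secondDiff {V : Type*} [AddCommGroup V] (φ : V → ℝ) (x z : V) : ℝ :=
  φ (x + z) + φ (x - z) - 2 * φ x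

/-- Tightness of the walk, uniformly in h: the rescaled bump has second differences of order R⁻² and
is at least 1/2 outside the ball of radius R, so the mass there at time t is O(t/R²). -/
lemma discHeat_quadBump_le (h : ℝ) (hh : h ≠ 0) {t : ℝ} (ht : 0 ≤ t) {R : ℝ} (hR : 0 < R) :
    discHeat (spaceStep N h) h t (fun z => quadBump (R⁻¹ • z)) 0 ≤ N * (2 / R ^ 2) * t := by
  have hq : IsBddFun (fun z : Space N => quadBump (R⁻¹ • z)) :=
    ⟨1, fun y => abs_le.mpr ⟨by linarith [quadBump_nonneg (R⁻¹ • y)], quadBump_le_one _⟩⟩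
  have h1 := discHeat_sub_le_of_discLap_le (spaceStep N h) h ht hq (A := N * (2 / R ^ 2))
    (discLap_le_of_second_diff_le (fun x z => ?_) hh) 0
  · simpa [quadBump_zero] using h1
  · have h2 := quadBump_second_diff_le_sq (R⁻¹ • x) (R⁻¹ • z)
    rw [← smul_add, ← smul_sub, norm_smul, mul_pow, norm_inv, Real.norm_of_nonneg hR.le] at h2
    rw [show 2 / R ^ 2 * ‖z‖ ^ 2 = 2 * (R⁻¹ ^ 2 * ‖z‖ ^ 2) by field_simp]
    exact h2

lemma discHeat_quadBump_le_min (h : ℝ) (hh : h ≠ 0) {t : ℝ} (ht : 0 ≤ t) :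
    discHeat (spaceStep N h) h t quadBump 0 ≤ min 1 (N * 2 * t) := by
  refine le_min ?_ ?_
  · rw [← discHeat_const (spaceStep N h) h t 1 0]
    exact discHeat_mono _ h ht
      ⟨1, fun y => abs_le.mpr ⟨by linarith [quadBump_nonneg y], quadBump_le_one _⟩⟩
      (IsBddFun.const 1) (fun y => quadBump_le_one y) 0
  · have := discHeat_quadBump_le (N := N) h hh ht one_pos
    simpa using this

/-- The weights are even in j, so jumps by z and by -z may be averaged. First-order terms drop out,
which is essential when σ ≥ 1. -/
lemma discHeat_sub_eq_secondDiff (h : ℝ) {t : ℝ} (ht : 0 ≤ t) {φ : Space N → ℝ} (hφ : IsBddFun φ)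
    (y : Space N) :
    discHeat (spaceStep N h) h t (secondDiff φ y) 0 =
      2 * (discHeat (spaceStep N h) h t φ y - φ y) := by
  have hb : IsBddFun (secondDiff φ y) :=
    ((hφ.comp (fun z => y + z)).add (hφ.comp (fun z => y - z))).sub (IsBddFun.const (2 * φ y))
  have h1 := hasSum_discHeat (spaceStep N h) (h := h) ht hφ y
  have h2 : HasSum (fun j : Fin N → ℤ => heatWeight j (t / h ^ 2) *
      φ (y - latVec (spaceStep N h) j)) (discHeat (spaceStep N h) h t φ y) := by
    rw [← (Equiv.neg (Fin N → ℤ)).hasSum_iff]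
    convert! h1 using 2 with j
    simp [heatWeight_neg, latVec, sub_eq_add_neg]
  have h3 := (hasSum_heatWeight N (t := t / h ^ 2) (by positivity)).mul_right (2 * φ y)
  refine (hasSum_discHeat (spaceStep N h) (h := h) ht hb 0).unique ?_
  convert! (h1.add h2).sub h3 using 1
  · funext j
    simp only [secondDiff, zero_add]
    ring
  · ring

lemma isBddFun_of_le_quadBump {g : Space N → ℝ} {C : ℝ} (hC : 0 ≤ C)
    (hg : ∀ z, |g z| ≤ C * quadBump z) : IsBddFun g :=
  ⟨C, fun z => (hg z).trans (mul_le_of_le_one_right hC (quadBump_le_one z))⟩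

lemma isBddFun_quadBump : IsBddFun (quadBump : Space N → ℝ) :=
  ⟨1, fun y => abs_le.mpr ⟨by linarith [quadBump_nonneg y], quadBump_le_one _⟩⟩

/-- The dominating function for the limit h → 0: the second difference lies between multiples of the
bump, and the semigroup of the bump at the origin is at most min(1, 2Nt), independently of h. -/
lemma abs_discHeat_sub_le_of_secondDiff (h : ℝ) (hh : h ≠ 0) {t : ℝ} (ht : 0 ≤ t)
    {φ : Space N → ℝ} (hφ : IsBddFun φ) {C : ℝ} (hC : 0 ≤ C) {y : Space N}
    (h2 : ∀ z, |secondDiff φ y z| ≤ C * quadBump z) :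
    |discHeat (spaceStep N h) h t φ y - φ y| ≤ C * min 1 (N * 2 * t) := by
  have h1 := discHeat_sub_eq_secondDiff h ht hφ y
  have hb := isBddFun_of_le_quadBump hC h2
  have h3 := discHeat_mono (spaceStep N h) h ht hb (isBddFun_quadBump.const_mul C)
    (fun z => (abs_le.mp (h2 z)).2) 0
  have h4 := discHeat_mono (spaceStep N h) h ht (isBddFun_quadBump.const_mul (-C)) hb
    (fun z => by linarith [(abs_le.mp (h2 z)).1]) 0
  rw [discHeat_const_mul _ h ht isBddFun_quadBump] at h3 h4
  have h5 := mul_le_mul_of_nonneg_left (discHeat_quadBump_le_min (N := N) h hh ht) hC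
  have h6 : 0 ≤ C * min 1 (N * 2 * t) := by positivity
  rw [abs_le]
  constructor <;> linarith

/-- Convergence of the discrete heat semigroup along moving points. -/
lemma tendsto_discHeat {T : ℝ} {φ : Space N → ℝ → ℝ} (hφc : Continuous (Function.uncurry φ))
    (hφ : BoundedOnSlab T φ) {h : ℕ → ℝ} (hh : Tendsto h atTop (𝓝 0)) (hpos : ∀ n, 0 < h n)
    {y : ℕ → Space N} {s : ℕ → ℝ} {x : Space N} {t₀ : ℝ} (hy : Tendsto y atTop (𝓝 x))
    (hs : Tendsto s atTop (𝓝 t₀)) (hsT : ∀ n, s n ∈ Icc (0 : ℝ) T) (ht₀ : t₀ ∈ Icc (0 : ℝ) T)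
    {t : ℝ} (ht : 0 < t) :
    Tendsto (fun n => discHeat (spaceStep N (h n)) (h n) t (fun z => φ z (s n)) (y n)) atTop
      (𝓝 (∫ z, gaussDens t z * φ (x + z) t₀)) := by
  have hb0 : IsBddFun (fun z => φ (x + z) t₀) := (hφ.isBddFun ht₀).comp (fun z => x + z)
  have hbn : ∀ n, IsBddFun (fun z => φ (y n + z) (s n)) := fun n =>
    (hφ.isBddFun (hsT n)).comp (fun z => y n + z)
  have h1 := tendsto_integral_walkMeasure hh hpos ht hb0 (by fun_prop)
  have hshift : ∀ n, discHeat (spaceStep N (h n)) (h n) t (fun z => φ z (s n)) (y n) =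
      discHeat (spaceStep N (h n)) (h n) t (fun z => φ (y n + z) (s n)) 0 := by
    intro n
    refine (hasSum_discHeat (spaceStep N (h n)) (h := h n) ht.le (hφ.isBddFun (hsT n)) (y n)).unique ?_
    simpa using hasSum_discHeat (spaceStep N (h n)) (h := h n) ht.le (hbn n) 0
  simp_rw [hshift]
  obtain ⟨C, hC⟩ := hφ
  have hC0 : 0 ≤ C := (abs_nonneg _).trans (hC x t₀ ht₀)
  rw [Metric.tendsto_atTop] at h1 ⊢
  intro ε hε
  -- Outside the ball of radius R the two translates differ by at most 2C ≤ 4C times the bump, whose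
  -- mean is O(t/R²). Inside it, joint continuity makes them uniformly close.
  obtain ⟨R, hR, hRε⟩ : ∃ R : ℝ, 0 < R ∧ 4 * C * (N * (2 / R ^ 2) * t) < ε / 4 := by
    have : Tendsto (fun R : ℝ => 4 * C * (N * (2 / R ^ 2) * t)) atTop (𝓝 0) := by
      have h2 : Tendsto (fun R : ℝ => 2 / R ^ 2) atTop (𝓝 0) :=
        tendsto_const_nhds.div_atTop (tendsto_pow_atTop two_ne_zero)
      simpa using ((h2.const_mul (N : ℝ)).mul_const t).const_mul (4 * C)
    exact ((eventually_gt_atTop 0).and (this.eventually_lt_const (by positivity))).exists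
  have hunif : ∀ᶠ n in atTop, ∀ z ∈ Metric.closedBall (0 : Space N) R,
      |φ (y n + z) (s n) - φ (x + z) t₀| < ε / 4 := by
    have h2 : ∀ᶠ p : Space N × ℝ in 𝓝 (x, t₀), ∀ z ∈ Metric.closedBall (0 : Space N) R,
        |φ (p.1 + z) p.2 - φ (x + z) t₀| < ε / 4 := by
      refine (isCompact_closedBall _ _).eventually_forall_of_forall_eventually fun z _ => ?_
      have h3 : Continuous (fun q : (Space N × ℝ) × Space N =>
          |φ (q.1.1 + q.2) q.1.2 - φ (x + q.2) t₀|) := by fun_prop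
      refine (h3.tendsto ((x, t₀), z)).eventually_lt_const ?_
      simpa using by positivity
    exact (hy.prodMk_nhds hs).eventually h2
  obtain ⟨n₁, hn₁⟩ := h1 (ε / 4) (by positivity)
  obtain ⟨n₂, hn₂⟩ := eventually_atTop.mp hunif
  refine ⟨max n₁ n₂, fun n hn => ?_⟩
  have e1 := hn₁ n (le_of_max_le_left hn)
  have e2 := hn₂ n (le_of_max_le_right hn)
  have hq : IsBddFun (fun z : Space N => quadBump (R⁻¹ • z)) :=
    ⟨1, fun y => abs_le.mpr ⟨by linarith [quadBump_nonneg (R⁻¹ • y)], quadBump_le_one _⟩⟩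
  have hpt : ∀ z, |φ (y n + z) (s n) - φ (x + z) t₀| ≤ ε / 4 + 4 * C * quadBump (R⁻¹ • z) := by
    intro z
    rcases le_or_gt ‖z‖ R with hz | hz
    · have := quadBump_nonneg (R⁻¹ • z)
      have h3 := e2 z (by simpa using hz)
      have : 0 ≤ 4 * C * quadBump (R⁻¹ • z) := by positivity
      linarith
    · have h3 : (1 : ℝ) ≤ ‖R⁻¹ • z‖ := by
        rw [norm_smul, norm_inv, Real.norm_of_nonneg hR.le, inv_mul_eq_div, one_le_div hR]
        exact hz.le
      have h4 := quadBump_lower zero_le_one h3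
      norm_num at h4
      have h5 := abs_sub (φ (y n + z) (s n)) (φ (x + z) t₀)
      have h6 := hC (y n + z) (s n) (hsT n)
      have h7 := hC (x + z) t₀ ht₀
      nlinarith
  have hbd : IsBddFun (fun z : Space N => ε / 4 + 4 * C * quadBump (R⁻¹ • z)) :=
    (IsBddFun.const _).add (hq.const_mul _)
  have e3 : discHeat (spaceStep N (h n)) (h n) t
      (fun z => ε / 4 + 4 * C * quadBump (R⁻¹ • z)) 0 < ε / 2 := by
    rw [discHeat_add _ _ ht.le (IsBddFun.const _) (hq.const_mul _), discHeat_const,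
      discHeat_const_mul _ _ ht.le hq]
    have h3 := discHeat_quadBump_le (N := N) (h n) (hpos n).ne' ht.le hR
    have h4 := mul_le_mul_of_nonneg_left h3 (by positivity : 0 ≤ 4 * C)
    linarith
  have e4 := discHeat_mono (spaceStep N (h n)) (h n) ht.le (hbn n) (hb0.add hbd)
    (fun z => by linarith [(abs_le.mp (hpt z)).2]) 0
  have e5 := discHeat_mono (spaceStep N (h n)) (h n) ht.le hb0 ((hbn n).add hbd)
    (fun z => by linarith [(abs_le.mp (hpt z)).1]) 0
  rw [discHeat_add _ _ ht.le hb0 hbd] at e4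
  rw [discHeat_add _ _ ht.le (hbn n) hbd] at e5
  rw [Real.dist_eq, abs_lt] at e1 ⊢
  constructor <;> linarith

/-! ### The fractional Laplacian in terms of second differences -/

/-- Obtained by letting h → 0 in the discrete bound, so no Gaussian moment has to be computed. -/
lemma integral_gaussDens_quadBump_le {t : ℝ} (ht : 0 < t) :
    ∫ z : Space N, gaussDens t z * quadBump z ≤ min 1 (N * 2 * t) := by
  have h1 := tendsto_integral_walkMeasure (N := N) tendsto_one_div_add_atTop_nhds_zero_nat
    (fun n => by positivity) ht isBddFun_quadBump contDiff_quadBump.continuous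
  exact le_of_tendsto h1 (Eventually.of_forall fun n =>
    discHeat_quadBump_le_min _ (by positivity) ht.le)

lemma integrable_gaussDens_mul {t : ℝ} (ht : 0 < t) {g : Space N → ℝ} (hg : IsBddFun g)
    (hgm : AEStronglyMeasurable g volume) : Integrable (fun z => gaussDens t z * g z) := by
  obtain ⟨C, hC⟩ := hg
  exact (integrable_gaussDens ht).mul_bdd (c := C) hgm (Eventually.of_forall hC)

/-- Integrating first in z leaves a multiple of min(1, 2Nt) / t^{1+σ/2}. This justifies exchanging
the time and space integrals in the subordination formula. -/
lemma integrable_subordination (hσ : σ ∈ Ioo (0 : ℝ) 2) {g : Space N → ℝ} (hgm : Measurable g)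
    {C : ℝ} (hC : 0 ≤ C) (hg : ∀ z, |g z| ≤ C * quadBump z) :
    Integrable (fun p : ℝ × Space N => gaussDens p.1 p.2 * g p.2 / p.1 ^ (1 + σ / 2))
      ((volume.restrict (Ioi (0 : ℝ))).prod volume) := by
  have hm : Measurable (fun p : ℝ × Space N => gaussDens p.1 p.2 * g p.2 / p.1 ^ (1 + σ / 2)) :=
    (measurable_gaussDens.mul (hgm.comp measurable_snd)).div (by fun_prop)
  have hgb := isBddFun_of_le_quadBump hC hg
  rw [integrable_prod_iff hm.aestronglyMeasurable]
  constructor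
  · filter_upwards [ae_restrict_mem measurableSet_Ioi] with t ht
    exact (integrable_gaussDens_mul ht hgb hgm.aestronglyMeasurable).div_const _
  · refine Integrable.mono' ((integrableOn_min_div_rpow hσ (c := N * 2) (by positivity)).const_mul C)
      hm.norm.stronglyMeasurable.integral_prod_right.aestronglyMeasurable ?_
    filter_upwards [ae_restrict_mem measurableSet_Ioi] with t ht
    have ht0 : 0 < t := ht
    rw [Real.norm_of_nonneg (integral_nonneg fun z => norm_nonneg _)]
    have h1 : ∀ z : Space N, ‖gaussDens t z * g z / t ^ (1 + σ / 2)‖ ≤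
        C * (gaussDens t z * quadBump z) / t ^ (1 + σ / 2) := by
      intro z
      have := gaussDens_nonneg ht0 z
      rw [norm_div, norm_mul, Real.norm_of_nonneg this,
        Real.norm_of_nonneg (by positivity : 0 ≤ t ^ (1 + σ / 2)), Real.norm_eq_abs]
      refine div_le_div_of_nonneg_right ?_ (by positivity)
      calc gaussDens t z * |g z| ≤ gaussDens t z * (C * quadBump z) := by
            gcongr; exact hg z
        _ = C * (gaussDens t z * quadBump z) := by ring
    calc ∫ z : Space N, ‖gaussDens t z * g z / t ^ (1 + σ / 2)‖
        ≤ ∫ z : Space N, C * (gaussDens t z * quadBump z) / t ^ (1 + σ / 2) := by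
          refine integral_mono ?_ ?_ h1
          · exact ((integrable_gaussDens_mul ht0 hgb hgm.aestronglyMeasurable).div_const _).norm
          · exact ((integrable_gaussDens_mul ht0 isBddFun_quadBump
              contDiff_quadBump.continuous.aestronglyMeasurable).const_mul C).div_const _
      _ = C * ((∫ z : Space N, gaussDens t z * quadBump z) / t ^ (1 + σ / 2)) := by
          rw [integral_div, integral_const_mul]; ring
      _ ≤ C * (min 1 (N * 2 * t) / t ^ (1 + σ / 2)) := by
          gcongr
          exact integral_gaussDens_quadBump_le ht0

lemma subordination_inner (hN : 0 < N) (hσ : σ ∈ Ioo (0 : ℝ) 2) (g : Space N → ℝ) :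
    ∀ᵐ z : Space N, gammaConst σ *
      ∫ t in Ioi (0 : ℝ), gaussDens t z * g z / t ^ (1 + σ / 2) = g z * fracKernel σ z := by
  have : NeZero N := ⟨hN.ne'⟩
  filter_upwards [compl_mem_ae_iff.mpr (measure_singleton (0 : Space N))] with z hz
  rw [← integral_gaussDens_div_rpow hσ hz, mul_left_comm, ← integral_const_mul (g z)]
  congr 2
  funext t
  ring

lemma integrable_mul_fracKernel (hN : 0 < N) (hσ : σ ∈ Ioo (0 : ℝ) 2) {g : Space N → ℝ}
    (hgm : Measurable g) {C : ℝ} (hC : 0 ≤ C) (hg : ∀ z, |g z| ≤ C * quadBump z) :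
    Integrable (fun z => g z * fracKernel σ z) :=
  ((integrable_subordination hσ hgm hC hg).integral_prod_right.const_mul (gammaConst σ)).congr
    (subordination_inner hN hσ g)

lemma integral_mul_fracKernel (hN : 0 < N) (hσ : σ ∈ Ioo (0 : ℝ) 2) {g : Space N → ℝ}
    (hgm : Measurable g) {C : ℝ} (hC : 0 ≤ C) (hg : ∀ z, |g z| ≤ C * quadBump z) :
    gammaConst σ * ∫ t in Ioi (0 : ℝ), (∫ z, gaussDens t z * g z) / t ^ (1 + σ / 2) =
      ∫ z, g z * fracKernel σ z := by
  simp_rw [← integral_div]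
  rw [integral_integral_swap (integrable_subordination hσ hgm hC hg), ← integral_const_mul]
  exact integral_congr_ae (subordination_inner hN hσ g)

/-- The fractional Laplacian in nonsingular form. -/
def levyOp (σ : ℝ) (φ : Space N → ℝ) (x : Space N) : ℝ :=
  1 / 2 * ∫ z, secondDiff φ x z * fracKernel σ z

lemma measurable_secondDiff {φ : Space N → ℝ} (hφ : Measurable φ) (x : Space N) :
    Measurable (secondDiff φ x) := by
  unfold secondDiff
  fun_prop

lemma integral_gaussDens_secondDiff {t : ℝ} (ht : 0 < t) {φ : Space N → ℝ} (hφ : IsBddFun φ)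
    (hφm : Measurable φ) (x : Space N) :
    ∫ z, gaussDens t z * secondDiff φ x z = 2 * ((∫ z, gaussDens t z * φ (x + z)) - φ x) := by
  have i1 := integrable_gaussDens_mul ht (hφ.comp (fun z => x + z))
    (hφm.comp (measurable_const_add x)).aestronglyMeasurable
  have i2 := integrable_gaussDens_mul ht (hφ.comp (fun z => x - z))
    (hφm.comp (measurable_const_sub x)).aestronglyMeasurable
  have i3 := (integrable_gaussDens (N := N) ht).mul_const (2 * φ x)
  have h1 : ∫ z, gaussDens t z * φ (x - z) = ∫ z, gaussDens t z * φ (x + z) := by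
    rw [← integral_neg_eq_self]
    simp [gaussDens_neg]
  have h2 : ∀ z, gaussDens t z * secondDiff φ x z =
      gaussDens t z * φ (x + z) + gaussDens t z * φ (x - z) - gaussDens t z * (2 * φ x) := by
    intro z
    simp only [secondDiff]
    ring
  have h3 := integral_sub (i1.add i2) i3
  have h4 := integral_add i1 i2
  simp only [Pi.add_apply] at h3 h4
  simp_rw [h2]
  rw [h3, h4, h1, integral_mul_const, integral_gaussDens ht]
  ring

/-- On the truncated region {|z| > r} the kernel is integrable and even, so the first difference may
be replaced by half the second difference. That integrand is integrable up to the origin, and the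
principal value becomes a dominated limit. -/
lemma fracLap_eq_levyOp (hN : 0 < N) (hσ : σ ∈ Ioo (0 : ℝ) 2) {φ : Space N → ℝ} (hφ : IsBddFun φ)
    (hφm : Measurable φ) {x : Space N} {C : ℝ} (hC : 0 ≤ C)
    (h2 : ∀ z, |secondDiff φ x z| ≤ C * quadBump z) : fracLap σ φ x = levyOp σ φ x := by
  have hint := integrable_mul_fracKernel hN hσ (measurable_secondDiff hφm x) hC h2
  have hev : ∀ r : ℝ, 0 < r → ∫ z in {z : Space N | r < ‖z‖}, (φ (x + z) - φ x) * fracKernel σ z =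
      1 / 2 * ∫ z in {z : Space N | r < ‖z‖}, secondDiff φ x z * fracKernel σ z := by
    intro r hr
    have hms : MeasurableSet {z : Space N | r < ‖z‖} := measurableSet_lt (by fun_prop) (by fun_prop)
    have hk : IntegrableOn (fun z : Space N => fracKernel σ z) {z | r < ‖z‖} := by
      have h3 := (integrable_mul_fracKernel (N := N) hN hσ (g := quadBump)
        contDiff_quadBump.continuous.measurable zero_le_one (fun z => by
          rw [abs_of_nonneg (quadBump_nonneg z), one_mul])).const_mul ((1 + r ^ 2) / r ^ 2)
      refine Integrable.mono' h3.integrableOn ?_ ?_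
      · unfold fracKernel
        exact (by fun_prop : Measurable _).aestronglyMeasurable
      · filter_upwards [ae_restrict_mem hms] with z hz
        have h4 := quadBump_lower hr.le (le_of_lt (show r < ‖z‖ from hz))
        have h5 := fracKernel_nonneg hσ.1 z
        rw [Real.norm_of_nonneg h5, ← mul_assoc]
        refine le_mul_of_one_le_left h5 ?_
        calc (1 : ℝ) = (1 + r ^ 2) / r ^ 2 * (r ^ 2 / (1 + r ^ 2)) := by field_simp
          _ ≤ (1 + r ^ 2) / r ^ 2 * quadBump z := by gcongr
    obtain ⟨B, hB⟩ := hφ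
    have i1 : IntegrableOn (fun z => (φ (x + z) - φ x) * fracKernel σ z) {z | r < ‖z‖} :=
      hk.bdd_mul (c := B + B) (by fun_prop : Measurable _).aestronglyMeasurable
        (Eventually.of_forall fun z => (abs_sub _ _).trans (add_le_add (hB _) (hB _)))
    have i2 : IntegrableOn (fun z => (φ (x - z) - φ x) * fracKernel σ z) {z | r < ‖z‖} :=
      hk.bdd_mul (c := B + B) (by fun_prop : Measurable _).aestronglyMeasurable
        (Eventually.of_forall fun z => (abs_sub _ _).trans (add_le_add (hB _) (hB _)))
    have e1 : ∫ z in {z : Space N | r < ‖z‖}, (φ (x - z) - φ x) * fracKernel σ z =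
        ∫ z in {z : Space N | r < ‖z‖}, (φ (x + z) - φ x) * fracKernel σ z := by
      rw [← integral_indicator hms, ← integral_indicator hms, ← integral_neg_eq_self]
      congr 1
      funext z
      simp only [indicator, mem_ofPred_eq, norm_neg, fracKernel_neg, sub_neg_eq_add]
    have e2 : ∫ z in {z : Space N | r < ‖z‖}, secondDiff φ x z * fracKernel σ z =
        (∫ z in {z : Space N | r < ‖z‖}, (φ (x + z) - φ x) * fracKernel σ z) +
          ∫ z in {z : Space N | r < ‖z‖}, (φ (x - z) - φ x) * fracKernel σ z := by
      rw [← integral_add i1 i2]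
      congr 1
      funext z
      simp only [secondDiff]
      ring
    rw [e2, e1]
    ring
  refine Tendsto.limUnder_eq ?_
  have hlim : Tendsto (fun r : ℝ => ∫ z in {z : Space N | r < ‖z‖},
      secondDiff φ x z * fracKernel σ z) (𝓝[>] 0)
      (𝓝 (∫ z, secondDiff φ x z * fracKernel σ z)) := by
    have hms : ∀ r : ℝ, MeasurableSet {z : Space N | r < ‖z‖} := fun r =>
      measurableSet_lt (by fun_prop) (by fun_prop)
    simp_rw [← fun r => integral_indicator (μ := volume)
      (f := fun z => secondDiff φ x z * fracKernel σ z) (hms r)]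
    refine tendsto_integral_filter_of_dominated_convergence
      (fun z => ‖secondDiff φ x z * fracKernel σ z‖)
      (Eventually.of_forall fun r => hint.aestronglyMeasurable.indicator (hms r))
      (Eventually.of_forall fun r => Eventually.of_forall fun z => norm_indicator_le_norm_self _ _)
      hint.norm ?_
    have : NeZero N := ⟨hN.ne'⟩
    filter_upwards [compl_mem_ae_iff.mpr (measure_singleton (0 : Space N))] with z hz
    have hz' : 0 < ‖z‖ := norm_pos_iff.mpr hz
    refine tendsto_const_nhds.congr' ?_
    filter_upwards [nhdsWithin_le_nhds (eventually_lt_nhds hz')] with r hr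
    exact (indicator_of_mem (show z ∈ {z : Space N | r < ‖z‖} from hr)
      (fun z => secondDiff φ x z * fracKernel σ z)).symm
  refine (hlim.const_mul (1 / 2)).congr' ?_
  filter_upwards [self_mem_nhdsWithin] with r hr
  exact (hev r hr).symm

/-- Consistency of the discrete fractional Laplacian along moving points. -/
lemma tendsto_discFracLap (hN : 0 < N) (hσ : σ ∈ Ioo (0 : ℝ) 2) {T : ℝ} {φ : Space N → ℝ → ℝ}
    (hφc : Continuous (Function.uncurry φ))
    (hφ : BoundedOnSlab T φ) {h : ℕ → ℝ} (hh : Tendsto h atTop (𝓝 0)) (hpos : ∀ n, 0 < h n)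
    {y : ℕ → Space N} {s : ℕ → ℝ} {x : Space N} {t₀ : ℝ} (hy : Tendsto y atTop (𝓝 x))
    (hs : Tendsto s atTop (𝓝 t₀)) (hsT : ∀ n, s n ∈ Icc (0 : ℝ) T) (ht₀ : t₀ ∈ Icc (0 : ℝ) T)
    {C : ℝ} (hC : 0 ≤ C)
    (h2 : ∀ᶠ n in atTop, ∀ z, |secondDiff (fun x => φ x (s n)) (y n) z| ≤ C * quadBump z) :
    Tendsto (fun n => discFracLap (spaceStep N (h n)) (h n) σ (fun z => φ z (s n)) (y n)) atTop
      (𝓝 (levyOp σ (fun x => φ x t₀) x)) := by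
  have hφm : Measurable (fun x => φ x t₀) := (by fun_prop : Continuous fun x => φ x t₀).measurable
  have hlim2 : ∀ z, |secondDiff (fun x => φ x t₀) x z| ≤ C * quadBump z := by
    intro z
    have hw : ∀ w, Tendsto (fun n => φ (y n + w) (s n)) atTop (𝓝 (φ (x + w) t₀)) := fun w =>
      (hφc.tendsto (x + w, t₀)).comp ((hy.add_const w).prodMk_nhds hs)
    have h3 := (((hw z).add (hw (-z))).sub ((hw 0).const_mul 2)).abs
    simp only [← sub_eq_add_neg, add_zero] at h3
    exact le_of_tendsto h3 (h2.mono fun n hn => hn z)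
  -- Subordination writes the limit in the same form as the discrete operator, with heat semigroup
  -- in place of random walk; it remains to pass to the limit under the time integral.
  have e1 : levyOp σ (fun x => φ x t₀) x = gammaConst σ * ∫ t in Ioi (0 : ℝ),
      ((∫ z, gaussDens t z * φ (x + z) t₀) - φ x t₀) / t ^ (1 + σ / 2) := by
    rw [levyOp, ← integral_mul_fracKernel hN hσ (measurable_secondDiff hφm x) hC hlim2, mul_left_comm,
      ← integral_const_mul]
    congr 1
    refine setIntegral_congr_fun measurableSet_Ioi fun t ht => ?_
    rw [integral_gaussDens_secondDiff ht (hφ.isBddFun ht₀) hφm x]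
    ring
  rw [e1]
  refine Tendsto.const_mul _ ?_
  refine tendsto_integral_filter_of_dominated_convergence
    (fun t => C * (min 1 (N * 2 * t) / t ^ (1 + σ / 2))) (Eventually.of_forall fun n => ?_) ?_
    ((integrableOn_min_div_rpow hσ (c := N * 2) (by positivity)).const_mul C) ?_
  · exact (integrableOn_discHeat_sub _ _ hσ (hφ.isBddFun (hsT n)) _).aestronglyMeasurable
  · filter_upwards [h2] with n hn
    filter_upwards [ae_restrict_mem measurableSet_Ioi] with t ht
    have ht0 : 0 < t := ht
    rw [norm_div, Real.norm_eq_abs, Real.norm_of_nonneg (by positivity : 0 ≤ t ^ (1 + σ / 2)),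
      ← mul_div_assoc]
    gcongr
    exact abs_discHeat_sub_le_of_secondDiff (h n) (hpos n).ne' ht0.le (hφ.isBddFun (hsT n)) hC hn
  · filter_upwards [ae_restrict_mem measurableSet_Ioi] with t ht
    have h5 : Tendsto (fun n => φ (y n) (s n)) atTop (𝓝 (φ x t₀)) :=
      (hφc.tendsto (x, t₀)).comp (hy.prodMk_nhds hs)
    exact ((tendsto_discHeat hφc hφ hh hpos hy hs hsT ht₀ ht).sub h5).div_const _

end
end ThetaScheme

/-! ### Second differences of test functions -/

namespace ThetaScheme
noncomputable section
variable {N : ℕ} {σ T : ℝ}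

/-- The derivative is C¹, hence Lipschitz near p. The mean value inequality for c ↦ Φ(q + cz) + Φ(q
- cz) on [0, 1], whose derivative is a difference of values of the differential, gives the quadratic
bound uniformly in q. -/
lemma exists_secondDiff_le_sq {V : Type*} [NormedAddCommGroup V] [NormedSpace ℝ V] {Φ : V → ℝ}
    (hΦ : ContDiff ℝ 2 Φ) (p : V) :
    ∃ K, 0 ≤ K ∧ ∃ ρ, 0 < ρ ∧ ρ ≤ 1 ∧ ∀ q ∈ Metric.ball p ρ, ∀ z, ‖z‖ < ρ →
      |secondDiff Φ q z| ≤ K * ‖z‖ ^ 2 := by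
  have h1 : ContDiff ℝ 1 (fderiv ℝ Φ) := hΦ.fderiv_right (by norm_num)
  obtain ⟨K, s, hs, hK⟩ := (h1.contDiffAt (x := p)).exists_lipschitzOnWith
  obtain ⟨ρ, hρ, hball⟩ := Metric.mem_nhds_iff.mp hs
  refine ⟨2 * K, by positivity, min 1 (ρ / 2), by positivity, min_le_left _ _, fun q hq z hz => ?_⟩
  have hmin : min 1 (ρ / 2) ≤ ρ / 2 := min_le_right _ _
  have hdiff : Differentiable ℝ Φ := hΦ.differentiable (by norm_num)
  have hmem : ∀ c : ℝ, |c| ≤ 1 → q + c • z ∈ s := by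
    intro c hc
    refine hball ?_
    rw [Metric.mem_ball] at hq ⊢
    calc dist (q + c • z) p ≤ dist (q + c • z) q + dist q p := dist_triangle _ _ _
      _ = |c| * ‖z‖ + dist q p := by simp [dist_eq_norm, norm_smul]
      _ < ρ := by nlinarith [norm_nonneg z]
  set g : ℝ → ℝ := fun c => Φ (q + c • z) + Φ (q - c • z) with hg
  have hd : ∀ c : ℝ, HasDerivAt g (fderiv ℝ Φ (q + c • z) z - fderiv ℝ Φ (q - c • z) z) c := by
    intro c
    have e1 : HasDerivAt (fun c : ℝ => q + c • z) z c := by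
      simpa using ((hasDerivAt_id c).smul_const z).const_add q
    have e2 : HasDerivAt (fun c : ℝ => q - c • z) (-z) c := by
      simpa using ((hasDerivAt_id c).smul_const z).const_sub q
    have e3 := (hdiff (q + c • z)).hasFDerivAt.comp_hasDerivAt c e1
    have e4 := (hdiff (q - c • z)).hasFDerivAt.comp_hasDerivAt c e2
    have e5 := e3.add e4
    rw [map_neg, ← sub_eq_add_neg] at e5
    exact e5
  have hb := norm_image_sub_le_of_norm_deriv_le_segment_01' (f := g) (C := 2 * K * ‖z‖ ^ 2)
    (fun c _ => (hd c).hasDerivWithinAt) (fun c hc => by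
      have hc1 : |c| ≤ 1 := by rw [abs_of_nonneg hc.1]; exact hc.2.le
      have e1 := hmem c hc1
      have e2 : q - c • z ∈ s := by
        have := hmem (-c) (by rwa [abs_neg])
        rwa [neg_smul, ← sub_eq_add_neg] at this
      have e3 := hK.dist_le_mul _ e1 _ e2
      rw [dist_eq_norm, dist_eq_norm, show q + c • z - (q - c • z) = (2 * c) • z by
        rw [mul_smul, two_smul]; abel, norm_smul, norm_mul, Real.norm_eq_abs, Real.norm_eq_abs,
        abs_two] at e3
      calc ‖fderiv ℝ Φ (q + c • z) z - fderiv ℝ Φ (q - c • z) z‖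
          = ‖(fderiv ℝ Φ (q + c • z) - fderiv ℝ Φ (q - c • z)) z‖ := by simp
        _ ≤ ‖fderiv ℝ Φ (q + c • z) - fderiv ℝ Φ (q - c • z)‖ * ‖z‖ :=
            ContinuousLinearMap.le_opNorm _ _
        _ ≤ (K * (2 * |c| * ‖z‖)) * ‖z‖ := by gcongr
        _ ≤ (K * (2 * 1 * ‖z‖)) * ‖z‖ := by gcongr
        _ = 2 * K * ‖z‖ ^ 2 := by ring)
  have e6 : g 1 - g 0 = secondDiff Φ q z := by
    simp only [hg, secondDiff, one_smul, zero_smul, add_zero, sub_zero]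
    ring
  rwa [e6, Real.norm_eq_abs] at hb

/-- The constant bounding second differences in terms of a local and a global bound. -/
def bumpConst (K ρ B : ℝ) : ℝ := 2 * K + 4 * B * ((1 + ρ ^ 2) / ρ ^ 2)

lemma bumpConst_nonneg {K ρ B : ℝ} (hK : 0 ≤ K) (hB : 0 ≤ B) : 0 ≤ bumpConst K ρ B := by
  unfold bumpConst; positivity

lemma secondDiff_le_quadBump {V : Type*} [NormedAddCommGroup V] {φ : V → ℝ}
    {x : V} {K ρ B : ℝ} (hK : 0 ≤ K) (hρ : 0 < ρ) (hρ1 : ρ ≤ 1) (hB : ∀ y, |φ y| ≤ B)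
    (hloc : ∀ z, ‖z‖ < ρ → |secondDiff φ x z| ≤ K * ‖z‖ ^ 2) (z : V) :
    |secondDiff φ x z| ≤ bumpConst K ρ B * quadBump z := by
  have hB0 : 0 ≤ B := (abs_nonneg _).trans (hB x)
  have hq := quadBump_nonneg z
  rcases lt_or_ge ‖z‖ ρ with hz | hz
  · have h1 : ‖z‖ ^ 2 ≤ 2 * quadBump z := by
      have h2 : ‖z‖ ^ 2 ≤ 1 := pow_le_one₀ (norm_nonneg _) (hz.le.trans hρ1)
      rw [quadBump, ← mul_div_assoc, le_div_iff₀ (by positivity)]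
      nlinarith [sq_nonneg ‖z‖]
    calc |secondDiff φ x z| ≤ K * ‖z‖ ^ 2 := hloc z hz
      _ ≤ K * (2 * quadBump z) := by gcongr
      _ ≤ bumpConst K ρ B * quadBump z := by
        have : 0 ≤ 4 * B * ((1 + ρ ^ 2) / ρ ^ 2) * quadBump z := by positivity
        rw [bumpConst]
        linarith
  · have h1 := quadBump_lower hρ.le hz
    have h2 : 1 ≤ (1 + ρ ^ 2) / ρ ^ 2 * quadBump z := by
      calc (1 : ℝ) = (1 + ρ ^ 2) / ρ ^ 2 * (ρ ^ 2 / (1 + ρ ^ 2)) := by field_simp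
        _ ≤ _ := by gcongr
    have h3 : |secondDiff φ x z| ≤ 4 * B := by
      have e1 := abs_le.mp (hB (x + z))
      have e2 := abs_le.mp (hB (x - z))
      have e3 := abs_le.mp (hB x)
      rw [secondDiff, abs_le]
      constructor <;> linarith
    calc |secondDiff φ x z| ≤ 4 * B * 1 := by linarith
      _ ≤ 4 * B * ((1 + ρ ^ 2) / ρ ^ 2 * quadBump z) := by gcongr
      _ ≤ bumpConst K ρ B * quadBump z := by
        have : 0 ≤ 2 * K * quadBump z := by positivity
        rw [bumpConst]
        linarith

/-- Second differences in space of a test function, locally uniformly in the base point. -/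
lemma IsTestFunction.exists_secondDiff_le {φ : Space N → ℝ → ℝ} (hφ : IsTestFunction T φ)
    (x : Space N) (t : ℝ) :
    ∃ C, 0 ≤ C ∧ ∃ ρ, 0 < ρ ∧ ∀ y s, dist y x < ρ → |s - t| < ρ → s ∈ Icc (0 : ℝ) T →
      ∀ z, |secondDiff (fun x => φ x s) y z| ≤ C * quadBump z := by
  obtain ⟨hc, B, hB⟩ := hφ
  obtain ⟨K, hK, ρ, hρ, hρ1, hloc⟩ := exists_secondDiff_le_sq hc (x, t)
  rcases lt_or_ge T 0 with hT | hT
  · exact ⟨0, le_rfl, 1, one_pos, fun y s _ _ hs => absurd (hs.1.trans hs.2) (not_le.mpr hT)⟩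
  have hB0 : 0 ≤ B := (abs_nonneg _).trans (hB 0 0 ⟨le_rfl, hT⟩)
  refine ⟨bumpConst K ρ B, bumpConst_nonneg hK hB0, ρ, hρ, fun y s hy hs hsT z => ?_⟩
  refine secondDiff_le_quadBump hK hρ hρ1 (fun w => hB w s hsT) (fun w hw => ?_) z
  have h1 := hloc (y, s) (by
    rw [Metric.mem_ball, Prod.dist_eq]
    exact max_lt hy (by rwa [Real.dist_eq])) (w, 0) (by simpa [Prod.norm_def, hρ] using hw)
  simpa [secondDiff, Function.uncurry, Prod.norm_def] using h1

lemma IsTestFunction.continuous {φ : Space N → ℝ → ℝ} (hφ : IsTestFunction T φ) :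
    Continuous (Function.uncurry φ) := hφ.1.continuous

lemma IsTestFunction.fracLap_eq (hN : 0 < N) (hσ : σ ∈ Ioo (0 : ℝ) 2) {φ : Space N → ℝ → ℝ}
    (hφ : IsTestFunction T φ) (x : Space N) {t : ℝ} (ht : t ∈ Icc (0 : ℝ) T) :
    fracLap σ (fun y => φ y t) x = levyOp σ (fun y => φ y t) x := by
  obtain ⟨C, hC, ρ, hρ, hb⟩ := hφ.exists_secondDiff_le x t
  have hc := hφ.continuous
  exact fracLap_eq_levyOp hN hσ (hφ.2.isBddFun ht)
    (by fun_prop : Continuous fun y => φ y t).measurable hC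
    (hb x t (by simpa using hρ) (by simpa using hρ) ht)

lemma IsTestFunction.tendsto_discFracLap (hN : 0 < N) (hσ : σ ∈ Ioo (0 : ℝ) 2)
    {φ : Space N → ℝ → ℝ} (hφ : IsTestFunction T φ) {h : ℕ → ℝ} (hh : Tendsto h atTop (𝓝 0))
    (hpos : ∀ n, 0 < h n)
    {y : ℕ → Space N} {s : ℕ → ℝ} {x : Space N} {t₀ : ℝ} (hy : Tendsto y atTop (𝓝 x))
    (hs : Tendsto s atTop (𝓝 t₀)) (hsT : ∀ n, s n ∈ Icc (0 : ℝ) T) (ht₀ : t₀ ∈ Icc (0 : ℝ) T) :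
    Tendsto (fun n => discFracLap (spaceStep N (h n)) (h n) σ (fun z => φ z (s n)) (y n)) atTop
      (𝓝 (levyOp σ (fun x => φ x t₀) x)) := by
  obtain ⟨C, hC, ρ, hρ, hb⟩ := hφ.exists_secondDiff_le x t₀
  refine ThetaScheme.tendsto_discFracLap hN hσ hφ.continuous hφ.2 hh hpos hy hs hsT ht₀ hC ?_
  filter_upwards [hy.eventually (Metric.ball_mem_nhds x hρ),
    hs.eventually (Metric.ball_mem_nhds t₀ hρ)] with n h1 h2
  exact hb _ _ h1 (by rwa [← Real.dist_eq]) (hsT n)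

lemma levyOp_add (hN : 0 < N) (hσ : σ ∈ Ioo (0 : ℝ) 2) {φ ψ : Space N → ℝ} (hφ : Measurable φ)
    (hψ : Measurable ψ) {x : Space N} {C D : ℝ} (hC : 0 ≤ C) (hD : 0 ≤ D)
    (h1 : ∀ z, |secondDiff φ x z| ≤ C * quadBump z)
    (h2 : ∀ z, |secondDiff ψ x z| ≤ D * quadBump z) :
    levyOp σ (fun y => φ y + ψ y) x = levyOp σ φ x + levyOp σ ψ x := by
  rw [levyOp, levyOp, levyOp, ← mul_add,
    ← integral_add (integrable_mul_fracKernel hN hσ (measurable_secondDiff hφ x) hC h1)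
      (integrable_mul_fracKernel hN hσ (measurable_secondDiff hψ x) hD h2)]
  congr 2
  funext z
  simp only [secondDiff]
  ring

/-! ### Scaled bumps -/

lemma secondDiff_scaled_quadBump_le (R : ℝ) (a x z : Space N) :
    secondDiff (fun y => quadBump (R⁻¹ • (y - a))) x z ≤ 4 * quadBump (R⁻¹ • z) := by
  have h := quadBump_second_diff_le (R⁻¹ • (x - a)) (R⁻¹ • z)
  simp only [secondDiff]
  rwa [← smul_add, ← smul_sub, show x - a + z = x + z - a by abel,
    show x - a - z = x - z - a by abel] at h

lemma integrable_scaled_quadBump (hN : 0 < N) (hσ : σ ∈ Ioo (0 : ℝ) 2) {R : ℝ} (hR : 1 ≤ R) :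
    Integrable (fun z : Space N => quadBump (R⁻¹ • z) * fracKernel σ z) := by
  refine integrable_mul_fracKernel hN hσ
    ((contDiff_quadBump.continuous.comp (continuous_const_smul _)).measurable) zero_le_one
    fun z => ?_
  rw [abs_of_nonneg (quadBump_nonneg _), one_mul, quadBump_eq, quadBump_eq]
  have h1 : ‖R⁻¹ • z‖ ≤ ‖z‖ := by
    rw [norm_smul, norm_inv, Real.norm_of_nonneg (by linarith)]
    exact mul_le_of_le_one_left (norm_nonneg _) (inv_le_one_of_one_le₀ hR)
  gcongr

/-- The nonlocal effect of a bump spread over a large ball is small. -/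
lemma tendsto_integral_scaled_quadBump (hN : 0 < N) (hσ : σ ∈ Ioo (0 : ℝ) 2) :
    Tendsto (fun R : ℝ => ∫ z : Space N, quadBump (R⁻¹ • z) * fracKernel σ z) atTop (𝓝 0) := by
  have h0 : (0 : ℝ) = ∫ _ : Space N, (0 : ℝ) := by simp
  rw [h0]
  have hint := integrable_scaled_quadBump (N := N) hN hσ le_rfl
  refine tendsto_integral_filter_of_dominated_convergence
    (fun z => quadBump ((1 : ℝ)⁻¹ • z) * fracKernel σ z) ?_ ?_ hint ?_
  · filter_upwards [eventually_ge_atTop 1] with R hR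
    exact (integrable_scaled_quadBump hN hσ hR).aestronglyMeasurable
  · filter_upwards [eventually_ge_atTop 1] with R hR
    refine Eventually.of_forall fun z => ?_
    rw [norm_mul, Real.norm_of_nonneg (quadBump_nonneg _), Real.norm_of_nonneg
      (fracKernel_nonneg hσ.1 z)]
    refine mul_le_mul_of_nonneg_right ?_ (fracKernel_nonneg hσ.1 z)
    rw [quadBump_eq, quadBump_eq, inv_one, one_smul]
    have h1 : ‖R⁻¹ • z‖ ≤ ‖z‖ := by
      rw [norm_smul, norm_inv, Real.norm_of_nonneg (by linarith)]
      exact mul_le_of_le_one_left (norm_nonneg _) (inv_le_one_of_one_le₀ hR)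
    gcongr
  · refine Eventually.of_forall fun z => ?_
    have h1 : Tendsto (fun R : ℝ => R⁻¹ • z) atTop (𝓝 0) := by
      simpa using (tendsto_inv_atTop_zero (𝕜 := ℝ)).smul_const z
    have h2 := (contDiff_quadBump.continuous.tendsto (0 : Space N)).comp h1
    rw [quadBump_zero] at h2
    simpa using h2.mul_const (fracKernel σ z)

end
end ThetaScheme

/-! ### Sequences of scheme solutions: uniform bounds, half-relaxed limits, initial data -/

namespace ThetaScheme
noncomputable section
variable {N : ℕ} {σ θ T LF : ℝ} {F : ℝ → ℝ}
  {f : Space N → ℝ → ℝ} {u₀ : Space N → ℝ}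

/-- A sequence of solutions of the scheme with discretization parameters tending to zero under
the CFL condition. -/
structure IsSchemeSeq (σ θ T LF : ℝ) (F : ℝ → ℝ) (f : Space N → ℝ → ℝ) (u₀ : Space N → ℝ)
    (h τ : ℕ → ℝ) (U : ℕ → Space N → ℝ → ℝ) : Prop where
  h_pos : ∀ n, 0 < h n
  h_lim : Tendsto h atTop (𝓝 0)
  τ_pos : ∀ n, 0 < τ n
  τ_lim : Tendsto τ atTop (𝓝 0)
  cfl : ∀ n, τ n * LF * (1 - θ) * jumpRate N σ (h n) ≤ 1
  sol : ∀ n, IsSpaceSolution σ θ T F f u₀ (h n) (τ n) (U n)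

variable {h τ : ℕ → ℝ} {U : ℕ → Space N → ℝ → ℝ}

/-- The discrete operator is odd, so a sign change is compensated by l ↦ -F(-l). Lower estimates
thereby reduce to upper ones. -/
lemma IsSpaceSolution.reflect {h τ : ℝ} {U : Space N → ℝ → ℝ} (hτ : 0 < τ)
    (hU : IsSpaceSolution σ θ T F f u₀ h τ U) :
    IsSpaceSolution σ θ T (fun l => -F (-l)) (fun x t => -f x t) (fun x => -u₀ x) h τ
      (fun x t => -U x t) where
  bounded := hU.bounded.neg
  initial x t ht := by rw [hU.initial x t ht]
  step x t ht := by
    rw [discFracLap_neg _ _ (hU.bounded.isBddFun ⟨by linarith [ht.1], by linarith [ht.2]⟩),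
      discFracLap_neg _ _ (hU.bounded.isBddFun ⟨by linarith [ht.1], ht.2⟩), hU.step x t ht]
    rw [show -((1 - θ) * -discFracLap (spaceStep N h) h σ (fun y => U y (t - τ)) x +
      θ * -discFracLap (spaceStep N h) h σ (fun y => U y t) x) =
      (1 - θ) * discFracLap (spaceStep N h) h σ (fun y => U y (t - τ)) x +
      θ * discFracLap (spaceStep N h) h σ (fun y => U y t) x by ring]
    ring

lemma IsSchemeSeq.reflect (hU : IsSchemeSeq σ θ T LF F f u₀ h τ U) :
    IsSchemeSeq σ θ T LF (fun l => -F (-l)) (fun x t => -f x t) (fun x => -u₀ x) h τ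
      (fun n x t => -U n x t) where
  h_pos := hU.h_pos
  h_lim := hU.h_lim
  τ_pos := hU.τ_pos
  τ_lim := hU.τ_lim
  cfl := hU.cfl
  sol n := (hU.sol n).reflect (hU.τ_pos n)

/-- Uniform upper barriers. -/
lemma IsSchemeSeq.exists_barrier (hU : IsSchemeSeq σ θ T LF F f u₀ h τ U)
    (hσ : σ ∈ Ioo (0 : ℝ) 2) (hθ : θ ∈ Icc (0 : ℝ) 1) (hF : OneSidedLipschitz F LF) (hT : 0 ≤ T)
    (hf : BoundedOnSlab T f) {a b : ℝ} (hb : 0 ≤ b) {x₀ : Space N}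
    (hu₀ : ∀ x, u₀ x ≤ a + b * quadBump (x - x₀)) :
    ∃ C, 0 ≤ C ∧ ∀ n x, ∀ t ∈ Icc (0 : ℝ) T, U n x t ≤ a + b * quadBump (x - x₀) + C * t := by
  obtain ⟨B, hB⟩ := hf
  have hB0 : 0 ≤ B := (abs_nonneg _).trans (hB 0 0 ⟨le_rfl, hT⟩)
  exact ⟨_, by positivity, fun n => (hU.sol n).le_barrier hσ hθ hF hT (hU.h_pos n) (hU.τ_pos n)
    (hU.cfl n) hB hb hu₀⟩

lemma IsSchemeSeq.exists_bound (hU : IsSchemeSeq σ θ T LF F f u₀ h τ U)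
    (hσ : σ ∈ Ioo (0 : ℝ) 2) (hθ : θ ∈ Icc (0 : ℝ) 1) (hF : OneSidedLipschitz F LF) (hT : 0 ≤ T)
    (hf : BoundedOnSlab T f) (hu₀ : IsBddFun u₀) :
    ∃ C, ∀ n x, ∀ t ∈ Icc (0 : ℝ) T, |U n x t| ≤ C := by
  obtain ⟨A, hA⟩ := hu₀
  obtain ⟨C, hC, h1⟩ := hU.exists_barrier hσ hθ hF hT hf (a := A) le_rfl (x₀ := 0)
    (fun x => by linarith [(abs_le.mp (hA x)).2])
  obtain ⟨D, hD, h2⟩ := hU.reflect.exists_barrier hσ hθ hF.reflect hT hf.neg (a := A) le_rfl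
    (x₀ := 0) (fun x => by linarith [(abs_le.mp (hA x)).1])
  refine ⟨A + C * T + D * T, fun n x t ht => ?_⟩
  have e1 := h1 n x t ht
  have e2 := h2 n x t ht
  have e3 := mul_le_mul_of_nonneg_left ht.2 hC
  have e4 := mul_le_mul_of_nonneg_left ht.2 hD
  have e5 : 0 ≤ D * T := by positivity
  have e6 : 0 ≤ C * T := by positivity
  rw [abs_le]
  constructor <;> linarith

/-! ### Half-relaxed limits -/

/-- The slab `ℝ^N × [0, T]`. -/
abbrev slab (N : ℕ) (T : ℝ) : Set (Space N × ℝ) := univ ×ˢ Icc (0 : ℝ) T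

/-- The upper half-relaxed limit of a sequence of functions on the slab. -/
def relaxedLimsup (T : ℝ) (U : ℕ → Space N → ℝ → ℝ) (x : Space N) (t : ℝ) : ℝ :=
  limsup (fun q : ℕ × (Space N × ℝ) => U q.1 q.2.1 q.2.2) (atTop ×ˢ 𝓝[slab N T] (x, t))

section Relaxed
variable {C : ℝ} (hC : ∀ n x, ∀ t ∈ Icc (0 : ℝ) T, |U n x t| ≤ C)
include hC

lemma eventually_abs_le (x : Space N) (t : ℝ) :
    ∀ᶠ q : ℕ × (Space N × ℝ) in atTop ×ˢ 𝓝[slab N T] (x, t), |U q.1 q.2.1 q.2.2| ≤ C := by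
  have : ∀ᶠ p : Space N × ℝ in 𝓝[slab N T] (x, t), p ∈ slab N T := self_mem_nhdsWithin
  exact (this.prod_inr _).mono fun q hq => hC _ _ _ hq.2

omit hC in
lemma neBot_slab {x : Space N} {t : ℝ} (ht : t ∈ Icc (0 : ℝ) T) :
    (atTop ×ˢ 𝓝[slab N T] (x, t) : Filter (ℕ × (Space N × ℝ))).NeBot := by
  have : (𝓝[slab N T] (x, t)).NeBot :=
    mem_closure_iff_nhdsWithin_neBot.mp (subset_closure ⟨mem_univ _, ht⟩)
  infer_instance

lemma eventually_lt_of_relaxedLimsup_lt {x : Space N} {t c : ℝ}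
    (hc : relaxedLimsup T U x t < c) :
    ∀ᶠ q : ℕ × (Space N × ℝ) in atTop ×ˢ 𝓝[slab N T] (x, t), U q.1 q.2.1 q.2.2 < c :=
  eventually_lt_of_limsup_lt hc
    ⟨C, eventually_map.mpr ((eventually_abs_le hC x t).mono fun _ hq => (abs_le.mp hq).2)⟩

lemma isCobounded_slab {x : Space N} {t : ℝ} (ht : t ∈ Icc (0 : ℝ) T) :
    IsCoboundedUnder (· ≤ ·) (atTop ×ˢ 𝓝[slab N T] (x, t))
      (fun q : ℕ × (Space N × ℝ) => U q.1 q.2.1 q.2.2) := by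
  have := neBot_slab (x := x) ht
  exact IsBoundedUnder.isCoboundedUnder_le
    ⟨-C, eventually_map.mpr ((eventually_abs_le hC x t).mono fun _ hq => (abs_le.mp hq).1)⟩

lemma relaxedLimsup_le_of_eventually {x : Space N} {t c : ℝ} (ht : t ∈ Icc (0 : ℝ) T)
    (hc : ∀ᶠ q : ℕ × (Space N × ℝ) in atTop ×ˢ 𝓝[slab N T] (x, t), U q.1 q.2.1 q.2.2 ≤ c) :
    relaxedLimsup T U x t ≤ c :=
  limsup_le_of_le (isCobounded_slab hC ht) hc

lemma le_relaxedLimsup_of_frequently {x : Space N} {t c : ℝ}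
    (hc : ∃ᶠ q : ℕ × (Space N × ℝ) in atTop ×ˢ 𝓝[slab N T] (x, t), c ≤ U q.1 q.2.1 q.2.2) :
    c ≤ relaxedLimsup T U x t := by
  by_contra hlt
  exact hc ((eventually_lt_of_relaxedLimsup_lt hC (not_le.mp hlt)).mono fun q hq => not_le.mpr hq)

lemma boundedOnSlab_relaxedLimsup : BoundedOnSlab T (relaxedLimsup T U) := by
  refine ⟨C, fun x t ht => abs_le.mpr ⟨?_, ?_⟩⟩
  · have := neBot_slab (x := x) ht
    exact le_relaxedLimsup_of_frequently hC
      ((eventually_abs_le hC x t).mono fun _ hq => (abs_le.mp hq).1).frequently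
  · exact relaxedLimsup_le_of_eventually hC ht
      ((eventually_abs_le hC x t).mono fun _ hq => (abs_le.mp hq).2)

/-- A bound that holds eventually at (x, t) holds eventually at all nearby points of the slab, and
so is inherited by the relaxed limit there. -/
lemma upperSemicontinuousOn_relaxedLimsup :
    UpperSemicontinuousOn (Function.uncurry (relaxedLimsup T U)) (slab N T) := by
  rintro ⟨x, t⟩ hp c hc
  obtain ⟨c', hc1, hc2⟩ := exists_between hc
  have h1 := eventually_lt_of_relaxedLimsup_lt hC hc1
  obtain ⟨P, hP, Q, hQ, hPQ⟩ := eventually_prod_iff.mp h1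
  filter_upwards [eventually_eventually_nhdsWithin.mpr hQ, self_mem_nhdsWithin] with p' h2 h3
  refine lt_of_le_of_lt (relaxedLimsup_le_of_eventually hC h3.2 ?_) hc2
  exact eventually_prod_iff.mpr ⟨P, hP, Q, h2, fun hn _ hq => (hPQ hn hq).le⟩

/-- Along sequences, the limit superior is below the half-relaxed limit. -/
lemma eventually_lt_of_tendsto {x : Space N} {t c : ℝ} (hc : relaxedLimsup T U x t < c)
    {ν : ℕ → ℕ} (hν : Tendsto ν atTop atTop) {y : ℕ → Space N} {s : ℕ → ℝ}
    (hy : Tendsto y atTop (𝓝 x)) (hs : Tendsto s atTop (𝓝 t)) (hsT : ∀ k, s k ∈ Icc (0 : ℝ) T) :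
    ∀ᶠ k in atTop, U (ν k) (y k) (s k) < c := by
  have h1 : Tendsto (fun k => (y k, s k)) atTop (𝓝[slab N T] (x, t)) :=
    tendsto_nhdsWithin_iff.mpr ⟨hy.prodMk_nhds hs, Eventually.of_forall fun k => ⟨mem_univ _, hsT k⟩⟩
  exact (hν.prodMk h1).eventually (eventually_lt_of_relaxedLimsup_lt hC hc)

/-- The half-relaxed limit is attained along a sequence. -/
lemma exists_recovery_seq {x : Space N} {t : ℝ} (ht : t ∈ Icc (0 : ℝ) T) :
    ∃ (ν : ℕ → ℕ) (y : ℕ → Space N) (s : ℕ → ℝ), Tendsto ν atTop atTop ∧ Tendsto y atTop (𝓝 x) ∧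
      Tendsto s atTop (𝓝 t) ∧ (∀ k, s k ∈ Icc (0 : ℝ) T) ∧
      Tendsto (fun k => U (ν k) (y k) (s k)) atTop (𝓝 (relaxedLimsup T U x t)) := by
  have hex : ∀ k : ℕ, ∃ (n : ℕ) (y : Space N) (s : ℝ), k ≤ n ∧ dist y x < 1 / ((k : ℝ) + 1) ∧
      dist s t < 1 / ((k : ℝ) + 1) ∧ s ∈ Icc (0 : ℝ) T ∧
      dist (U n y s) (relaxedLimsup T U x t) < 1 / ((k : ℝ) + 1) := by
    intro k
    have hk : (0 : ℝ) < 1 / ((k : ℝ) + 1) := by positivity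
    have e1 := frequently_lt_of_lt_limsup (isCobounded_slab hC ht)
      (sub_lt_self (relaxedLimsup T U x t) hk)
    have e2 := eventually_lt_of_relaxedLimsup_lt hC
      (lt_add_of_pos_right (relaxedLimsup T U x t) hk)
    have e3 : ∀ᶠ q : ℕ × (Space N × ℝ) in atTop ×ˢ 𝓝[slab N T] (x, t), k ≤ q.1 :=
      (eventually_ge_atTop k).prod_inl _
    have e4 : ∀ᶠ q : ℕ × (Space N × ℝ) in atTop ×ˢ 𝓝[slab N T] (x, t),
        q.2 ∈ Metric.ball (x, t) (1 / ((k : ℝ) + 1)) ∩ slab N T :=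
      Eventually.prod_inr (inter_mem (mem_nhdsWithin_of_mem_nhds (Metric.ball_mem_nhds _ hk))
        self_mem_nhdsWithin) _
    obtain ⟨⟨n, y, s⟩, h1, h2, h3, h4, h6⟩ := (e1.and_eventually (e2.and (e3.and e4))).exists
    rw [Metric.mem_ball, Prod.dist_eq, max_lt_iff] at h4
    refine ⟨n, y, s, h3, h4.1, h4.2, h6.2, ?_⟩
    dsimp only at h1 h2
    rw [Real.dist_eq, abs_lt]
    constructor <;> linarith
  choose ν y s h1 h2 h3 h4 h5 using hex
  have hlim := tendsto_one_div_add_atTop_nhds_zero_nat (𝕜 := ℝ)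
  refine ⟨ν, y, s, tendsto_atTop_mono h1 tendsto_id, ?_, ?_, h4, ?_⟩
  · exact tendsto_iff_dist_tendsto_zero.mpr
      (squeeze_zero (fun _ => dist_nonneg) (fun k => (h2 k).le) hlim)
  · exact tendsto_iff_dist_tendsto_zero.mpr
      (squeeze_zero (fun _ => dist_nonneg) (fun k => (h3 k).le) hlim)
  · exact tendsto_iff_dist_tendsto_zero.mpr
      (squeeze_zero (fun _ => dist_nonneg) (fun k => (h5 k).le) hlim)

end Relaxed

/-- The half-relaxed limit takes the initial values. -/
lemma IsSchemeSeq.relaxedLimsup_initial (hU : IsSchemeSeq σ θ T LF F f u₀ h τ U)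
    (hσ : σ ∈ Ioo (0 : ℝ) 2) (hθ : θ ∈ Icc (0 : ℝ) 1) (hF : OneSidedLipschitz F LF) (hT : 0 ≤ T)
    (hf : BoundedOnSlab T f) (hu₀ : IsBddFun u₀) (hu₀c : Continuous u₀) (x : Space N) :
    relaxedLimsup T U x 0 ≤ u₀ x := by
  obtain ⟨C, hC⟩ := hU.exists_bound hσ hθ hF hT hf hu₀
  obtain ⟨A, hA0, hA⟩ := hu₀.exists_nonneg
  refine le_of_forall_pos_lt_add fun ε hε => ?_
  obtain ⟨ρ, hρ, hball⟩ := Metric.continuousAt_iff.mp (hu₀c.continuousAt (x := x)) (ε / 2)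
    (by positivity)
  -- Inside the ball of radius ρ, continuity gives the bound; outside it the bump is at least
  -- ρ²/(1+ρ²), so the chosen coefficient adds at least 2A, the largest possible oscillation of u₀.
  obtain ⟨D, hD, hbar⟩ := hU.exists_barrier hσ hθ hF hT hf (a := u₀ x + ε / 2)
    (b := 2 * A * ((1 + ρ ^ 2) / ρ ^ 2)) (by positivity) (x₀ := x) (fun y => by
      have hq := quadBump_nonneg (y - x)
      rcases lt_or_ge (dist y x) ρ with hy | hy
      · have h1 := hball hy
        rw [Real.dist_eq, abs_lt] at h1
        have : 0 ≤ 2 * A * ((1 + ρ ^ 2) / ρ ^ 2) * quadBump (y - x) := by positivity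
        linarith
      · rw [dist_eq_norm] at hy
        have h1 := quadBump_lower hρ.le hy
        have h2 : 1 ≤ (1 + ρ ^ 2) / ρ ^ 2 * quadBump (y - x) := by
          calc (1 : ℝ) = (1 + ρ ^ 2) / ρ ^ 2 * (ρ ^ 2 / (1 + ρ ^ 2)) := by field_simp
            _ ≤ _ := by gcongr
        have h3 := mul_le_mul_of_nonneg_left h2 (by positivity : 0 ≤ 2 * A)
        have h4 := abs_le.mp (hA y)
        have h5 := abs_le.mp (hA x)
        linarith)
  refine lt_of_le_of_lt (relaxedLimsup_le_of_eventually hC ⟨le_rfl, hT⟩ (c := u₀ x + 3 * ε / 4) ?_)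
    (by linarith)
  have hcont : Continuous (fun p : Space N × ℝ => u₀ x + ε / 2 +
      2 * A * ((1 + ρ ^ 2) / ρ ^ 2) * quadBump (p.1 - x) + D * p.2) := by
    have := (contDiff_quadBump (V := Space N)).continuous
    fun_prop
  have h1 := (hcont.tendsto (x, 0)).eventually_lt_const (u := u₀ x + 3 * ε / 4) (by
    rw [sub_self, quadBump_zero]; linarith)
  have h2 : ∀ᶠ p in 𝓝[slab N T] (x, (0 : ℝ)), p ∈ slab N T := self_mem_nhdsWithin
  have h3 : ∀ᶠ p in 𝓝[slab N T] (x, (0 : ℝ)), _ := h1.filter_mono nhdsWithin_le_nhds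
  refine Eventually.mono (Eventually.prod_inr (h3.and h2) _) ?_
  rintro ⟨n, y, s⟩ ⟨h4, h5⟩
  exact (hbar n y s h5.2).trans h4.le

end
end ThetaScheme

/-! ### Stability: the relaxed limit satisfies the viscosity inequality -/

namespace ThetaScheme
noncomputable section
variable {N : ℕ} {σ θ T LF : ℝ} {F : ℝ → ℝ}
  {f : Space N → ℝ → ℝ} {u₀ : Space N → ℝ}
variable {h τ : ℕ → ℝ} {U : ℕ → Space N → ℝ → ℝ}

/-- Difference quotients in time of a `C¹` function along moving points. -/
lemma tendsto_diff_quotient {φ : Space N → ℝ → ℝ} (hφ : ContDiff ℝ 1 (Function.uncurry φ))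
    {y : ℕ → Space N} {s s' : ℕ → ℝ} {x : Space N} {t : ℝ} (hy : Tendsto y atTop (𝓝 x))
    (hs : Tendsto s atTop (𝓝 t)) (hs' : Tendsto s' atTop (𝓝 t)) (hlt : ∀ᶠ k in atTop, s' k < s k) :
    Tendsto (fun k => (φ (y k) (s k) - φ (y k) (s' k)) / (s k - s' k)) atTop
      (𝓝 (deriv (φ x) t)) := by
  -- Strict differentiability allows both endpoints of the difference quotient and the space point
  -- to move.
  have hstrict := hφ.contDiffAt.hasStrictFDerivAt (x := (x, t)) (by norm_num)
  set D := fderiv ℝ (Function.uncurry φ) (x, t)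
  have hD : deriv (φ x) t = D (0, 1) := by
    have h1 : HasDerivAt (fun r : ℝ => (x, r)) ((0 : Space N), (1 : ℝ)) t :=
      (hasDerivAt_const t x).prodMk (hasDerivAt_id t)
    exact (hstrict.hasFDerivAt.comp_hasDerivAt t h1).deriv
  have ho := hstrict.isLittleO.comp_tendsto
    ((hy.prodMk_nhds hs).prodMk_nhds (hy.prodMk_nhds hs'))
  have h2 : (fun k => φ (y k) (s k) - φ (y k) (s' k) - (s k - s' k) * D (0, 1)) =o[atTop]
      fun k => s k - s' k := by
    refine (ho.congr_left fun k => ?_).trans_isBigO ?_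
    · have : ((y k, s k) - (y k, s' k) : Space N × ℝ) = (s k - s' k) • ((0 : Space N), (1 : ℝ)) := by
        simp
      simp only [Function.comp]
      rw [this, map_smul, smul_eq_mul]
      rfl
    · refine Asymptotics.isBigO_of_le _ fun k => ?_
      simp [Function.comp, Prod.norm_def]
  rw [hD]
  have h3 := h2.tendsto_div_nhds_zero.add_const (D (0, 1))
  rw [zero_add] at h3
  refine h3.congr' ?_
  filter_upwards [hlt] with k hk
  have : s k - s' k ≠ 0 := by linarith
  field_simp
  ring

/-- The penalized test function. -/
def penalized (φ : Space N → ℝ → ℝ) (A R : ℝ) (x₀ : Space N) (t₀ : ℝ) (x : Space N) (t : ℝ) : ℝ :=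
  φ x t + A * quadBump (R⁻¹ • (x - x₀)) + A * quadBump (t - t₀)

lemma contDiff_scaled_quadBump (R : ℝ) (x₀ : Space N) :
    ContDiff ℝ 2 (fun x : Space N => quadBump (R⁻¹ • (x - x₀))) :=
  contDiff_quadBump.comp ((contDiff_id.sub contDiff_const).const_smul R⁻¹)

lemma isTestFunction_penalized {φ : Space N → ℝ → ℝ} (hφ : IsTestFunction T φ) (A R : ℝ)
    (x₀ : Space N) (t₀ : ℝ) : IsTestFunction T (penalized φ A R x₀ t₀) := by
  obtain ⟨hc, B, hB⟩ := hφ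
  refine ⟨?_, B + |A| + |A|, fun x t ht => ?_⟩
  · have h1 : ContDiff ℝ 2 (fun p : Space N × ℝ => quadBump (R⁻¹ • (p.1 - x₀))) :=
      (contDiff_scaled_quadBump R x₀).comp contDiff_fst
    have h2 : ContDiff ℝ 2 (fun p : Space N × ℝ => quadBump (p.2 - t₀)) :=
      contDiff_quadBump.comp (contDiff_snd.sub contDiff_const)
    exact (hc.add (contDiff_const.mul h1)).add (contDiff_const.mul h2)
  · have h1 : ∀ r : ℝ, 0 ≤ r → r ≤ 1 → |A * r| ≤ |A| := fun r h0 h1 => by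
      rw [abs_mul, abs_of_nonneg h0]
      exact mul_le_of_le_one_right (abs_nonneg A) h1
    refine (abs_add_le _ _).trans (add_le_add ((abs_add_le _ _).trans (add_le_add (hB x t ht) ?_)) ?_)
    · exact h1 _ (quadBump_nonneg _) (quadBump_le_one _)
    · exact h1 _ (quadBump_nonneg _) (quadBump_le_one _)

lemma deriv_penalized {φ : Space N → ℝ → ℝ} (hφ : IsTestFunction T φ) (A R : ℝ)
    (x₀ : Space N) (t₀ : ℝ) : deriv (penalized φ A R x₀ t₀ x₀) t₀ = deriv (φ x₀) t₀ := by
  have h1 : DifferentiableAt ℝ (φ x₀) t₀ := by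
    have : Differentiable ℝ (Function.uncurry φ) := hφ.1.differentiable (by norm_num)
    have h2 : DifferentiableAt ℝ (fun r : ℝ => (x₀, r)) t₀ := by fun_prop
    exact (this (x₀, t₀)).comp t₀ h2
  have h2 : HasDerivAt (fun t : ℝ => A * quadBump (t - t₀)) 0 t₀ := by
    have e1 : HasDerivAt (fun t : ℝ => (t - t₀) ^ 2 / (1 + (t - t₀) ^ 2)) 0 t₀ := by
      have e2 : HasDerivAt (fun t : ℝ => (t - t₀) ^ 2) 0 t₀ := by
        simpa using ((hasDerivAt_id' t₀).sub_const t₀).fun_pow 2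
      simpa using e2.fun_div (e2.const_add 1) (by simp)
    have e3 : (fun t : ℝ => A * quadBump (t - t₀)) =
        fun t => A * ((t - t₀) ^ 2 / (1 + (t - t₀) ^ 2)) := by
      funext t
      simp [quadBump]
    rw [e3]
    simpa using e1.const_mul A
  have h3 := (h1.hasDerivAt.add_const (A * quadBump (R⁻¹ • (x₀ - x₀)))).add h2
  rw [add_zero] at h3
  exact h3.deriv

lemma secondDiff_scaled_self (A R : ℝ) (x₀ z : Space N) :
    secondDiff (fun y => A * quadBump (R⁻¹ • (y - x₀))) x₀ z = 2 * A * quadBump (R⁻¹ • z) := by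
  simp [secondDiff, quadBump_zero, quadBump_neg]
  ring

/-- At the centre the second difference of the bump is 2A times its value, and the penalization in
time vanishes at t₀. The additional integral tends to 0 as R → ∞, so making the maximum strict costs
nothing in the limit. -/
lemma levyOp_penalized (hN : 0 < N) (hσ : σ ∈ Ioo (0 : ℝ) 2) {φ : Space N → ℝ → ℝ}
    (hφ : IsTestFunction T φ) {A R : ℝ} (hA : 0 ≤ A) (hR : 1 ≤ R) (x₀ : Space N) {t₀ : ℝ}
    (ht₀ : t₀ ∈ Icc (0 : ℝ) T) :
    levyOp σ (fun x => penalized φ A R x₀ t₀ x t₀) x₀ =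
      levyOp σ (fun x => φ x t₀) x₀ + A * ∫ z : Space N, quadBump (R⁻¹ • z) * fracKernel σ z := by
  obtain ⟨C, hC, ρ, hρ, hb⟩ := hφ.exists_secondDiff_le x₀ t₀
  have hc := hφ.continuous
  have h1 : ∀ z : Space N, quadBump (R⁻¹ • z) ≤ quadBump z := by
    intro z
    rw [quadBump_eq, quadBump_eq]
    have h1 : ‖R⁻¹ • z‖ ≤ ‖z‖ := by
      rw [norm_smul, norm_inv, Real.norm_of_nonneg (by linarith)]
      exact mul_le_of_le_one_left (norm_nonneg _) (inv_le_one_of_one_le₀ hR)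
    gcongr
  have h2 := levyOp_add hN hσ (φ := fun x => φ x t₀)
    (ψ := fun x => A * quadBump (R⁻¹ • (x - x₀)))
    (by fun_prop : Continuous fun y => φ y t₀).measurable
    (((contDiff_scaled_quadBump R x₀).continuous.const_mul A)).measurable
    (x := x₀) hC (D := 2 * A) (by positivity)
    (hb x₀ t₀ (by simpa using hρ) (by simpa using hρ) ht₀) (fun z => by
      rw [secondDiff_scaled_self, abs_of_nonneg (by have := quadBump_nonneg (R⁻¹ • z); positivity)]
      exact mul_le_mul_of_nonneg_left (h1 z) (by positivity))
  have h3 : (fun x => penalized φ A R x₀ t₀ x t₀) =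
      fun x => φ x t₀ + A * quadBump (R⁻¹ • (x - x₀)) := by
    funext x
    simp [penalized, quadBump_zero]
  rw [h3, h2]
  congr 1
  rw [levyOp]
  simp_rw [secondDiff_scaled_self]
  rw [← integral_const_mul, ← integral_const_mul]
  congr 1
  funext z
  ring

/-- Approximate maximum points of the penalized difference converge. -/
lemma exists_max_seq (hT : 0 ≤ T) {C : ℝ} (hC : ∀ n x, ∀ t ∈ Icc (0 : ℝ) T, |U n x t| ≤ C)
    {φ : Space N → ℝ → ℝ} (hφ : IsTestFunction T φ) {B : ℝ}
    (hB : ∀ x, ∀ t ∈ Icc (0 : ℝ) T, |φ x t| ≤ B) {x₀ : Space N} {t₀ : ℝ}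
    (ht₀ : t₀ ∈ Icc (0 : ℝ) T)
    (hmax : ∀ y, ∀ s ∈ Icc (0 : ℝ) T, relaxedLimsup T U y s - φ y s ≤
      relaxedLimsup T U x₀ t₀ - φ x₀ t₀) {δ : ℕ → ℝ} (hδ : ∀ n, 0 < δ n)
    (hδ0 : Tendsto δ atTop (𝓝 0)) {R : ℝ} (hR : 0 < R) :
    ∃ (ν : ℕ → ℕ) (y : ℕ → Space N) (s : ℕ → ℝ), Tendsto ν atTop atTop ∧
      Tendsto y atTop (𝓝 x₀) ∧ Tendsto s atTop (𝓝 t₀) ∧ (∀ k, s k ∈ Icc (0 : ℝ) T) ∧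
      ∀ k, ∀ x, ∀ t ∈ Icc (0 : ℝ) T,
        U (ν k) x t - penalized φ (4 * (B + C) + 4) R x₀ t₀ x t ≤
        U (ν k) (y k) (s k) - penalized φ (4 * (B + C) + 4) R x₀ t₀ (y k) (s k) + δ (ν k) := by
  have hC0 : 0 ≤ C := (abs_nonneg _).trans (hC 0 0 0 ⟨le_rfl, hT⟩)
  have hB0 : 0 ≤ B := (abs_nonneg _).trans (hB 0 0 ⟨le_rfl, hT⟩)
  -- Outside the ball of radius R the bump is at least 1/2, so the penalized difference is at most
  -- -(B + C) - 2 there, whereas m ≥ -(B + C). Almost maximal points thus stay in a compact set.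
  set A := 4 * (B + C) + 4 with hA
  have hApos : 0 < A := by positivity
  set φR := penalized φ A R x₀ t₀ with hφR
  have htest : IsTestFunction T φR := isTestFunction_penalized hφ A R x₀ t₀
  set m := relaxedLimsup T U x₀ t₀ - φ x₀ t₀ with hm
  have hφR0 : φR x₀ t₀ = φ x₀ t₀ := by simp [hφR, penalized, quadBump_zero]
  have hUC : ∀ n, BoundedOnSlab T (U n) := fun n => ⟨C, hC n⟩
  obtain ⟨ν, p, r, hν, hp, hr, hrT, hUlim⟩ := exists_recovery_seq hC ht₀ (x := x₀)
  have hsel := fun k => ((hUC (ν k)).sub htest.2).exists_almost_max hT (hδ (ν k))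
  choose y s hsT hys using hsel
  have hlow : Tendsto (fun k => U (ν k) (p k) (r k) - φR (p k) (r k) - δ (ν k)) atTop (𝓝 m) := by
    have h1 : Tendsto (fun k => φR (p k) (r k)) atTop (𝓝 (φ x₀ t₀)) := by
      have := (htest.continuous.tendsto (x₀, t₀)).comp (hp.prodMk_nhds hr)
      rw [show Function.uncurry φR (x₀, t₀) = φ x₀ t₀ from hφR0] at this
      exact this
    have := (hUlim.sub h1).sub (hδ0.comp hν)
    rwa [sub_zero] at this
  have hge : ∀ k, U (ν k) (p k) (r k) - φR (p k) (r k) - δ (ν k) ≤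
      U (ν k) (y k) (s k) - φR (y k) (s k) := fun k => by linarith [hys k (p k) (r k) (hrT k)]
  have hmlow : -(B + C) ≤ m := by
    have h2 : -C ≤ relaxedLimsup T U x₀ t₀ :=
      ge_of_tendsto hUlim (Eventually.of_forall fun k => (abs_le.mp (hC _ _ _ (hrT k))).1)
    have h3 := abs_le.mp (hB x₀ t₀ ht₀)
    rw [hm]; linarith
  have hball : ∀ᶠ k in atTop, (y k, s k) ∈ Metric.closedBall x₀ R ×ˢ Icc (0 : ℝ) T := by
    filter_upwards [hlow.eventually_const_lt (sub_one_lt m)] with k hk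
    refine ⟨?_, hsT k⟩
    by_contra hfar
    rw [Metric.mem_closedBall, not_le, dist_eq_norm] at hfar
    have h1 : (1 : ℝ) ≤ ‖R⁻¹ • (y k - x₀)‖ := by
      rw [norm_smul, norm_inv, Real.norm_of_nonneg hR.le, inv_mul_eq_div, one_le_div hR]
      exact hfar.le
    have h2 := quadBump_lower zero_le_one h1
    norm_num at h2
    have h3 := hge k
    have h4 := (abs_le.mp (hC (ν k) (y k) (s k) (hsT k))).2
    have h5 := (abs_le.mp (hB (y k) (s k) (hsT k))).1
    have h6 : φR (y k) (s k) = φ (y k) (s k) + A * quadBump (R⁻¹ • (y k - x₀)) +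
      A * quadBump (s k - t₀) := rfl
    have h7 : 0 ≤ A * quadBump (s k - t₀) := mul_nonneg hApos.le (quadBump_nonneg _)
    have h8 : A * (1 / 2) ≤ A * quadBump (R⁻¹ • (y k - x₀)) :=
      mul_le_mul_of_nonneg_left (by linarith) hApos.le
    rw [hA] at h8
    linarith
  obtain ⟨⟨x', t'⟩, hxt, κ, hκ, hlim⟩ := IsCompact.tendsto_subseq'
    ((isCompact_closedBall x₀ R).prod isCompact_Icc) hball.frequently
  have hy : Tendsto (fun k => y (κ k)) atTop (𝓝 x') := (continuous_fst.tendsto _).comp hlim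
  have hs : Tendsto (fun k => s (κ k)) atTop (𝓝 t') := (continuous_snd.tendsto _).comp hlim
  have hνκ : Tendsto (fun k => ν (κ k)) atTop atTop := hν.comp hκ.tendsto_atTop
  -- The cluster point still reaches the unpenalized maximum m, so both penalties must vanish at it,
  -- and it is (x₀, t₀).
  have hkey : m ≤ relaxedLimsup T U x' t' - φR x' t' := by
    refine le_of_forall_pos_le_add fun ε hε => ?_
    have h1 := eventually_lt_of_tendsto hC (lt_add_of_pos_right (relaxedLimsup T U x' t') hε)
      hνκ hy hs (fun k => hsT _)
    have h2 : Tendsto (fun k => φR (y (κ k)) (s (κ k))) atTop (𝓝 (φR x' t')) :=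
      (htest.continuous.tendsto (x', t')).comp (hy.prodMk_nhds hs)
    have h3 := hlow.comp hκ.tendsto_atTop
    refine le_of_tendsto_of_tendsto h3 ((h2.const_sub (relaxedLimsup T U x' t' + ε))) ?_ |>.trans ?_
    · filter_upwards [h1] with k hk
      simp only [Function.comp]
      linarith [hge (κ k)]
    · linarith
  have hmax' := hmax x' t' hxt.2
  have h6 : φR x' t' = φ x' t' + A * quadBump (R⁻¹ • (x' - x₀)) + A * quadBump (t' - t₀) := rfl
  have hq1 := quadBump_nonneg (R⁻¹ • (x' - x₀))
  have hq2 := quadBump_nonneg (t' - t₀)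
  have hx : x' = x₀ := by
    by_contra hne
    have := quadBump_pos (z := R⁻¹ • (x' - x₀))
      (smul_ne_zero (inv_ne_zero hR.ne') (sub_ne_zero.mpr hne))
    nlinarith
  have ht : t' = t₀ := by
    by_contra hne
    have := quadBump_pos (z := t' - t₀) (sub_ne_zero.mpr hne)
    nlinarith
  subst hx ht
  exact ⟨fun k => ν (κ k), fun k => y (κ k), fun k => s (κ k), hνκ, hy, hs, fun k => hsT _,
    fun k => hys (κ k)⟩

/-- Stability: the half-relaxed limit of solutions of the scheme satisfies the viscosity
inequality. -/
lemma IsSchemeSeq.relaxedLimsup_test (hU : IsSchemeSeq σ θ T LF F f u₀ h τ U) (hN : 0 < N)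
    (hσ : σ ∈ Ioo (0 : ℝ) 2) (hθ : θ ∈ Icc (0 : ℝ) 1) (hF : OneSidedLipschitz F LF) (hT : 0 ≤ T)
    (hf : BoundedOnSlab T f) (hfc : ContinuousOn (Function.uncurry f) (univ ×ˢ Ioc (0 : ℝ) T))
    (hu₀ : IsBddFun u₀) {φ : Space N → ℝ → ℝ} (hφ : IsTestFunction T φ) {x₀ : Space N} {t₀ : ℝ}
    (ht₀ : t₀ ∈ Ioc (0 : ℝ) T)
    (hmax : ∀ y, ∀ s ∈ Icc (0 : ℝ) T, relaxedLimsup T U y s - φ y s ≤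
      relaxedLimsup T U x₀ t₀ - φ x₀ t₀) :
    deriv (φ x₀) t₀ - F (fracLap σ (fun y => φ y t₀) x₀) ≤ f x₀ t₀ := by
  have ht₀' : t₀ ∈ Icc (0 : ℝ) T := Ioc_subset_Icc_self ht₀
  obtain ⟨C, hC⟩ := hU.exists_bound hσ hθ hF hT hf hu₀
  obtain ⟨B, hB⟩ := hφ.2
  have hC0 : 0 ≤ C := (abs_nonneg _).trans (hC 0 0 0 ⟨le_rfl, hT⟩)
  have hB0 : 0 ≤ B := (abs_nonneg _).trans (hB 0 0 ⟨le_rfl, hT⟩)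
  set A := 4 * (B + C) + 4 with hA
  have hA0 : 0 ≤ A := by positivity
  have hL := hF.nonneg
  set c : ℕ → ℝ := fun n => 1 + τ n * LF * θ * jumpRate N σ (h n) with hc
  have hc1 : ∀ n, 1 ≤ c n := fun n => by
    have h1 := jumpRate_nonneg N hσ (h n)
    have h2 := (hU.τ_pos n).le
    have h3 := hθ.1
    have : 0 ≤ τ n * LF * θ * jumpRate N σ (h n) := by positivity
    simp only [hc]
    linarith
  -- With this tolerance the error term of `test_at_almost_max` is exactly τ², which vanishes after
  -- division by τ even if c is unbounded.
  have hδpos : ∀ n, 0 < τ n ^ 2 / c n := fun n =>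
    div_pos (pow_pos (hU.τ_pos n) 2) (by linarith [hc1 n])
  have hδlim : Tendsto (fun n => τ n ^ 2 / c n) atTop (𝓝 0) := by
    have h1 : Tendsto (fun n => τ n ^ 2) atTop (𝓝 0) := by simpa using hU.τ_lim.pow 2
    exact squeeze_zero (fun n => (hδpos n).le)
      (fun n => div_le_self (sq_nonneg _) (hc1 n)) h1
  rw [hφ.fracLap_eq hN hσ x₀ ht₀']
  have hclaim : ∀ R : ℝ, 1 ≤ R → deriv (φ x₀) t₀ - F (levyOp σ (fun y => φ y t₀) x₀ +
      A * ∫ z : Space N, quadBump (R⁻¹ • z) * fracKernel σ z) ≤ f x₀ t₀ := by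
    intro R hR
    obtain ⟨ν, y, s, hν, hy, hs, hsT, halmost⟩ := exists_max_seq hT hC hφ hB ht₀' hmax
      hδpos hδlim (R := R) (by linarith)
    have htest : IsTestFunction T (penalized φ A R x₀ t₀) := isTestFunction_penalized hφ A R x₀ t₀
    set φR := penalized φ A R x₀ t₀
    have hτν : Tendsto (fun k => τ (ν k)) atTop (𝓝 0) := hU.τ_lim.comp hν
    have hhν : Tendsto (fun k => h (ν k)) atTop (𝓝 0) := hU.h_lim.comp hν
    -- Truncation at 0 keeps every previous time in [0, T], as the consistency lemma requires; since
    -- t₀ > 0 it is eventually inactive.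
    set s' : ℕ → ℝ := fun k => max 0 (s k - τ (ν k)) with hs'def
    have hs'lim : Tendsto s' atTop (𝓝 t₀) := by
      have := (tendsto_const_nhds (x := (0 : ℝ))).max (hs.sub hτν)
      rwa [sub_zero, max_eq_right ht₀.1.le] at this
    have hs'T : ∀ k, s' k ∈ Icc (0 : ℝ) T := fun k =>
      ⟨le_max_left _ _, max_le hT (by linarith [(hsT k).2, hU.τ_pos (ν k)])⟩
    have hbig : ∀ᶠ k in atTop, τ (ν k) < s k := by
      have := (hs.sub hτν).eventually_const_lt (u := 0) (by simpa using ht₀.1)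
      exact this.mono fun k hk => by linarith
    have hs'eq : ∀ᶠ k in atTop, s' k = s k - τ (ν k) :=
      hbig.mono fun k hk => max_eq_right (by linarith)
    have hlt : ∀ᶠ k in atTop, s' k < s k :=
      hs'eq.mono fun k hk => by rw [hk]; linarith [hU.τ_pos (ν k)]
    have hder := tendsto_diff_quotient (htest.1.of_le (by norm_num)) hy hs hs'lim hlt
    rw [deriv_penalized hφ] at hder
    have hL1 := htest.tendsto_discFracLap hN hσ hhν (fun k => hU.h_pos _) hy hs hsT ht₀'
    have hL2 := htest.tendsto_discFracLap hN hσ hhν (fun k => hU.h_pos _) hy hs'lim hs'T ht₀'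
    rw [levyOp_penalized hN hσ hφ hA0 hR x₀ ht₀'] at hL1 hL2
    set ℓ := levyOp σ (fun y => φ y t₀) x₀ +
      A * ∫ z : Space N, quadBump (R⁻¹ • z) * fracKernel σ z
    have hFlim : Tendsto (fun k => F ((1 - θ) * discFracLap (spaceStep N (h (ν k))) (h (ν k)) σ
        (fun x => φR x (s' k)) (y k) + θ * discFracLap (spaceStep N (h (ν k))) (h (ν k)) σ
        (fun x => φR x (s k)) (y k))) atTop (𝓝 (F ℓ)) := by
      refine (hF.continuous.tendsto ℓ).comp ?_
      have := (hL2.const_mul (1 - θ)).add (hL1.const_mul θ)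
      rwa [show (1 - θ) * ℓ + θ * ℓ = ℓ by ring] at this
    have hflim : Tendsto (fun k => f (y k) (s' k)) atTop (𝓝 (f x₀ t₀)) := by
      have h1 : Tendsto (fun k => (y k, s' k)) atTop (𝓝[univ ×ˢ Ioc (0 : ℝ) T] (x₀, t₀)) := by
        refine tendsto_nhdsWithin_iff.mpr ⟨hy.prodMk_nhds hs'lim, ?_⟩
        filter_upwards [hs'lim.eventually_const_lt ht₀.1] with k hk
        exact ⟨mem_univ _, hk, (hs'T k).2⟩
      exact (hfc (x₀, t₀) ⟨mem_univ _, ht₀⟩).tendsto.comp h1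
    have hrhs := (hFlim.add hflim).add hτν
    rw [add_zero] at hrhs
    have hineq := le_of_tendsto_of_tendsto hder hrhs ?_
    · linarith
    filter_upwards [hbig, hs'eq] with k hk1 hk2
    have h1 := (hU.sol (ν k)).test_at_almost_max hσ hθ hF (hU.τ_pos _) (hU.cfl _) htest.2
      ⟨hk1.le, (hsT k).2⟩ (halmost k)
    have h2 : τ (ν k) ^ 2 / c (ν k) * (1 + τ (ν k) * LF * θ * jumpRate N σ (h (ν k))) =
        τ (ν k) ^ 2 := div_mul_cancel₀ _ (by linarith [hc1 (ν k)])
    rw [h2, ← hk2] at h1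
    have h3 := hU.τ_pos (ν k)
    rw [show s k - s' k = τ (ν k) by rw [hk2]; ring, div_le_iff₀ h3]
    linarith
  have hlim : Tendsto (fun R : ℝ => deriv (φ x₀) t₀ - F (levyOp σ (fun y => φ y t₀) x₀ +
      A * ∫ z : Space N, quadBump (R⁻¹ • z) * fracKernel σ z)) atTop
      (𝓝 (deriv (φ x₀) t₀ - F (levyOp σ (fun y => φ y t₀) x₀))) := by
    refine tendsto_const_nhds.sub ((hF.continuous.tendsto _).comp ?_)
    have := ((tendsto_integral_scaled_quadBump (N := N) hN hσ).const_mul A).const_add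
      (levyOp σ (fun y => φ y t₀) x₀)
    simpa using this
  exact le_of_tendsto hlim ((eventually_ge_atTop 1).mono hclaim)

/-- The upper half-relaxed limit is a viscosity subsolution. -/
theorem IsSchemeSeq.isViscositySubsolution (hU : IsSchemeSeq σ θ T LF F f u₀ h τ U) (hN : 0 < N)
    (hσ : σ ∈ Ioo (0 : ℝ) 2) (hθ : θ ∈ Icc (0 : ℝ) 1) (hF : OneSidedLipschitz F LF) (hT : 0 ≤ T)
    (hf : BoundedOnSlab T f) (hfc : ContinuousOn (Function.uncurry f) (univ ×ˢ Ioc (0 : ℝ) T))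
    (hu₀ : IsBddFun u₀) (hu₀c : Continuous u₀) :
    IsViscositySubsolution σ T F f u₀ (relaxedLimsup T U) := by
  obtain ⟨C, hC⟩ := hU.exists_bound hσ hθ hF hT hf hu₀
  exact ⟨upperSemicontinuousOn_relaxedLimsup hC, boundedOnSlab_relaxedLimsup hC,
    hU.relaxedLimsup_initial hσ hθ hF hT hf hu₀ hu₀c,
    fun φ hφ x t ht hmax => hU.relaxedLimsup_test hN hσ hθ hF hT hf hfc hu₀ hφ ht hmax⟩

end
end ThetaScheme

/-! ### Smooth approximation of upper semicontinuous functions from above -/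

namespace ThetaScheme
noncomputable section

section SupConvolution
variable {X : Type*} [PseudoMetricSpace X]

/-- Sup-convolution over a set with the distance. -/
def supConv (S : Set X) (u : X → ℝ) (k : ℝ) (p : X) : ℝ := ⨆ q : S, (u q - k * dist p q)

variable {S : Set X} {u : X → ℝ} {B k : ℝ}

lemma bddAbove_supConv (hB : ∀ q ∈ S, |u q| ≤ B) (hk : 0 ≤ k) (p : X) :
    BddAbove (range fun q : S => u q - k * dist p q) := by
  refine ⟨B, ?_⟩
  rintro _ ⟨q, rfl⟩
  have h1 := (abs_le.mp (hB q q.2)).2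
  have h2 : 0 ≤ k * dist p q := by positivity
  dsimp only
  linarith

lemma le_supConv (hB : ∀ q ∈ S, |u q| ≤ B) (hk : 0 ≤ k) {p : X} (hp : p ∈ S) :
    u p ≤ supConv S u k p := by
  have h := le_ciSup (bddAbove_supConv hB hk p) ⟨p, hp⟩
  simpa [supConv] using h

lemma supConv_le (hS : S.Nonempty) (hB : ∀ q ∈ S, |u q| ≤ B) (hk : 0 ≤ k) (p : X) :
    supConv S u k p ≤ B := by
  have := hS.to_subtype
  refine ciSup_le fun q => ?_
  have h1 := (abs_le.mp (hB q q.2)).2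
  have h2 : 0 ≤ k * dist p q := by positivity
  linarith

lemma uniformContinuous_supConv (hS : S.Nonempty) (hB : ∀ q ∈ S, |u q| ≤ B) (hk : 0 ≤ k) :
    UniformContinuous (supConv S u k) := by
  have := hS.to_subtype
  refine (LipschitzWith.of_le_add_mul ⟨k, hk⟩ fun p p' => ?_).uniformContinuous
  refine ciSup_le fun q => ?_
  have h1 := le_ciSup (bddAbove_supConv hB hk p') q
  have h2 := mul_le_mul_of_nonneg_left (dist_triangle p' p q) hk
  have h3 : supConv S u k p' = ⨆ q : S, (u q - k * dist p' q) := rfl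
  rw [dist_comm p' p] at h2
  rw [h3]
  change _ ≤ _ + k * dist p p'
  linarith

/-- Points near p are controlled by upper semicontinuity; points at distance at least δ lose kδ,
which exceeds B - c' for large k. -/
lemma tendsto_supConv (hu : UpperSemicontinuousOn u S) (hB : ∀ q ∈ S, |u q| ≤ B) {p : X}
    (hp : p ∈ S) : Tendsto (fun k => supConv S u k p) atTop (𝓝 (u p)) := by
  have hS : S.Nonempty := ⟨p, hp⟩
  have := hS.to_subtype
  refine tendsto_order.mpr ⟨fun c hc => ?_, fun c hc => ?_⟩
  · filter_upwards [eventually_ge_atTop 0] with k hk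
    exact hc.trans_le (le_supConv hB hk hp)
  · obtain ⟨c', hc1, hc2⟩ := exists_between hc
    obtain ⟨δ, hδ, hball⟩ := Metric.mem_nhdsWithin_iff.mp (hu p hp c' hc1)
    filter_upwards [eventually_ge_atTop 0, eventually_ge_atTop ((B - c') / δ)] with k hk hk2
    refine lt_of_le_of_lt (ciSup_le fun q => ?_) hc2
    rcases lt_or_ge (dist p q) δ with hd | hd
    · have h1 : u q < c' := hball ⟨by rwa [Metric.mem_ball, dist_comm], q.2⟩
      have h2 : 0 ≤ k * dist p q := by positivity
      linarith
    · rw [div_le_iff₀ hδ] at hk2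
      have h1 := (abs_le.mp (hB q q.2)).2
      have h2 := mul_le_mul_of_nonneg_left hd hk
      linarith

end SupConvolution

/-- Bounded upper semicontinuous functions are limits of smooth functions from above. -/
lemma exists_contDiff_tendsto_of_upperSemicontinuousOn {E : Type*} [NormedAddCommGroup E]
    [NormedSpace ℝ E] [FiniteDimensional ℝ E] {S : Set E} {u : E → ℝ} {B : ℝ}
    (hu : UpperSemicontinuousOn u S) (hB : ∀ q ∈ S, |u q| ≤ B) :
    ∃ g : ℕ → E → ℝ, (∀ k, ContDiff ℝ 2 (g k)) ∧ (∀ k, ∀ p ∈ S, u p ≤ g k p ∧ |g k p| ≤ B + 2) ∧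
      ∀ p ∈ S, Tendsto (fun k => g k p) atTop (𝓝 (u p)) := by
  rcases S.eq_empty_or_nonempty with rfl | hS
  · exact ⟨fun _ _ => 0, fun _ => contDiff_const, by simp, by simp⟩
  have hδ : ∀ k : ℕ, (0 : ℝ) < 1 / ((k : ℝ) + 1) := fun k => by positivity
  have hδ1 : ∀ k : ℕ, 1 / ((k : ℝ) + 1) ≤ 1 := fun k => by
    rw [div_le_one (by positivity)]
    linarith [(Nat.cast_nonneg k : (0 : ℝ) ≤ k)]
  have hex := fun k : ℕ => (uniformContinuous_supConv hS hB (Nat.cast_nonneg k)).exists_contDiff_dist_le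
    (hδ k)
  choose g hg hgd using hex
  have hd : ∀ k p, |g k p - supConv S u k p| < 1 / ((k : ℝ) + 1) := fun k p => by
    rw [← Real.dist_eq]; exact hgd k p
  -- The shift by the approximation error keeps the smooth functions above u. Shift and error are
  -- each at most 1, whence the bound B + 2.
  refine ⟨fun k p => g k p + 1 / ((k : ℝ) + 1),
    fun k => (((hg k).of_le (by exact_mod_cast le_top : ((2 : ℕ∞) : WithTop ℕ∞) ≤ ((⊤ : ℕ∞) : WithTop ℕ∞)))).add contDiff_const, fun k p hp => ?_, fun p hp => ?_⟩
  · have h1 := abs_lt.mp (hd k p)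
    have h2 := le_supConv hB (Nat.cast_nonneg k) hp
    have h3 := supConv_le hS hB (Nat.cast_nonneg k) p
    have h4 := abs_le.mp (hB p hp)
    refine ⟨by linarith, abs_le.mpr ⟨?_, ?_⟩⟩ <;> linarith [hδ1 k, hδ k]
  · have h1 := (tendsto_supConv hu hB hp).comp (tendsto_natCast_atTop_atTop (R := ℝ))
    have h2 := tendsto_one_div_add_atTop_nhds_zero_nat (𝕜 := ℝ)
    have h3 : Tendsto (fun k => g k p - supConv S u k p) atTop (𝓝 0) :=
      squeeze_zero_norm (fun k => (hd k p).le) h2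
    have h4 := (h3.add h1).add h2
    rw [zero_add, add_zero] at h4
    refine h4.congr fun k => ?_
    simp only [Function.comp]
    ring

end
end ThetaScheme

/-! ### Testing with the subsolution itself away from the contact point -/

namespace ThetaScheme
noncomputable section
variable {N : ℕ} {σ T LF : ℝ} {F : ℝ → ℝ}
  {f : Space N → ℝ → ℝ} {u₀ : Space N → ℝ} {u : Space N → ℝ → ℝ}

/-- A function glued from `φ` near `x₀` and `u` away from `x₀`, with a cutoff `χ` at the origin. -/
def glue (χ φ u : Space N → ℝ) (x₀ x : Space N) : ℝ :=
  χ (x - x₀) * φ x + (1 - χ (x - x₀)) * u x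

/-- The quadratic penalizations are unbounded, whereas test functions must be bounded; the cutoff
confines them to a compact set. -/
lemma exists_bound_cutoff_mul (χ : ContDiffBump (0 : Space N)) {Ψ : Space N × ℝ → ℝ}
    (hΨ : Continuous Ψ) (T : ℝ) (x₀ : Space N) :
    ∃ D, ∀ x, ∀ t ∈ Icc (0 : ℝ) T, |χ (x - x₀) * Ψ (x, t)| ≤ D := by
  obtain ⟨D, hD⟩ := ((isCompact_closedBall x₀ χ.rOut).prod
    (isCompact_Icc (a := (0 : ℝ)) (b := T))).exists_bound_of_continuousOn hΨ.continuousOn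
  refine ⟨max D 0, fun x t ht => ?_⟩
  rcases le_or_gt (dist x x₀) χ.rOut with hx | hx
  · rw [abs_mul, abs_of_nonneg χ.nonneg]
    have h1 := hD (x, t) ⟨hx, ht⟩
    calc χ (x - x₀) * |Ψ (x, t)| ≤ 1 * |Ψ (x, t)| :=
          mul_le_mul_of_nonneg_right χ.le_one (abs_nonneg _)
      _ ≤ max D 0 := by rw [one_mul]; exact le_max_of_le_left h1
  · rw [χ.zero_of_le_dist (by rw [dist_zero_right, ← dist_eq_norm]; exact hx.le)]
    simp

/-- The glued function is not smooth, but replacing u in it by smooth g_k ≥ u decreasing to u in the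
limit sense gives admissible test functions that touch u from above at the same point. Near that
point they all coincide with Φ up to a constant, so the viscosity inequality passes to the limit by
dominated convergence. -/
lemma IsViscositySubsolution.test_glue (hN : 0 < N) (hσ : σ ∈ Ioo (0 : ℝ) 2) (hF : Continuous F)
    (hu : IsViscositySubsolution σ T F f u₀ u) {Φ : Space N → ℝ → ℝ}
    (hΦ : ContDiff ℝ 2 (Function.uncurry Φ)) {x₀ : Space N} {t₀ : ℝ} (ht₀ : t₀ ∈ Ioc (0 : ℝ) T)
    (hmax : ∀ y, ∀ s ∈ Icc (0 : ℝ) T, u y s - Φ y s ≤ u x₀ t₀ - Φ x₀ t₀)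
    (χ : ContDiffBump (0 : Space N)) :
    ∃ w, w = glue χ (fun x => Φ x t₀ - Φ x₀ t₀ + u x₀ t₀) (fun x => u x t₀) x₀ ∧
      Measurable w ∧ (∃ C, 0 ≤ C ∧ ∀ z, |secondDiff w x₀ z| ≤ C * quadBump z) ∧
      deriv (Φ x₀) t₀ - F (levyOp σ w x₀) ≤ f x₀ t₀ := by
  have ht₀' : t₀ ∈ Icc (0 : ℝ) T := Ioc_subset_Icc_self ht₀
  obtain ⟨B, hB⟩ := hu.bounded
  obtain ⟨g, hgc, hg, hglim⟩ := exists_contDiff_tendsto_of_upperSemicontinuousOn hu.usc (B := B)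
    (fun q hq => hB q.1 q.2 hq.2)
  set Ψ : Space N → ℝ → ℝ := fun x t => Φ x t - Φ x₀ t₀ + u x₀ t₀ with hΨ
  have hΨc : ContDiff ℝ 2 (Function.uncurry Ψ) := (hΦ.sub contDiff_const).add contDiff_const
  obtain ⟨D, hD⟩ := exists_bound_cutoff_mul χ hΨc.continuous T x₀
  set φ : ℕ → Space N → ℝ → ℝ := fun k x t =>
    χ (x - x₀) * Ψ x t + (1 - χ (x - x₀)) * g k (x, t) with hφ
  have hχ0 : ∀ z : Space N, ‖z‖ < χ.rIn → χ z = 1 := fun z hz =>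
    χ.one_of_mem_closedBall (by simpa using hz.le)
  have hφb : ∀ k x, ∀ t ∈ Icc (0 : ℝ) T, |φ k x t| ≤ D + (B + 2) := by
    intro k x t ht
    refine (abs_add_le _ _).trans (add_le_add (hD x t ht) ?_)
    rw [abs_mul, abs_of_nonneg (sub_nonneg.mpr χ.le_one)]
    exact (mul_le_of_le_one_left (abs_nonneg _) (by linarith [χ.nonneg (x := x - x₀)])).trans
      (hg k (x, t) ⟨mem_univ _, ht⟩).2
  have hφtest : ∀ k, IsTestFunction T (φ k) := by
    intro k
    refine ⟨?_, _, hφb k⟩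
    have h1 : ContDiff ℝ 2 (fun p : Space N × ℝ => χ (p.1 - x₀)) :=
      χ.contDiff.comp (contDiff_fst.sub contDiff_const)
    exact (h1.mul hΨc).add ((contDiff_const.sub h1).mul (hgc k))
  set w := glue χ (fun x => Ψ x t₀) (fun x => u x t₀) x₀ with hw
  have hwlim : ∀ x, Tendsto (fun k => φ k x t₀) atTop (𝓝 (w x)) := fun x =>
    ((hglim (x, t₀) ⟨mem_univ _, ht₀'⟩).const_mul (1 - χ (x - x₀))).const_add
      (χ (x - x₀) * Ψ x t₀)
  have hsdlim : ∀ z, Tendsto (fun k => secondDiff (fun x => φ k x t₀) x₀ z) atTop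
      (𝓝 (secondDiff w x₀ z)) := fun z =>
    ((hwlim _).add (hwlim _)).sub ((hwlim _).const_mul 2)
  obtain ⟨K, hK, ρ, hρ, hρ1, hloc⟩ := exists_secondDiff_le_sq hΨc (x₀, t₀)
  have hBD : 0 ≤ D + (B + 2) := (abs_nonneg _).trans (hφb 0 x₀ t₀ ht₀')
  -- Independent of k: on the inner ball of the cutoff the test functions equal Ψ, and elsewhere
  -- only their common supremum bound enters.
  set C := bumpConst K (min ρ χ.rIn) (D + (B + 2)) with hC
  have hC0 : 0 ≤ C := bumpConst_nonneg hK hBD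
  have hsd : ∀ k z, |secondDiff (fun x => φ k x t₀) x₀ z| ≤ C * quadBump z := by
    intro k z
    refine secondDiff_le_quadBump hK (lt_min hρ χ.rIn_pos) ((min_le_left _ _).trans hρ1)
      (fun x => hφb k x t₀ ht₀') (fun z hz => ?_) z
    have h1 := hloc (x₀, t₀) (Metric.mem_ball_self hρ) (z, 0) (by
      simpa [Prod.norm_def, hρ] using hz.trans_le (min_le_left _ _))
    have h2 : χ z = 1 := hχ0 z (hz.trans_le (min_le_right _ _))
    have h3 : χ (-z) = 1 := by rw [χ.neg, h2]
    have h4 : χ (0 : Space N) = 1 := hχ0 0 (by simpa using χ.rIn_pos)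
    have h5 : secondDiff (fun x => φ k x t₀) x₀ z = secondDiff (Function.uncurry Ψ) (x₀, t₀) (z, 0) := by
      simp [secondDiff, hφ, h2, h3, h4, Function.uncurry]
    rw [h5]
    simpa [Prod.norm_def] using h1
  have hsdw : ∀ z, |secondDiff w x₀ z| ≤ C * quadBump z := fun z =>
    le_of_tendsto (hsdlim z).abs (Eventually.of_forall fun k => hsd k z)
  have hφm : ∀ k, Measurable (fun x => φ k x t₀) := fun k => by
    have := (hφtest k).continuous
    exact (by fun_prop : Continuous fun x => φ k x t₀).measurable
  have hwm : Measurable w := measurable_of_tendsto_metrizable hφm (tendsto_pi_nhds.mpr hwlim)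
  refine ⟨w, rfl, hwm, ⟨C, hC0, hsdw⟩, ?_⟩
  have hχ00 : χ (0 : Space N) = 1 := hχ0 0 (by simpa using χ.rIn_pos)
  have hineq : ∀ k, deriv (Φ x₀) t₀ - F (levyOp σ (fun x => φ k x t₀) x₀) ≤ f x₀ t₀ := by
    intro k
    have h1 : φ k x₀ = fun t => Φ x₀ t - Φ x₀ t₀ + u x₀ t₀ := by
      funext t
      simp [hφ, hχ00, hΨ]
    have h2 := hu.test (φ k) (hφtest k) x₀ t₀ ht₀ (fun y s hs => by
      have e1 : φ k x₀ t₀ = u x₀ t₀ := by rw [h1]; simp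
      have e2 : u y s ≤ Ψ y s := by
        simp only [hΨ]
        linarith [hmax y s hs]
      have e3 := (hg k (y, s) ⟨mem_univ _, hs⟩).1
      have e4 := mul_le_mul_of_nonneg_left e2 (χ.nonneg (x := y - x₀))
      have e5 := mul_le_mul_of_nonneg_left e3 (sub_nonneg.mpr (χ.le_one (x := y - x₀)))
      rw [e1]
      simp only [hφ, Function.uncurry] at e5 ⊢
      linarith)
    rw [h1, deriv_add_const, deriv_sub_const, (hφtest k).fracLap_eq hN hσ x₀ ht₀'] at h2
    exact h2
  have hlim : Tendsto (fun k => levyOp σ (fun x => φ k x t₀) x₀) atTop (𝓝 (levyOp σ w x₀)) := by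
    refine Tendsto.const_mul _ (tendsto_integral_of_dominated_convergence
      (fun z => C * quadBump z * fracKernel σ z) (fun k => ?_) ?_ (fun k => ?_) ?_)
    · exact (integrable_mul_fracKernel hN hσ (measurable_secondDiff (hφm k) x₀) hC0
        (hsd k)).aestronglyMeasurable
    · refine integrable_mul_fracKernel hN hσ
        (contDiff_quadBump.continuous.const_mul C).measurable hC0 fun z => ?_
      rw [abs_of_nonneg (mul_nonneg hC0 (quadBump_nonneg z))]
    · refine Eventually.of_forall fun z => ?_
      rw [norm_mul, Real.norm_of_nonneg (fracKernel_nonneg hσ.1 z)]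
      exact mul_le_mul_of_nonneg_right (hsd k z) (fracKernel_nonneg hσ.1 z)
    · exact Eventually.of_forall fun z => (hsdlim z).mul_const _
  exact le_of_tendsto ((((hF.tendsto _).comp hlim).const_sub (deriv (Φ x₀) t₀)))
    (Eventually.of_forall hineq)

end
end ThetaScheme

/-! ### The comparison principle -/

namespace ThetaScheme
noncomputable section
variable {N : ℕ} {σ T LF : ℝ} {F : ℝ → ℝ}
  {f : Space N → ℝ → ℝ} {u₀ : Space N → ℝ} {u v : Space N → ℝ → ℝ}

lemma cutoff_mul_sq_le (χ : ContDiffBump (0 : Space N)) (hχ : χ.rOut ≤ 1) (z : Space N) :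
    |χ z * ‖z‖ ^ 2| ≤ 2 * quadBump z := by
  have hq := quadBump_nonneg z
  rw [abs_of_nonneg (mul_nonneg χ.nonneg (sq_nonneg _))]
  rcases le_or_gt ‖z‖ 1 with hz | hz
  · have h1 : ‖z‖ ^ 2 ≤ 1 := pow_le_one₀ (norm_nonneg _) hz
    have h2 : ‖z‖ ^ 2 ≤ 2 * quadBump z := by
      rw [quadBump, ← mul_div_assoc, le_div_iff₀ (by positivity)]
      nlinarith [sq_nonneg ‖z‖]
    exact (mul_le_of_le_one_left (sq_nonneg _) χ.le_one).trans h2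
  · rw [χ.zero_of_le_dist (by rw [dist_zero_right]; linarith)]
    linarith

lemma integrable_cutoff_mul_sq (hN : 0 < N) (hσ : σ ∈ Ioo (0 : ℝ) 2)
    (χ : ContDiffBump (0 : Space N)) (hχ : χ.rOut ≤ 1) :
    Integrable fun z : Space N => χ z * ‖z‖ ^ 2 * fracKernel σ z :=
  integrable_mul_fracKernel hN hσ (χ.continuous.mul (continuous_norm.pow 2)).measurable
    zero_le_two (cutoff_mul_sq_le χ hχ)

/-- Cutoffs with shrinking supports. -/
def shrinkingBump (N n : ℕ) : ContDiffBump (0 : Space N) where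
  rIn := 1 / ((n : ℝ) + 1) / 2
  rOut := 1 / ((n : ℝ) + 1)
  rIn_pos := by positivity
  rIn_lt_rOut := half_lt_self (by positivity)

lemma shrinkingBump_rOut_le (N n : ℕ) : (shrinkingBump N n).rOut ≤ 1 := by
  change 1 / ((n : ℝ) + 1) ≤ 1
  rw [div_le_one (by positivity)]
  linarith [(Nat.cast_nonneg n : (0 : ℝ) ≤ n)]

/-- A function of order |z|² near the origin is integrable against the kernel since σ < 2, so its
integral over shrinking balls vanishes. This defeats the factor 1/ε in the doubling argument. -/
lemma tendsto_integral_shrinkingBump (hN : 0 < N) (hσ : σ ∈ Ioo (0 : ℝ) 2) :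
    Tendsto (fun n => ∫ z : Space N, shrinkingBump N n z * ‖z‖ ^ 2 * fracKernel σ z) atTop
      (𝓝 0) := by
  have h0 : (0 : ℝ) = ∫ _ : Space N, (0 : ℝ) := by simp
  rw [h0]
  refine tendsto_integral_of_dominated_convergence (fun z => 2 * quadBump z * fracKernel σ z)
    (fun n => (integrable_cutoff_mul_sq hN hσ _ (shrinkingBump_rOut_le N n)).aestronglyMeasurable)
    ?_ (fun n => Eventually.of_forall fun z => ?_) (Eventually.of_forall fun z => ?_)
  · refine integrable_mul_fracKernel hN hσ
      (contDiff_quadBump.continuous.const_mul 2).measurable zero_le_two fun z => ?_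
    rw [abs_of_nonneg (mul_nonneg zero_le_two (quadBump_nonneg z))]
  · rw [norm_mul, Real.norm_of_nonneg (fracKernel_nonneg hσ.1 z)]
    exact mul_le_mul_of_nonneg_right (cutoff_mul_sq_le _ (shrinkingBump_rOut_le N n) z)
      (fracKernel_nonneg hσ.1 z)
  · rcases eq_or_ne z 0 with rfl | hz
    · simp
    · refine tendsto_const_nhds.congr' ?_
      filter_upwards [(tendsto_one_div_add_atTop_nhds_zero_nat (𝕜 := ℝ)).eventually_lt_const
        (norm_pos_iff.mpr hz)] with n hn
      rw [(shrinkingBump N n).zero_of_le_dist (by rw [dist_zero_right]; exact hn.le)]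
      simp

/-! ### Doubling of variables -/

/-- The penalization in the doubling of variables. -/
def doublePen (ε R C η : ℝ) (x : Space N) (t : ℝ) (y : Space N) (s : ℝ) : ℝ :=
  (‖x - y‖ ^ 2 + (t - s) ^ 2) / (2 * ε) + C * quadBump (R⁻¹ • x) + η * t

/-- On the part weighted by χ the two quadratics increase by |z|²/ε in total, their inner products
with x - y cancelling. On the part weighted by 1 - χ, maximality is applied to the pair (x+z, y+z),
whose difference is unchanged, so only the bump contributes. -/
lemma glue_increment_le {ε R C η : ℝ} (hε : 0 < ε) {x y : Space N} {t s : ℝ}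
    (ht : t ∈ Icc (0 : ℝ) T) (hs : s ∈ Icc (0 : ℝ) T)
    (hmax : ∀ x', ∀ t' ∈ Icc (0 : ℝ) T, ∀ y', ∀ s' ∈ Icc (0 : ℝ) T,
      u x' t' + v y' s' - doublePen ε R C η x' t' y' s' ≤ u x t + v y s - doublePen ε R C η x t y s)
    (χ : ContDiffBump (0 : Space N)) (z : Space N) :
    (glue χ (fun x' => doublePen ε R C η x' t y s - doublePen ε R C η x t y s + u x t)
        (fun x' => u x' t) x (x + z) - u x t) +
      (glue χ (fun y' => (‖x - y'‖ ^ 2 + (t - s) ^ 2) / (2 * ε) -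
        (‖x - y‖ ^ 2 + (t - s) ^ 2) / (2 * ε) + v y s) (fun y' => v y' s) y (y + z) - v y s) ≤
      χ z * ‖z‖ ^ 2 / ε + C * (quadBump (R⁻¹ • (x + z)) - quadBump (R⁻¹ • x)) := by
  have h1 := hmax (x + z) t ht (y + z) s hs
  have h2 := mul_le_mul_of_nonneg_left h1 (sub_nonneg.mpr (χ.le_one (x := z)))
  have e1 := norm_add_sq_real (x - y) z
  have e2 := norm_sub_sq_real (x - y) z
  have e3 : x + z - y = x - y + z := by abel
  have e4 : x - (y + z) = x - y - z := by abel
  have e5 : x + z - (y + z) = x - y := by abel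
  simp only [glue, doublePen, add_sub_cancel_left, e3, e4, e5] at h2 ⊢
  rw [e1, e2]
  rw [mul_sub, mul_sub] at h2
  have e6 : χ z * ‖z‖ ^ 2 / ε = χ z * (‖z‖ ^ 2 / (2 * ε) + ‖z‖ ^ 2 / (2 * ε)) := by
    field_simp; ring
  rw [e6]
  simp only [add_div, sub_div]
  linarith

/-- In the sum of the two viscosity inequalities the time derivatives ±(t-s)/ε cancel and leave η.
Monotonicity and the Lipschitz bound of F reduce the rest to an upper bound for the sum of the two
nonlocal terms. -/
lemma doubling_inequality (hN : 0 < N) (hσ : σ ∈ Ioo (0 : ℝ) 2) (hF : OneSidedLipschitz F LF)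
    (hu : IsViscositySubsolution σ T F f u₀ u)
    (hv : IsViscositySubsolution σ T (fun l => -F (-l)) (fun x t => -f x t) (fun x => -u₀ x) v)
    {ε R C η : ℝ} (hε : 0 < ε) (hR : 1 ≤ R) (hC : 0 ≤ C) {x y : Space N} {t s : ℝ}
    (ht : t ∈ Ioc (0 : ℝ) T) (hs : s ∈ Ioc (0 : ℝ) T)
    (hmax : ∀ x', ∀ t' ∈ Icc (0 : ℝ) T, ∀ y', ∀ s' ∈ Icc (0 : ℝ) T,
      u x' t' + v y' s' - doublePen ε R C η x' t' y' s' ≤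
        u x t + v y s - doublePen ε R C η x t y s) :
    η ≤ LF * (2 * C * ∫ z : Space N, quadBump (R⁻¹ • z) * fracKernel σ z) + (f x t - f y s) := by
  have ht' : t ∈ Icc (0 : ℝ) T := Ioc_subset_Icc_self ht
  have hs' : s ∈ Icc (0 : ℝ) T := Ioc_subset_Icc_self hs
  set J := ∫ z : Space N, quadBump (R⁻¹ • z) * fracKernel σ z with hJ
  have hJint := integrable_scaled_quadBump (N := N) hN hσ hR
  have hbumpc : ContDiff ℝ 2 (fun p : Space N × ℝ => quadBump (R⁻¹ • p.1)) :=
    contDiff_quadBump.comp (contDiff_fst.const_smul R⁻¹)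
  have hΦ1 : ContDiff ℝ 2 (Function.uncurry fun x' t' => doublePen ε R C η x' t' y s) := by
    have h1 : ContDiff ℝ 2 (fun p : Space N × ℝ => ‖p.1 - y‖ ^ 2) :=
      (contDiff_norm_sq ℝ).comp (contDiff_fst.sub contDiff_const)
    have h2 : ContDiff ℝ 2 (fun p : Space N × ℝ => (p.2 - s) ^ 2) :=
      (contDiff_snd.sub contDiff_const).pow 2
    exact (((h1.add h2).div_const _).add (contDiff_const.mul hbumpc)).add
      (contDiff_const.mul contDiff_snd)
  have hΦ2 : ContDiff ℝ 2 (Function.uncurry fun y' s' =>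
      (‖x - y'‖ ^ 2 + (t - s') ^ 2) / (2 * ε)) := by
    have h1 : ContDiff ℝ 2 (fun p : Space N × ℝ => ‖x - p.1‖ ^ 2) :=
      (contDiff_norm_sq ℝ).comp (contDiff_const.sub contDiff_fst)
    have h2 : ContDiff ℝ 2 (fun p : Space N × ℝ => (t - p.2) ^ 2) :=
      (contDiff_const.sub contDiff_snd).pow 2
    exact (h1.add h2).div_const _
  have hd1 : HasDerivAt (doublePen ε R C η x · y s) ((t - s) / ε + η) t := by
    have h1 : HasDerivAt (fun t' : ℝ => (t' - s) ^ 2) (2 * (t - s)) t := by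
      simpa using ((hasDerivAt_id' t).sub_const s).fun_pow 2
    have h2 := (((h1.const_add (‖x - y‖ ^ 2)).div_const (2 * ε)).add_const
      (C * quadBump (R⁻¹ • x))).add ((hasDerivAt_id' t).const_mul η)
    exact h2.congr_deriv (by field_simp)
  have hd2 : HasDerivAt (fun s' => (‖x - y‖ ^ 2 + (t - s') ^ 2) / (2 * ε)) (-((t - s) / ε)) s := by
    have h1 : HasDerivAt (fun s' : ℝ => (t - s') ^ 2) (-(2 * (t - s))) s := by
      simpa using ((hasDerivAt_id' s).const_sub t).fun_pow 2
    have h2 := (h1.const_add (‖x - y‖ ^ 2)).div_const (2 * ε)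
    exact h2.congr_deriv (by field_simp)
  -- The bump and the η-term depend only on the first pair of variables and drop out of the test
  -- function for v.
  have hcancel : ∀ {k a b p q c d : ℝ}, k + a - (p + c + d) ≤ k + b - (q + c + d) →
      a - p ≤ b - q := fun h => by linarith
  have hkey : ∀ n, η ≤ LF * ((1 / ε) * (∫ z : Space N, shrinkingBump N n z * ‖z‖ ^ 2 *
      fracKernel σ z) + 2 * C * J) + (f x t - f y s) := by
    intro n
    set χ := shrinkingBump N n
    obtain ⟨w₁, hw₁, hm₁, ⟨K₁, hK₁, hs₁⟩, hi₁⟩ := hu.test_glue hN hσ hF.continuous hΦ1 ht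
      (fun x' t' ht1 => by linarith [hmax x' t' ht1 y s hs']) χ
    obtain ⟨w₂, hw₂, hm₂, ⟨K₂, hK₂, hs₂⟩, hi₂⟩ := hv.test_glue hN hσ
      hF.reflect.continuous hΦ2 hs
      (fun y' s' hs1 => hcancel (hmax x t ht' y' s' hs1)) χ
    rw [hd1.deriv] at hi₁
    rw [hd2.deriv] at hi₂
    have hwx : w₁ x = u x t := by rw [hw₁]; simp only [glue]; ring
    have hwy : w₂ y = v y s := by rw [hw₂]; simp only [glue]; ring
    have hinc : ∀ z, (w₁ (x + z) - w₁ x) + (w₂ (y + z) - w₂ y) ≤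
        χ z * ‖z‖ ^ 2 / ε + C * (quadBump (R⁻¹ • (x + z)) - quadBump (R⁻¹ • x)) := by
      intro z
      rw [hwx, hwy, hw₁, hw₂]
      exact glue_increment_le hε ht' hs' hmax χ z
    have hpt : ∀ z, secondDiff w₁ x z + secondDiff w₂ y z ≤
        2 / ε * (χ z * ‖z‖ ^ 2) + 4 * C * quadBump (R⁻¹ • z) := by
      intro z
      have e1 := hinc z
      have e2 := hinc (-z)
      have e3 := mul_le_mul_of_nonneg_left (secondDiff_scaled_quadBump_le R 0 x z) hC
      rw [χ.neg, norm_neg, ← sub_eq_add_neg, ← sub_eq_add_neg] at e2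
      simp only [secondDiff, sub_zero] at e3 ⊢
      have e4 : 2 / ε * (χ z * ‖z‖ ^ 2) = χ z * ‖z‖ ^ 2 / ε + χ z * ‖z‖ ^ 2 / ε := by ring
      rw [e4]
      linarith
    have hχint := integrable_cutoff_mul_sq hN hσ χ (shrinkingBump_rOut_le N n)
    have hi1 := integrable_mul_fracKernel hN hσ (measurable_secondDiff hm₁ x) hK₁ hs₁
    have hi2 := integrable_mul_fracKernel hN hσ (measurable_secondDiff hm₂ y) hK₂ hs₂
    have hsum : levyOp σ w₁ x + levyOp σ w₂ y ≤
        (1 / ε) * (∫ z : Space N, χ z * ‖z‖ ^ 2 * fracKernel σ z) + 2 * C * J := by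
      have h1 : ∫ z, (secondDiff w₁ x z * fracKernel σ z + secondDiff w₂ y z * fracKernel σ z) ≤
          ∫ z, (2 / ε * (χ z * ‖z‖ ^ 2 * fracKernel σ z) +
            4 * C * (quadBump (R⁻¹ • z) * fracKernel σ z)) := by
        refine integral_mono (hi1.add hi2) ((hχint.const_mul _).add (hJint.const_mul _)) fun z => ?_
        have := mul_le_mul_of_nonneg_right (hpt z) (fracKernel_nonneg hσ.1 z)
        dsimp only
        linarith
      rw [integral_add hi1 hi2, integral_add (hχint.const_mul _) (hJint.const_mul _),
        integral_const_mul, integral_const_mul, ← hJ] at h1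
      rw [levyOp, levyOp]
      have e1 : 2 / ε * ∫ z : Space N, χ z * ‖z‖ ^ 2 * fracKernel σ z =
        2 * ((1 / ε) * ∫ z : Space N, χ z * ‖z‖ ^ 2 * fracKernel σ z) := by ring
      rw [e1] at h1
      linarith
    have hnn : 0 ≤ (1 / ε) * (∫ z : Space N, χ z * ‖z‖ ^ 2 * fracKernel σ z) + 2 * C * J := by
      have h1 : 0 ≤ ∫ z : Space N, χ z * ‖z‖ ^ 2 * fracKernel σ z := integral_nonneg fun z =>
        mul_nonneg (mul_nonneg χ.nonneg (sq_nonneg _)) (fracKernel_nonneg hσ.1 z)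
      have h2 : 0 ≤ J := integral_nonneg fun z =>
        mul_nonneg (quadBump_nonneg _) (fracKernel_nonneg hσ.1 z)
      positivity
    have h3 := hF (levyOp σ w₁ x) (-levyOp σ w₂ y)
    have h4 : LF * max 0 (levyOp σ w₁ x - -levyOp σ w₂ y) ≤
        LF * ((1 / ε) * (∫ z : Space N, χ z * ‖z‖ ^ 2 * fracKernel σ z) + 2 * C * J) :=
      mul_le_mul_of_nonneg_left (max_le hnn (by rwa [sub_neg_eq_add])) hF.nonneg
    refine le_trans ?_ (add_le_add (h3.trans h4) le_rfl)
    linarith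
  -- The gluing region shrinks while ε stays fixed, so the term carrying 1/ε disappears.
  have hlim := ((((tendsto_integral_shrinkingBump (N := N) hN hσ).const_mul (1 / ε)).add_const
    (2 * C * J)).const_mul LF).add_const (f x t - f y s)
  rw [mul_zero, zero_add] at hlim
  exact ge_of_tendsto hlim (Eventually.of_forall hkey)

/-- The doubled difference attains its maximum. -/
lemma exists_doubled_max (hu : IsViscositySubsolution σ T F f u₀ u) {F' : ℝ → ℝ}
    {f' : Space N → ℝ → ℝ} {v₀ : Space N → ℝ} (hv : IsViscositySubsolution σ T F' f' v₀ v)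
    {A : ℝ} (hA : 0 ≤ A)
    (hbd : ∀ x, ∀ t ∈ Icc (0 : ℝ) T, ∀ y, ∀ s ∈ Icc (0 : ℝ) T, u x t + v y s ≤ A)
    {ε R η : ℝ} (hε : 0 < ε) (hR : 0 < R) (hη : 0 ≤ η) {x₁ : Space N} {t₁ : ℝ}
    (ht₁ : t₁ ∈ Icc (0 : ℝ) T)
    (hpos : 0 < u x₁ t₁ + v x₁ t₁ - doublePen ε R (2 * A) η x₁ t₁ x₁ t₁) :
    ∃ x ∈ Metric.closedBall (0 : Space N) R, ∃ t ∈ Icc (0 : ℝ) T, ∃ y, ∃ s ∈ Icc (0 : ℝ) T,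
      ∀ x', ∀ t' ∈ Icc (0 : ℝ) T, ∀ y', ∀ s' ∈ Icc (0 : ℝ) T,
        u x' t' + v y' s' - doublePen ε R (2 * A) η x' t' y' s' ≤
          u x t + v y s - doublePen ε R (2 * A) η x t y s := by
  set Ψ : (Space N × ℝ) × (Space N × ℝ) → ℝ := fun q =>
    u q.1.1 q.1.2 + v q.2.1 q.2.2 - doublePen ε R (2 * A) η q.1.1 q.1.2 q.2.1 q.2.2 with hΨ
  -- If |x| ≤ R and |y| > ρ, then |x - y| ≥ 2εA + 1 and the quadratic penalty exceeds A. If |x| > R,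
  -- the bump with coefficient 2A contributes at least A. Either way the functional is nonpositive
  -- outside K.
  set ρ := R + (2 * ε * A + 1) with hρ
  set K : Set ((Space N × ℝ) × (Space N × ℝ)) :=
    (Metric.closedBall (0 : Space N) R ×ˢ Icc (0 : ℝ) T) ×ˢ
      (Metric.closedBall (0 : Space N) ρ ×ˢ Icc (0 : ℝ) T) with hK
  have hKc : IsCompact K := ((isCompact_closedBall _ _).prod isCompact_Icc).prod
    ((isCompact_closedBall _ _).prod isCompact_Icc)
  have hout : ∀ x, ∀ t ∈ Icc (0 : ℝ) T, ∀ y, ∀ s ∈ Icc (0 : ℝ) T,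
      ((x, t), (y, s)) ∉ K → Ψ ((x, t), (y, s)) ≤ 0 := by
    intro x t ht y s hs hnot
    have h1 := hbd x t ht y s hs
    have h2 : 0 ≤ η * t := mul_nonneg hη ht.1
    have h3 : 0 ≤ (t - s) ^ 2 := sq_nonneg _
    have h4 := quadBump_nonneg (R⁻¹ • x)
    have h5 : 0 ≤ 2 * A * quadBump (R⁻¹ • x) := by positivity
    simp only [hΨ, doublePen]
    rcases le_or_gt ‖x‖ R with hx | hx
    · have hy : ρ < ‖y‖ := by
        by_contra hy
        exact hnot ⟨⟨by simpa using hx, ht⟩, ⟨by simpa using not_lt.mp hy, hs⟩⟩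
      have h6 : 2 * ε * A + 1 ≤ ‖x - y‖ := by
        have := norm_sub_norm_le y x
        rw [norm_sub_rev] at this
        linarith
      have h7 : A ≤ (‖x - y‖ ^ 2 + (t - s) ^ 2) / (2 * ε) := by
        rw [le_div_iff₀ (by positivity)]
        have h8 : 0 ≤ 2 * ε * A := by positivity
        nlinarith
      linarith
    · have h6 : (1 : ℝ) ≤ ‖R⁻¹ • x‖ := by
        rw [norm_smul, norm_inv, Real.norm_of_nonneg hR.le, inv_mul_eq_div, one_le_div hR]
        exact hx.le
      have h7 := quadBump_lower zero_le_one h6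
      norm_num at h7
      have h8 : 2 * A * (1 / 2) ≤ 2 * A * quadBump (R⁻¹ • x) :=
        mul_le_mul_of_nonneg_left h7 (by positivity)
      have h9 : 0 ≤ (‖x - y‖ ^ 2 + (t - s) ^ 2) / (2 * ε) := by positivity
      linarith
  have h₁ : ((x₁, t₁), (x₁, t₁)) ∈ K := by
    by_contra hnot
    exact absurd (hout x₁ t₁ ht₁ x₁ t₁ ht₁ hnot) (not_le.mpr hpos)
  have husc : UpperSemicontinuousOn Ψ K := by
    have h1 : UpperSemicontinuousOn (fun q : (Space N × ℝ) × (Space N × ℝ) => u q.1.1 q.1.2) K :=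
      hu.usc.comp (g := Prod.fst) (by fun_prop) fun q hq => ⟨mem_univ _, hq.1.2⟩
    have h2 : UpperSemicontinuousOn (fun q : (Space N × ℝ) × (Space N × ℝ) => v q.2.1 q.2.2) K :=
      hv.usc.comp (g := Prod.snd) (by fun_prop) fun q hq => ⟨mem_univ _, hq.2.2⟩
    have h3 : Continuous (fun q : (Space N × ℝ) × (Space N × ℝ) =>
        -doublePen ε R (2 * A) η q.1.1 q.1.2 q.2.1 q.2.2) := by
      have := (contDiff_quadBump (V := Space N)).continuous
      unfold doublePen
      fun_prop
    have h4 := (h1.add h2).add h3.continuousOn.upperSemicontinuousOn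
    exact h4
  obtain ⟨⟨⟨x, t⟩, ⟨y, s⟩⟩, hmem, hmax⟩ := husc.exists_isMaxOn ⟨_, h₁⟩ hKc
  refine ⟨x, hmem.1.1, t, hmem.1.2, y, s, hmem.2.2, fun x' t' ht' y' s' hs' => ?_⟩
  by_cases hin : ((x', t'), (y', s')) ∈ K
  · exact hmax hin
  · exact (hout x' t' ht' y' s' hs' hin).trans (hpos.le.trans (hmax h₁))

/-- Comparison, stated for two subsolutions of reflected problems. -/
theorem IsViscositySubsolution.add_nonpos (hN : 0 < N) (hσ : σ ∈ Ioo (0 : ℝ) 2)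
    (hF : OneSidedLipschitz F LF)
    (hfc : ContinuousOn (Function.uncurry f) (univ ×ˢ Ioc (0 : ℝ) T))
    (hu : IsViscositySubsolution σ T F f u₀ u)
    (hv : IsViscositySubsolution σ T (fun l => -F (-l)) (fun x t => -f x t) (fun x => -u₀ x) v)
    (x₁ : Space N) {t₁ : ℝ} (ht₁ : t₁ ∈ Icc (0 : ℝ) T) : u x₁ t₁ + v x₁ t₁ ≤ 0 := by
  by_contra! ha
  set a := u x₁ t₁ + v x₁ t₁ with ha_def
  have hT : 0 ≤ T := ht₁.1.trans ht₁.2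
  obtain ⟨B, hB⟩ := hu.bounded
  obtain ⟨B', hB'⟩ := hv.bounded
  set A := B + B' with hA_def
  have hbd : ∀ x, ∀ t ∈ Icc (0 : ℝ) T, ∀ y, ∀ s ∈ Icc (0 : ℝ) T, u x t + v y s ≤ A :=
    fun x t ht y s hs => add_le_add (abs_le.mp (hB x t ht)).2 (abs_le.mp (hB' y s hs)).2
  have hA : 0 ≤ A := ha.le.trans (hbd x₁ t₁ ht₁ x₁ t₁ ht₁)
  -- The time term costs at most a/4 at t₁, and so will the bump, leaving a/2 at the base point.
  set η := a / (4 * (T + 1)) with hη_def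
  have hη : 0 < η := by positivity
  have hηt : η * t₁ ≤ a / 4 := by
    rw [hη_def, div_mul_eq_mul_div, div_le_div_iff₀ (by positivity) (by positivity)]
    nlinarith [ht₁.2]
  -- R is fixed before ε → 0. The maximum points then remain in a compact set, so continuity of f at
  -- one limit point suffices and uniform continuity is not needed.
  obtain ⟨R, hR1, hR2, hR3⟩ : ∃ R : ℝ, 1 ≤ R ∧ 2 * A * quadBump (R⁻¹ • x₁) < a / 4 ∧
      LF * (2 * (2 * A) * ∫ z : Space N, quadBump (R⁻¹ • z) * fracKernel σ z) < η / 2 := by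
    have h1 : Tendsto (fun R : ℝ => 2 * A * quadBump (R⁻¹ • x₁)) atTop (𝓝 0) := by
      have e1 : Tendsto (fun R : ℝ => R⁻¹ • x₁) atTop (𝓝 0) := by
        simpa using (tendsto_inv_atTop_zero (𝕜 := ℝ)).smul_const x₁
      have e2 := (contDiff_quadBump.continuous.tendsto (0 : Space N)).comp e1
      rw [quadBump_zero] at e2
      simpa using e2.const_mul (2 * A)
    have h2 := ((tendsto_integral_scaled_quadBump (N := N) hN hσ).const_mul (2 * (2 * A))).const_mul
      LF
    rw [mul_zero, mul_zero] at h2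
    exact ((eventually_ge_atTop 1).and ((h1.eventually_lt_const (u := a / 4) (by positivity)).and
      (h2.eventually_lt_const (u := η / 2) (by positivity)))).exists
  have hR0 : 0 < R := by linarith
  set ε : ℕ → ℝ := fun n => 1 / ((n : ℝ) + 1) with hε_def
  have hε : ∀ n, 0 < ε n := fun n => by simp only [hε_def]; positivity
  have hval : ∀ n, a / 2 ≤
      u x₁ t₁ + v x₁ t₁ - doublePen (ε n) R (2 * A) η x₁ t₁ x₁ t₁ := by
    intro n
    simp only [doublePen, sub_self, norm_zero]
    norm_num
    linarith
  have hex := fun n => exists_doubled_max hu hv hA hbd (hε n) hR0 hη.le ht₁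
    ((by positivity : 0 < a / 2).trans_le (hval n))
  choose x hx t ht y s hs hmax using hex
  have hlow : ∀ n, a / 2 ≤ u (x n) (t n) + v (y n) (s n) -
      doublePen (ε n) R (2 * A) η (x n) (t n) (y n) (s n) := fun n =>
    (hval n).trans (hmax n x₁ t₁ ht₁ x₁ t₁ ht₁)
  have hpen : ∀ n, (‖x n - y n‖ ^ 2 + (t n - s n) ^ 2) / (2 * ε n) ≤
      doublePen (ε n) R (2 * A) η (x n) (t n) (y n) (s n) := by
    intro n
    have h1 := quadBump_nonneg (R⁻¹ • x n)
    have h2 := mul_nonneg hη.le (ht n).1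
    have h3 : 0 ≤ 2 * A * quadBump (R⁻¹ • x n) := by positivity
    simp only [doublePen]
    linarith
  have hsum : ∀ n, a / 2 ≤ u (x n) (t n) + v (y n) (s n) := by
    intro n
    have h1 : 0 ≤ (‖x n - y n‖ ^ 2 + (t n - s n) ^ 2) / (2 * ε n) := by
      have := hε n
      positivity
    linarith [hlow n, hpen n]
  have hclose : ∀ n, ‖x n - y n‖ ^ 2 + (t n - s n) ^ 2 ≤ A * (2 * ε n) := by
    intro n
    rw [← div_le_iff₀ (by linarith [hε n])]
    linarith [hlow n, hpen n, hbd (x n) (t n) (ht n) (y n) (s n) (hs n)]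
  have hεlim : Tendsto (fun n => A * (2 * ε n)) atTop (𝓝 0) := by
    have := ((tendsto_one_div_add_atTop_nhds_zero_nat (𝕜 := ℝ)).const_mul 2).const_mul A
    rwa [mul_zero, mul_zero] at this
  have hxy : Tendsto (fun n => x n - y n) atTop (𝓝 0) := by
    have h1 : Tendsto (fun n => ‖x n - y n‖ ^ 2) atTop (𝓝 0) :=
      squeeze_zero (fun n => sq_nonneg _)
        (fun n => by linarith [hclose n, sq_nonneg (t n - s n)]) hεlim
    have h2 := h1.sqrt
    rw [Real.sqrt_zero] at h2
    exact tendsto_zero_iff_norm_tendsto_zero.mpr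
      (h2.congr fun n => Real.sqrt_sq (norm_nonneg _))
  have hts : Tendsto (fun n => t n - s n) atTop (𝓝 0) := by
    have h1 : Tendsto (fun n => (t n - s n) ^ 2) atTop (𝓝 0) :=
      squeeze_zero (fun n => sq_nonneg _)
        (fun n => by linarith [hclose n, sq_nonneg ‖x n - y n‖]) hεlim
    have h2 := h1.sqrt
    rw [Real.sqrt_zero] at h2
    exact tendsto_zero_iff_norm_tendsto_zero.mpr
      (h2.congr fun n => Real.sqrt_sq_eq_abs _)
  obtain ⟨⟨x', t'⟩, hxt, κ, hκ, hlim⟩ := ((isCompact_closedBall (0 : Space N) R).prod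
    (isCompact_Icc (a := (0 : ℝ)) (b := T))).tendsto_subseq (x := fun n => (x n, t n))
      fun n => ⟨hx n, ht n⟩
  have hxl : Tendsto (fun k => x (κ k)) atTop (𝓝 x') := (continuous_fst.tendsto _).comp hlim
  have htl : Tendsto (fun k => t (κ k)) atTop (𝓝 t') := (continuous_snd.tendsto _).comp hlim
  have hyl : Tendsto (fun k => y (κ k)) atTop (𝓝 x') := by
    simpa using hxl.sub (hxy.comp hκ.tendsto_atTop)
  have hsl : Tendsto (fun k => s (κ k)) atTop (𝓝 t') := by
    simpa using htl.sub (hts.comp hκ.tendsto_atTop)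
  have hmem : (x', t') ∈ slab N T := ⟨mem_univ _, hxt.2⟩
  have hw1 : Tendsto (fun k => (x (κ k), t (κ k))) atTop (𝓝[slab N T] (x', t')) :=
    tendsto_nhdsWithin_iff.mpr ⟨hxl.prodMk_nhds htl,
      Eventually.of_forall fun k => ⟨mem_univ _, ht _⟩⟩
  have hw2 : Tendsto (fun k => (y (κ k), s (κ k))) atTop (𝓝[slab N T] (x', t')) :=
    tendsto_nhdsWithin_iff.mpr ⟨hyl.prodMk_nhds hsl,
      Eventually.of_forall fun k => ⟨mem_univ _, hs _⟩⟩
  have hstar : a / 2 ≤ u x' t' + v x' t' := by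
    refine le_of_forall_pos_le_add fun δ hδ => ?_
    have h1 := hw1.eventually (hu.usc (x', t') hmem (u x' t' + δ / 2) (by
      simp only [Function.uncurry]; linarith))
    have h2 := hw2.eventually (hv.usc (x', t') hmem (v x' t' + δ / 2) (by
      simp only [Function.uncurry]; linarith))
    obtain ⟨k, h3, h4⟩ := (h1.and h2).exists
    simp only [Function.uncurry] at h3 h4
    linarith [hsum (κ k)]
  -- At t = 0 the initial conditions give u + v ≤ 0. Hence the maximum points are eventually at
  -- positive times, where the equation holds and f is continuous.
  have ht'pos : 0 < t' := by
    refine lt_of_le_of_ne hxt.2.1 fun h0 => ?_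
    have h1 := hu.initial x'
    have h2 := hv.initial x'
    rw [← h0] at hstar
    linarith
  have hIoc : ∀ {r : ℕ → ℝ}, (∀ k, r k ∈ Icc (0 : ℝ) T) → Tendsto r atTop (𝓝 t') →
      ∀ᶠ k in atTop, r k ∈ Ioc (0 : ℝ) T := fun hr hl =>
    (hl.eventually_const_lt ht'pos).mono fun k hk => ⟨hk, (hr k).2⟩
  have ht1 := hIoc (fun k => ht (κ k)) htl
  have hs1 := hIoc (fun k => hs (κ k)) hsl
  have hflim : ∀ {p : ℕ → Space N} {r : ℕ → ℝ}, Tendsto p atTop (𝓝 x') → Tendsto r atTop (𝓝 t') →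
      (∀ᶠ k in atTop, r k ∈ Ioc (0 : ℝ) T) → Tendsto (fun k => f (p k) (r k)) atTop (𝓝 (f x' t')) :=
    fun hp hr he => (hfc (x', t') ⟨mem_univ _, ht'pos, hxt.2.2⟩).tendsto.comp
      (tendsto_nhdsWithin_iff.mpr ⟨hp.prodMk_nhds hr, he.mono fun k hk => ⟨mem_univ _, hk⟩⟩)
  have hfinal := (hflim hxl htl ht1).sub (hflim hyl hsl hs1)
  rw [sub_self] at hfinal
  -- The bump uses up less than η/2, and the difference of the values of f tends to 0.
  have : η / 2 ≤ 0 := by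
    refine ge_of_tendsto hfinal ?_
    filter_upwards [ht1, hs1] with k hk1 hk2
    have := doubling_inequality hN hσ hF hu hv (hε (κ k)) hR1 (by positivity : 0 ≤ 2 * A) hk1 hk2
      (hmax (κ k))
    linarith
  linarith

end
end ThetaScheme

/-! ### Reflection, convergence and the existence of a solution -/

namespace ThetaScheme
noncomputable section
variable {N : ℕ} {σ θ T LF : ℝ} {F : ℝ → ℝ}
  {f : Space N → ℝ → ℝ} {u₀ : Space N → ℝ} {u v : Space N → ℝ → ℝ}

/-! ### Reflection -/

lemma IsTestFunction.neg {φ : Space N → ℝ → ℝ} (hφ : IsTestFunction T φ) :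
    IsTestFunction T fun x t => -φ x t :=
  ⟨hφ.1.neg, hφ.2.neg⟩

lemma IsTestFunction.fracLap_neg (hN : 0 < N) (hσ : σ ∈ Ioo (0 : ℝ) 2) {φ : Space N → ℝ → ℝ}
    (hφ : IsTestFunction T φ) (x : Space N) {t : ℝ} (ht : t ∈ Icc (0 : ℝ) T) :
    fracLap σ (fun y => -φ y t) x = -fracLap σ (fun y => φ y t) x := by
  rw [hφ.neg.fracLap_eq hN hσ x ht, hφ.fracLap_eq hN hσ x ht, levyOp, levyOp, ← mul_neg,
    ← integral_neg]
  congr 2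
  funext z
  simp only [secondDiff]
  ring

/-- The negative of a supersolution is a subsolution of the reflected problem. -/
lemma IsViscositySupersolution.reflect (hN : 0 < N) (hσ : σ ∈ Ioo (0 : ℝ) 2)
    (hu : IsViscositySupersolution σ T F f u₀ u) :
    IsViscositySubsolution σ T (fun l => -F (-l)) (fun x t => -f x t) (fun x => -u₀ x)
      (fun x t => -u x t) where
  usc p hp c hc := (hu.lsc p hp (-c) (by simp only [Function.uncurry] at hc ⊢; linarith)).mono
    fun q hq => by simp only [Function.uncurry] at hq ⊢; linarith
  bounded := hu.bounded.neg
  initial x := neg_le_neg (hu.initial x)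
  test φ hφ x t ht hmax := by
    have h1 := hu.test _ hφ.neg x t ht fun y s hs => by linarith [hmax y s hs]
    rw [hφ.fracLap_neg hN hσ x (Ioc_subset_Icc_self ht), deriv.fun_neg] at h1
    linarith

/-- A function that equals on the slab the negative of a subsolution of the reflected problem is a
supersolution. -/
lemma IsViscositySubsolution.reflect (hN : 0 < N) (hσ : σ ∈ Ioo (0 : ℝ) 2)
    (hv : IsViscositySubsolution σ T (fun l => -F (-l)) (fun x t => -f x t) (fun x => -u₀ x) v)
    (hT : 0 ≤ T) (huv : ∀ x, ∀ t ∈ Icc (0 : ℝ) T, u x t = -v x t) :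
    IsViscositySupersolution σ T F f u₀ u where
  lsc := by
    rintro ⟨x, t⟩ hp c hc
    have h1 := hv.usc (x, t) hp (-c) (by
      have := huv x t hp.2
      simp only [Function.uncurry] at hc ⊢
      linarith)
    filter_upwards [h1, self_mem_nhdsWithin] with q hq hq'
    have := huv q.1 q.2 hq'.2
    simp only [Function.uncurry] at hq ⊢
    linarith
  bounded := by
    obtain ⟨C, hC⟩ := hv.bounded
    exact ⟨C, fun x t ht => by rw [huv x t ht, abs_neg]; exact hC x t ht⟩
  initial x := by
    have h1 := hv.initial x
    rw [huv x 0 ⟨le_rfl, hT⟩]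
    linarith
  test φ hφ x t ht hmin := by
    have ht' := Ioc_subset_Icc_self ht
    have h1 := hv.test _ hφ.neg x t ht fun y s hs => by
      have := hmin y s hs
      rw [huv y s hs, huv x t ht'] at this
      linarith
    rw [hφ.fracLap_neg hN hσ x ht', neg_neg, deriv.fun_neg] at h1
    linarith

lemma IsViscositySolution.continuousOn (hu : IsViscositySolution σ T F f u₀ u) :
    ContinuousOn (Function.uncurry u) (slab N T) :=
  continuousOn_iff_lower_upperSemicontinuousOn.mpr ⟨hu.2.lsc, hu.1.usc⟩

/-! ### Convergence -/

section Sequences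
variable {h τ : ℕ → ℝ} {U : ℕ → Space N → ℝ → ℝ}

/-- The upper relaxed limit is never below the lower one. Comparison supplies the reverse
inequality, so the two agree. -/
lemma relaxedLimsup_add_nonneg {C : ℝ} (hC : ∀ n x, ∀ t ∈ Icc (0 : ℝ) T, |U n x t| ≤ C)
    (x : Space N) {t : ℝ} (ht : t ∈ Icc (0 : ℝ) T) :
    0 ≤ relaxedLimsup T U x t + relaxedLimsup T (fun n x t => -U n x t) x t := by
  by_contra! hlt
  obtain ⟨c, hc1, hc2⟩ := exists_between
    (show relaxedLimsup T U x t < -relaxedLimsup T (fun n x t => -U n x t) x t by linarith)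
  have hC' : ∀ n x, ∀ t ∈ Icc (0 : ℝ) T, |-U n x t| ≤ C := fun n x t ht => by
    rw [abs_neg]; exact hC n x t ht
  have h1 := eventually_lt_of_relaxedLimsup_lt hC hc1
  have h2 := eventually_lt_of_relaxedLimsup_lt hC' (lt_neg_of_lt_neg hc2)
  have := neBot_slab (x := x) ht
  obtain ⟨q, h3, h4⟩ := (h1.and h2).exists
  linarith

variable (hU : IsSchemeSeq σ θ T LF F f u₀ h τ U) (hN : 0 < N)
    (hσ : σ ∈ Ioo (0 : ℝ) 2) (hθ : θ ∈ Icc (0 : ℝ) 1) (hF : OneSidedLipschitz F LF) (hT : 0 ≤ T)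
    (hf : BoundedOnSlab T f) (hfc : ContinuousOn (Function.uncurry f) (univ ×ˢ Ioc (0 : ℝ) T))
    (hu₀ : IsBddFun u₀) (hu₀c : Continuous u₀)
include hU hN hσ hθ hF hT hf hfc hu₀ hu₀c

lemma IsSchemeSeq.isViscositySubsolution_neg :
    IsViscositySubsolution σ T (fun l => -F (-l)) (fun x t => -f x t) (fun x => -u₀ x)
      (relaxedLimsup T fun n x t => -U n x t) := by
  obtain ⟨A, hA⟩ := hu₀
  exact hU.reflect.isViscositySubsolution hN hσ hθ hF.reflect hT hf.neg hfc.neg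
    ⟨A, fun x => by rw [abs_neg]; exact hA x⟩ hu₀c.neg

/-- The half-relaxed limit of solutions of the scheme is a viscosity solution. -/
theorem IsSchemeSeq.isViscositySolution : IsViscositySolution σ T F f u₀ (relaxedLimsup T U) := by
  obtain ⟨C, hC⟩ := hU.exists_bound hσ hθ hF hT hf hu₀
  have h1 := hU.isViscositySubsolution hN hσ hθ hF hT hf hfc hu₀ hu₀c
  have h2 := hU.isViscositySubsolution_neg hN hσ hθ hF hT hf hfc hu₀ hu₀c
  refine ⟨h1, h2.reflect hN hσ hT fun x t ht => ?_⟩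
  have h3 := h1.add_nonpos hN hσ hF hfc h2 x ht
  have h4 := relaxedLimsup_add_nonneg hC x ht
  linarith

/-- Solutions of the scheme converge along converging sequences of points. -/
lemma IsSchemeSeq.tendsto (hu : IsViscositySolution σ T F f u₀ u) {ν : ℕ → ℕ}
    (hν : Tendsto ν atTop atTop) {y : ℕ → Space N} {s : ℕ → ℝ} {x : Space N} {t : ℝ}
    (hy : Tendsto y atTop (𝓝 x)) (hs : Tendsto s atTop (𝓝 t)) (hsT : ∀ k, s k ∈ Icc (0 : ℝ) T)
    (ht : t ∈ Icc (0 : ℝ) T) : Tendsto (fun k => U (ν k) (y k) (s k)) atTop (𝓝 (u x t)) := by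
  obtain ⟨C, hC⟩ := hU.exists_bound hσ hθ hF hT hf hu₀
  -- Comparison puts the upper relaxed limit below u and the lower one above u, which squeezes the
  -- values along every convergent sequence of points.
  have h1 := (hU.isViscositySubsolution hN hσ hθ hF hT hf hfc hu₀ hu₀c).add_nonpos hN hσ hF hfc
    (hu.2.reflect hN hσ) x ht
  have h2 := hu.1.add_nonpos hN hσ hF hfc
    (hU.isViscositySubsolution_neg hN hσ hθ hF hT hf hfc hu₀ hu₀c) x ht
  refine tendsto_order.mpr ⟨fun c hc => ?_, fun c hc => ?_⟩
  · refine (eventually_lt_of_tendsto (U := fun n x t => -U n x t) (c := -c) (C := C)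
      (fun n x t ht => by rw [abs_neg]; exact hC n x t ht) (by linarith) hν hy hs hsT).mono
      fun k hk => by linarith
  · exact eventually_lt_of_tendsto hC (by linarith) hν hy hs hsT

end Sequences

variable (hN : 0 < N) (hσ : σ ∈ Ioo (0 : ℝ) 2) (hθ : θ ∈ Icc (0 : ℝ) 1)
    (hF : OneSidedLipschitz F LF) (hT : 0 < T)
    (hf : BoundedOnSlab T f) (hfc : ContinuousOn (Function.uncurry f) (univ ×ˢ Ioc (0 : ℝ) T))
    (hu₀ : IsBddFun u₀) (hu₀c : Continuous u₀)
include hN hσ hθ hF hT hf hfc hu₀ hu₀c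

/-- The solution is constructed as the limit of the scheme itself: for each mesh size, M is taken
large enough to satisfy the CFL condition. -/
theorem exists_viscositySolution : ∃ u, IsViscositySolution σ T F f u₀ u := by
  set h : ℕ → ℝ := fun n => 1 / ((n : ℝ) + 1) with hh
  have hpos : ∀ n, 0 < h n := fun n => by simp only [hh]; positivity
  have hlim : Tendsto h atTop (𝓝 0) := tendsto_one_div_add_atTop_nhds_zero_nat
  have hex : ∀ n, ∃ M : ℕ, 0 < M ∧ T / M < h n ∧
      (1 - θ) * (T / M) * (LF * cflConst N σ) ≤ h n ^ σ := by
    intro n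
    have h1 : Tendsto (fun M : ℕ => T / (M : ℝ)) atTop (𝓝 0) :=
      tendsto_const_div_atTop_nhds_zero_nat T
    have h2 := (h1.const_mul (1 - θ)).mul_const (LF * cflConst N σ)
    rw [mul_zero, zero_mul] at h2
    obtain ⟨M, e1, e2, e3⟩ := ((eventually_gt_atTop 0).and ((h1.eventually_lt_const (hpos n)).and
      (h2.eventually_lt_const (Real.rpow_pos_of_pos (hpos n) σ)))).exists
    exact ⟨M, e1, e2, e3.le⟩
  choose M hM hMh hcfl using hex
  choose U hU using fun n => exists_spaceSolution hσ hT hθ hF hf hu₀ (h n) (hM n)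
  have hτ : ∀ n, 0 < T / M n := fun n => div_pos hT (by exact_mod_cast hM n)
  have hseq : IsSchemeSeq σ θ T LF F f u₀ h (fun n => T / M n) U :=
    ⟨hpos, hlim, hτ, squeeze_zero (fun n => (hτ n).le) (fun n => (hMh n).le) hlim,
      fun n => cfl_jumpRate hσ (hpos n) (hcfl n), hU⟩
  exact ⟨_, hseq.isViscositySolution hN hσ hθ hF hT.le hf hfc hu₀ hu₀c⟩

/-- Convergence of the scheme on the whole space, uniformly on bounded sets. -/
theorem spaceSolution_tendsto (hu : IsViscositySolution σ T F f u₀ u) (R : ℝ) {ε : ℝ}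
    (hε : 0 < ε) : ∃ δ : ℝ, 0 < δ ∧ ∀ h : ℝ, 0 < h → h < δ → ∀ M : ℕ, 0 < M → T / M < δ →
      (1 - θ) * (T / M) * (LF * cflConst N σ) ≤ h ^ σ →
        ∀ U, IsSpaceSolution σ θ T F f u₀ h (T / M) U →
          ∀ x, ‖x‖ ≤ R → ∀ t ∈ Icc (0 : ℝ) T, |U x t - u x t| ≤ ε := by
  -- Failure for every δ yields a sequence of bad discretizations and bad points in a compact set.
  -- Along a convergent subsequence the scheme and the continuous limit u have the same limit, a
  -- contradiction.
  by_contra! hcon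
  choose h hpos hlt M hM hMlt hcfl U hU x hx t ht hbad using
    fun n : ℕ => hcon (1 / ((n : ℝ) + 1)) (by positivity)
  have hlim := tendsto_one_div_add_atTop_nhds_zero_nat (𝕜 := ℝ)
  have hτ : ∀ n, 0 < T / M n := fun n => div_pos hT (by exact_mod_cast hM n)
  have hseq : IsSchemeSeq σ θ T LF F f u₀ h (fun n => T / M n) U :=
    ⟨hpos, squeeze_zero (fun n => (hpos n).le) (fun n => (hlt n).le) hlim, hτ,
      squeeze_zero (fun n => (hτ n).le) (fun n => (hMlt n).le) hlim,
      fun n => cfl_jumpRate hσ (hpos n) (hcfl n), hU⟩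
  obtain ⟨⟨x', t'⟩, hxt, κ, hκ, hκlim⟩ := ((isCompact_closedBall (0 : Space N) R).prod
    (isCompact_Icc (a := (0 : ℝ)) (b := T))).tendsto_subseq (x := fun n => (x n, t n))
      fun n => ⟨by simpa using hx n, ht n⟩
  have hxl : Tendsto (fun k => x (κ k)) atTop (𝓝 x') := (continuous_fst.tendsto _).comp hκlim
  have htl : Tendsto (fun k => t (κ k)) atTop (𝓝 t') := (continuous_snd.tendsto _).comp hκlim
  have h1 := hseq.tendsto hN hσ hθ hF hT.le hf hfc hu₀ hu₀c hu hκ.tendsto_atTop hxl htl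
    (fun k => ht (κ k)) hxt.2
  have h2 : Tendsto (fun k => u (x (κ k)) (t (κ k))) atTop (𝓝 (u x' t')) :=
    (hu.continuousOn (x', t') ⟨mem_univ _, hxt.2⟩).tendsto.comp
      (tendsto_nhdsWithin_iff.mpr ⟨hxl.prodMk_nhds htl,
        Eventually.of_forall fun k => ⟨mem_univ _, ht _⟩⟩)
  have h3 := (h1.sub h2).abs
  rw [sub_self, abs_zero] at h3
  obtain ⟨k, hk⟩ := (h3.eventually_lt_const hε).exists
  exact absurd hk (not_lt.mpr (hbad (κ k)).le)

end
end ThetaScheme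

/-! ### Assembly -/

theorem mainTheorem8
    (N : ℕ) (hN : 0 < N) (σ : ℝ) (hσ : σ ∈ Set.Ioo (0 : ℝ) 2) (T : ℝ) (hT : 0 < T)
    (θ : ℝ) (hθ : θ ∈ Set.Icc (0 : ℝ) 1)
    -- (A1)
    (F : ℝ → ℝ) (LF : ℝ) (hF : ∀ l₁ l₂ : ℝ, F l₁ - F l₂ ≤ LF * max 0 (l₁ - l₂))
    -- (A2)
    (f : EuclideanSpace ℝ (Fin N) → ℝ → ℝ)
    (hf_cont : ContinuousOn (Function.uncurry f) (Set.univ ×ˢ Set.Ioc (0 : ℝ) T))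
    (hf_bdd : ThetaScheme.BoundedOnSlab T f)
    (u₀ : EuclideanSpace ℝ (Fin N) → ℝ) (hu₀_cont : Continuous u₀)
    (hu₀_bdd : ∃ C : ℝ, ∀ x, |u₀ x| ≤ C) :
    -- existence and uniqueness for the scheme on the grid
    (∀ h : ℝ, 0 < h → ∀ M : ℕ, 0 < M →
      ∃ U : ℕ → (Fin N → ℤ) → ℝ,
        ThetaScheme.IsGridSolution σ θ F f u₀ h (T / M) M U ∧
        ∀ V : ℕ → (Fin N → ℤ) → ℝ, ThetaScheme.IsGridSolution σ θ F f u₀ h (T / M) M V →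
          ∀ n ≤ M, ∀ i, V n i = U n i) ∧
    -- existence and uniqueness for the scheme on the whole space
    (∀ h : ℝ, 0 < h → ∀ M : ℕ, 0 < M →
      ∃ U : EuclideanSpace ℝ (Fin N) → ℝ → ℝ,
        ThetaScheme.IsSpaceSolution σ θ T F f u₀ h (T / M) U ∧
        ∀ V : EuclideanSpace ℝ (Fin N) → ℝ → ℝ,
          ThetaScheme.IsSpaceSolution σ θ T F f u₀ h (T / M) V →
            ∀ x, ∀ t ∈ Set.Icc (0 : ℝ) T, V x t = U x t) ∧
    -- there is a viscosity solution
    (∃ u, ThetaScheme.IsViscositySolution σ T F f u₀ u) ∧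
    -- the scheme converges to it, uniformly on bounded sets, as `h → 0` and `τ = T / M → 0`
    -- subject to the CFL condition `(1 - θ) τ ≤ h ^ σ / (L_F C_σ)`
    ∀ u, ThetaScheme.IsViscositySolution σ T F f u₀ u →
      ∀ R : ℝ, ∀ ε : ℝ, 0 < ε → ∃ δ : ℝ, 0 < δ ∧
        ∀ h : ℝ, 0 < h → h < δ → ∀ M : ℕ, 0 < M → T / M < δ →
          (1 - θ) * (T / M) * (LF * ThetaScheme.cflConst N σ) ≤ h ^ σ →
            (∀ U, ThetaScheme.IsGridSolution σ θ F f u₀ h (T / M) M U →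
              ∀ n ≤ M, ∀ i : Fin N → ℤ, ‖ThetaScheme.gridPoint h i‖ ≤ R →
                |U n i - u (ThetaScheme.gridPoint h i) (n * (T / M))| ≤ ε) ∧
            (∀ U, ThetaScheme.IsSpaceSolution σ θ T F f u₀ h (T / M) U →
              ∀ x, ‖x‖ ≤ R → ∀ t ∈ Set.Icc (0 : ℝ) T, |U x t - u x t| ≤ ε) := by
  have hF' : ThetaScheme.OneSidedLipschitz F LF := hF
  refine ⟨fun h _ M hM => ?_, fun h _ M hM => ?_,
    ThetaScheme.exists_viscositySolution hN hσ hθ hF' hT hf_bdd hf_cont hu₀_bdd hu₀_cont,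
    fun u hu R ε hε => ?_⟩
  · obtain ⟨U, hU⟩ := ThetaScheme.exists_gridSolution hσ hT hθ hF' hf_bdd hu₀_bdd h hM
    exact ⟨U, hU, fun V hV n hn i =>
      congrFun (ThetaScheme.gridSolution_unique hσ hθ hF' (by positivity) hU hV n hn) i⟩
  · obtain ⟨U, hU⟩ := ThetaScheme.exists_spaceSolution hσ hT hθ hF' hf_bdd hu₀_bdd h hM
    exact ⟨U, hU, fun V hV => ThetaScheme.spaceSolution_unique hσ hθ hF'
      (div_pos hT (by exact_mod_cast hM)) hU hV⟩
  · obtain ⟨δ, hδ, hconv⟩ := ThetaScheme.spaceSolution_tendsto hN hσ hθ hF' hT hf_bdd hf_cont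
      hu₀_bdd hu₀_cont hu R hε
    refine ⟨δ, hδ, fun h hh hhδ M hM hMδ hcfl => ⟨fun V hV n hn i hi => ?_,
      hconv h hh hhδ M hM hMδ hcfl⟩⟩
    -- By uniqueness the given grid solution is the restriction of this whole-space solution, to
    -- which the convergence applies.
    obtain ⟨U, hU⟩ := ThetaScheme.exists_spaceSolution hσ hT hθ hF' hf_bdd hu₀_bdd h hM
    have hM' : (0 : ℝ) < M := by exact_mod_cast hM
    have hn' : (n : ℝ) ≤ M := by exact_mod_cast hn
    have h1 := congrFun (ThetaScheme.gridSolution_unique hσ hθ hF' (by positivity) hV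
      (hU.gridSolution hT hM) n hn) i
    have h2 := hconv h hh hhδ M hM hMδ hcfl U hU (ThetaScheme.gridPoint h i) hi (n * (T / M))
      ⟨by positivity, by rw [← mul_div_assoc, div_le_iff₀ hM']; nlinarith⟩
    rwa [← h1]
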